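/- **Setting.** Let $C>0$, let $\nu$ be a probability measure on $[C^{-1},C]$, let $\mathbb P=\nu^{\otimes\mathbb Z}$ be the law of the i.i.d. disorder $\mathbf m=(m_x)_{x\in\mathbb Z}$, let $\mu_1$ be the product of standard Gaussian laws on $\mathbb R^{\mathbb Z}$, and write $\mathbb E^\star$ for expectation under $\mathbb P^\star=\mathbb P\otimes\mu_1$. For $\lambda,\gamma>0$ let $\mathcal L^{\mathbf m}=\mathcal A^{\mathbf m}+\mathcal S$ act on cylinder functions of $(\mathbf m,\omega)$, where $$\mathcal A^{\mathbf m}=\sum_{x\in\mathbb Z}\Big(\frac{\omega_{x+1}}{\sqrt{m_xm_{x+1}}}-\frac{\omega_{x-1}}{\sqrt{m_{x-1}m_x}}\Big)\frac{\partial}{\partial\omega_x},\qquad \mathcal S f(\omega)=\gamma\sum_x\big[f(\omega^x)-f(\omega)\big]+\lambda\sum_x\big[f(\omega^{x,x+1})-f(\omega)\big],$$ $\omega^x$ being $\omega$ with $\omega_x$ replaced by $-\omega_x$, and $\omega^{x,x+1}$ being $\omega$ with $\omega_x,\omega_{x+1}$ exchanged; put $\mathcal L^{\mathbf m,\star}=\mathcal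 S-\mathcal A^{\mathbf m}$. Let $$j^A_{0,1}=\frac{2\omega_0\omega_1}{\sqrt{m_0m_1}},\quad j^S_{0,1}=\lambda(\omega_1^2-\omega_0^2),\quad j_{0,1}=j^S_{0,1}+j^A_{0,1},\quad j^\star_{0,1}=j^S_{0,1}-j^A_{0,1}.$$ Let $\tau_x$ denote the translation by $x$ of both disorder and configuration. Let $\mathcal C$ be the space of measurable cylinder functions in $L^2(\mathbb P^\star)$ that are continuous in $\mathbf m$ for every $\omega$ and, for every $\mathbf m$, lie in $L^2(\mu_1)$ with zero $\mu_1$-mean. Let $\mathcal Q\subset\mathcal C$ be the set of the functions $$\sum_i\psi_{i,i}(\mathbf m)(\omega_{i+1}^2-\omega_i^2)+\sum_{i\ne j}\psi_{i,j}(\mathbf m)\omega_i\omega_j$$ with $\psi_{i,j}=\psi_{j,i}$ continuous cylinder functions of $\mathbf m$, all but finitely many of them zero. Set $$\ll g,h\gg_\star=\sum_{x\in\mathbb Z}\mathbb E^\star[g\,\tau_xh],\qquad \ll g\gg_{\star\star}=\sum_{x\in\mathbb Z}x\,\mathbb E^\star[g\,\omega_x^2],\qquad \chi(1)=\mathrm{Var}_{\mu_1}(\omega_0^2)=2.$$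 Let $\mathbf L^2_\star$ be the Hilbert space completion of $\mathcal C$ for $\ll\cdot,\cdot\gg_\star$, and, on it, let $\mathcal L^{\mathbf m}$ be the closure of the operator $f\mapsto\mathcal L^{\mathbf m}f$ defined on those $f\in\mathcal C$ with $\mathcal L^{\mathbf m}f\in\mathcal C$ that are continuously differentiable in $\omega$ and, together with their first derivatives, of at most polynomial growth in finitely many coordinates of $\omega$, uniformly in $\mathbf m$. With $\Gamma_g=\sum_x\tau_xg$ (a formal sum), and $\nabla_0 F=F(\mathbf m,\omega^0)-F(\mathbf m,\omega)$, $\nabla_{0,1}F=F(\mathbf m,\omega^{0,1})-F(\mathbf m,\omega)$, set $$|||\varphi|||_1^2=\sup_{g\in\mathcal Q,\,a\in\mathbb R}\Big\{2\ll\varphi,g\gg_\star+2a\ll\varphi\gg_{\star\star}-\tfrac\gamma2\mathbb E^\star\big[(\nabla_0\Gamma_g)^2\big]-\tfrac\lambda2\mathbb E^\star\big[(a(\omega_1^2-\omega_0^2)+\nabla_{0,1}\Gamma_g)^2\big]\Big\}.$$ **Theorem.** For all $\lambda,\gamma>0$: for every $z>0$ the resolvent equation $(z-\mathcal L^{\mathbf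 m})h_z=j^A_{0,1}$ has a unique solution $h_z=(z-\mathcal L^{\mathbf m})^{-1}j^A_{0,1}$ in $\mathbf L^2_\star$; the limit $$\overline D=\lambda+\frac12\lim_{z\to0,\ z>0}\ll j^A_{0,1},(z-\mathcal L^{\mathbf m})^{-1}j^A_{0,1}\gg_\star$$ exists and is finite; and $\overline D$ coincides with the diffusion coefficient $D$ of the non-gradient method, in each of its forms: $$\overline D=\lambda+\frac1{\chi(1)}\inf_{f\in\mathcal Q}\sup_{g\in\mathcal Q}\Big\{\ll f,-\mathcal Sf\gg_\star+2\ll j^A_{0,1}-\mathcal A^{\mathbf m}f,g\gg_\star-\ll g,-\mathcal Sg\gg_\star\Big\},$$ $$\overline D=\frac1{\chi(1)}\inf_{f\in\mathcal Q}|||j^\star_{0,1}-\mathcal L^{\mathbf m,\star}f|||_1^2,$$ and $\overline D$ is the unique real number $a$ such that $\inf_{f\in\mathcal Q}|||j_{0,1}-a(\omega_1^2-\omega_0^2)-\mathcal L^{\mathbf m}f|||_1=0$. -/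

import Mathlib

open MeasureTheory ProbabilityTheory Filter Topology

noncomputable section

namespace DisorderedChain

/-! ## Configurations, shifts and equilibrium measures -/

/-- Disorder configurations `m ∈ [C⁻¹, C]^ℤ`. -/
abbrev Disorder (C : ℝ) := ℤ → Set.Icc C⁻¹ C

/-- Particle configurations `ω ∈ ℝ^ℤ`. -/
abbrev Config := ℤ → ℝ

/-- Real functions of the disorder and of the particle configuration. -/
abbrev Obs (C : ℝ) := Disorder C → Config → ℝ

/-- Translation of a configuration: `(τ_x η)_z = η_{x+z}`. -/
def shift {α : Type*} (x : ℤ) (η : ℤ → α) : ℤ → α := fun z => η (x + z)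

/-- The configuration with the value at `x` flipped. -/
def flipSite (x : ℤ) (ω : Config) : Config := Function.update ω x (-(ω x))

/-- The configuration with the values at `x` and `x + 1` exchanged. -/
def exch (x : ℤ) (ω : Config) : Config := fun z => ω (Equiv.swap x (x + 1) z)

variable {C : ℝ}

/-- Translation of a function: `τ_x f (m, ω) = f (τ_x m, τ_x ω)`. -/
def trans (x : ℤ) (f : Obs C) : Obs C := fun m ω => f (shift x m) (shift x ω)

/-- The Gibbs measure at inverse temperature one: product of standard Gaussians. -/
def gibbs : Measure Config := Measure.infinitePi (fun _ : ℤ => gaussianReal 0 1)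

/-- The law of the i.i.d. disorder with one-site law `ν`. -/
def disorderLaw (ν : Measure (Set.Icc C⁻¹ C)) : Measure (Disorder C) :=
  Measure.infinitePi (fun _ : ℤ => ν)

/-- The annealed equilibrium measure `ℙ⋆ = ℙ ⊗ μ₁`. -/
def annealed (ν : Measure (Set.Icc C⁻¹ C)) : Measure (Disorder C × Config) :=
  (disorderLaw ν).prod gibbs

/-- Expectation with respect to `ℙ⋆`. -/
def expect (ν : Measure (Set.Icc C⁻¹ C)) (f : Obs C) : ℝ :=
  ∫ p, f p.1 p.2 ∂(annealed ν)

/-! ## Cylinder functions -/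

/-- `f` depends only on the disorder and particle coordinates in the set `s`. -/
def DependsOnBox (f : Obs C) (s : Finset ℤ) : Prop :=
  ∀ m m' ω ω', (∀ x ∈ s, m x = m' x) → (∀ x ∈ s, ω x = ω' x) → f m ω = f m' ω'

/-- The space `𝒞` of cylinder functions: continuous in the disorder, square integrable, and
centred with respect to the Gibbs measure for every realization of the disorder. -/
structure IsLocal (ν : Measure (Set.Icc C⁻¹ C)) (f : Obs C) : Prop where
  cylinder : ∃ s, DependsOnBox f s
  measurable : Measurable (fun p : Disorder C × Config => f p.1 p.2)
  continuous_disorder : ∀ ω, Continuous (fun m => f m ω)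
  memLp_gibbs : ∀ m, MemLp (f m) 2 gibbs
  mean_zero : ∀ m, ∫ ω, f m ω ∂gibbs = 0
  memLp_annealed : MemLp (fun p : Disorder C × Config => f p.1 p.2) 2 (annealed ν)

/-- The space `𝒬` of quadratic cylinder functions. -/
def quadratic (C : ℝ) : Set (Obs C) :=
  {f | ∃ (s : Finset ℤ) (ψ : ℤ → ℤ → Disorder C → ℝ),
    (∀ i j, ∃ t : Finset ℤ, ∀ m m', (∀ x ∈ t, m x = m' x) → ψ i j m = ψ i j m') ∧
    (∀ i j, Continuous (ψ i j)) ∧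
    (∀ i j, ψ i j = ψ j i) ∧
    (∀ i j, ¬ (i ∈ s ∧ j ∈ s) → ψ i j = 0) ∧
    ∀ m ω, f m ω = ∑ i ∈ s, ψ i i m * (ω (i + 1) ^ 2 - ω i ^ 2)
      + ∑ i ∈ s, ∑ j ∈ s.erase i, ψ i j m * (ω i * ω j)}

/-! ## The generator -/

/-- `∂f/∂ω_x`. -/
def partialDeriv (x : ℤ) (f : Obs C) : Obs C :=
  fun m ω => deriv (fun t => f m (Function.update ω x t)) (ω x)

/-- The antisymmetric (Hamiltonian) part `𝒜^m` of the generator. -/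
def genA (f : Obs C) : Obs C := fun m ω =>
  ∑' x : ℤ, (ω (x + 1) / √((m x : ℝ) * m (x + 1)) - ω (x - 1) / √((m (x - 1) : ℝ) * m x))
    * partialDeriv x f m ω

/-- The symmetric part `𝒮 = γ 𝒮^flip + λ 𝒮^exch` of the generator. -/
def genS (lam gam : ℝ) (f : Obs C) : Obs C := fun m ω =>
  gam * ∑' x : ℤ, (f m (flipSite x ω) - f m ω) + lam * ∑' x : ℤ, (f m (exch x ω) - f m ω)

/-- The generator `ℒ^m = 𝒜^m + 𝒮`. -/
def gen (lam gam : ℝ) (f : Obs C) : Obs C := genA f + genS lam gam f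

/-- The formal adjoint `ℒ^{m,⋆} = 𝒮 - 𝒜^m`. -/
def genAdj (lam gam : ℝ) (f : Obs C) : Obs C := genS lam gam f - genA f

/-! ## Energy currents and the gradient of the energy -/

/-- The antisymmetric current `j^A_{0,1}`. -/
def currentA : Obs C := fun m ω => 2 * ω 0 * ω 1 / √((m 0 : ℝ) * m 1)

/-- The energy gradient `ω₁² - ω₀²`. -/
def gradEnergy : Obs C := fun _ ω => ω 1 ^ 2 - ω 0 ^ 2

/-- The symmetric current `j^S_{0,1} = λ (ω₁² - ω₀²)`. -/
def currentS (lam : ℝ) : Obs C := lam • gradEnergy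

/-- The total current `j_{0,1} = j^A_{0,1} + j^S_{0,1}`. -/
def current (lam : ℝ) : Obs C := currentA + currentS lam

/-- `j⋆_{0,1} = j^S_{0,1} - j^A_{0,1}`. -/
def currentAdj (lam : ℝ) : Obs C := currentS lam - currentA

/-! ## Semi-inner products and the variational diffusion coefficient -/

/-- The static compressibility `χ(1)`, the variance of `ω₀²`. -/
def compressibility : ℝ :=
  ∫ t, t ^ 4 ∂(gaussianReal 0 1) - (∫ t, t ^ 2 ∂(gaussianReal 0 1)) ^ 2

/-- `≪g, h≫_⋆ = ∑_x 𝔼⋆[g τ_x h]`. -/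
def starProd (ν : Measure (Set.Icc C⁻¹ C)) (g h : Obs C) : ℝ :=
  ∑' x : ℤ, expect ν (g * trans x h)

/-- `≪g≫_⋆⋆ = ∑_x x 𝔼⋆[g ω_x²]`. -/
def starStar (ν : Measure (Set.Icc C⁻¹ C)) (g : Obs C) : ℝ :=
  ∑' x : ℤ, (x : ℝ) * expect ν (fun m ω => g m ω * ω x ^ 2)

/-- `∇₀ Γ_g` for the formal sum `Γ_g = ∑_x τ_x g`. -/
def gradFlip (g : Obs C) : Obs C := fun m ω =>
  ∑' x : ℤ, (trans x g m (flipSite 0 ω) - trans x g m ω)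

/-- `∇_{0,1} Γ_g` for the formal sum `Γ_g = ∑_x τ_x g`. -/
def gradExch (g : Obs C) : Obs C := fun m ω =>
  ∑' x : ℤ, (trans x g m (exch 0 ω) - trans x g m ω)

/-- The Dirichlet form `𝒟₀(ℙ⋆; a ω₀² + Γ_g)`; note that `∇₀ ω₀² = 0` and that
`∇_{0,1} ω₀² = ω₁² - ω₀²`. -/
def dirichlet (ν : Measure (Set.Icc C⁻¹ C)) (lam gam a : ℝ) (g : Obs C) : ℝ :=
  gam / 2 * expect ν (fun m ω => gradFlip g m ω ^ 2)
    + lam / 2 * expect ν (fun m ω => (a * (ω 1 ^ 2 - ω 0 ^ 2) + gradExch g m ω) ^ 2)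

/-- The squared semi-norm
`|||φ|||₁² = sup_{g ∈ 𝒬, a ∈ ℝ} {2≪φ,g≫_⋆ + 2a≪φ≫_⋆⋆ - 𝒟₀(ℙ⋆; a ω₀² + Γ_g)}`. -/
def tripleNormSq (ν : Measure (Set.Icc C⁻¹ C)) (lam gam : ℝ) (φ : Obs C) : EReal :=
  ⨆ g ∈ quadratic C, ⨆ a : ℝ,
    ((2 * starProd ν φ g + 2 * a * starStar ν φ - dirichlet ν lam gam a g : ℝ) : EReal)

/-- The diffusion coefficient
`λ + χ(1)⁻¹ inf_{f ∈ 𝒬} sup_{g ∈ 𝒬} {≪f,-𝒮f≫_⋆ + 2≪j^A_{0,1} - 𝒜^m f, g≫_⋆ - ≪g,-𝒮g≫_⋆}`. -/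
def minimaxD (ν : Measure (Set.Icc C⁻¹ C)) (lam gam : ℝ) : EReal :=
  (lam : EReal) + ((1 / compressibility : ℝ) : EReal) *
    ⨅ f ∈ quadratic C, ⨆ g ∈ quadratic C,
      ((starProd ν f (-genS lam gam f) + 2 * starProd ν (currentA - genA f) g
        - starProd ν g (-genS lam gam g) : ℝ) : EReal)

/-- The diffusion coefficient `χ(1)⁻¹ inf_{f ∈ 𝒬} |||j⋆_{0,1} - ℒ^{m,⋆} f|||₁²`. -/
def normD (ν : Measure (Set.Icc C⁻¹ C)) (lam gam : ℝ) : EReal :=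
  ((1 / compressibility : ℝ) : EReal) *
    ⨅ f ∈ quadratic C, tripleNormSq ν lam gam (currentAdj lam - genAdj lam gam f)

/-- `D` is a non-gradient diffusion coefficient if `j_{0,1} - D (ω₁² - ω₀²)` lies in the closure
of `ℒ^m 𝒬` for the semi-norm `|||·|||₁`. -/
def IsNonGradientCoeff (ν : Measure (Set.Icc C⁻¹ C)) (lam gam D : ℝ) : Prop :=
  ∀ ε : ℝ, 0 < ε → ∃ f ∈ quadratic C,
    tripleNormSq ν lam gam (current lam - D • gradEnergy - gen lam gam f) < (ε : EReal)

/-! ## Auxiliary facts: `≪·,·≫_⋆` is a positive semi-definite form on cylinder functions -/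

section Facts

variable {ν : Measure (Set.Icc C⁻¹ C)}

instance : IsProbabilityMeasure gibbs := by unfold gibbs; infer_instance

instance [IsProbabilityMeasure ν] : IsProbabilityMeasure (disorderLaw ν) := by
  unfold disorderLaw; infer_instance

instance [IsProbabilityMeasure ν] : IsProbabilityMeasure (annealed ν) := by
  unfold annealed; infer_instance

lemma shift_shift {α : Type*} (x y : ℤ) (η : ℤ → α) :
    shift x (shift y η) = shift (x + y) η := by
  funext z; simp only [shift]; congr 1; ring

lemma measurable_shift {α : Type*} [MeasurableSpace α] (x : ℤ) :
    Measurable (shift x : (ℤ → α) → ℤ → α) :=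
  measurable_pi_lambda _ fun z => measurable_pi_apply (x + z)

lemma measurePreserving_shift {α : Type*} [MeasurableSpace α] (P : Measure α)
    [IsProbabilityMeasure P] (x : ℤ) :
    MeasurePreserving (shift x : (ℤ → α) → ℤ → α) (Measure.infinitePi fun _ => P)
      (Measure.infinitePi fun _ => P) :=
  ⟨measurable_shift x, Measure.map_infinitePi_infinitePi_of_inj (P := fun _ : ℤ => P)
    (f := fun z : ℤ => x + z) (add_right_injective x)⟩

lemma measurePreserving_annealed [IsProbabilityMeasure ν] (x : ℤ) :
    MeasurePreserving (Prod.map (shift x) (shift x)) (annealed ν) (annealed ν) :=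
  (measurePreserving_shift ν x).prod (measurePreserving_shift (gaussianReal 0 1) x)

lemma expect_trans [IsProbabilityMeasure ν] {f : Obs C}
    (hf : Measurable (fun p : Disorder C × Config => f p.1 p.2)) (x : ℤ) :
    expect ν (trans x f) = expect ν f := by
  have h := measurePreserving_annealed (ν := ν) x
  unfold expect
  conv_rhs => rw [← h.map_eq]
  rw [integral_map h.measurable.aemeasurable hf.aestronglyMeasurable]
  rfl

lemma trans_trans (x y : ℤ) (f : Obs C) : trans x (trans y f) = trans (y + x) f := by
  funext m ω; simp only [trans, shift_shift]

lemma trans_zero (f : Obs C) : trans 0 f = f := by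
  have h : ∀ {α : Type} (η : ℤ → α), shift 0 η = η := fun η => by funext z; simp [shift]
  funext m ω; simp only [trans, h]

lemma trans_mul (x : ℤ) (f g : Obs C) : trans x (f * g) = trans x f * trans x g := rfl

namespace IsLocal

variable {f g h : Obs C}

lemma memLp_trans [IsProbabilityMeasure ν] (hf : IsLocal ν f) (x : ℤ) :
    MemLp (fun p : Disorder C × Config => trans x f p.1 p.2) 2 (annealed ν) :=
  hf.memLp_annealed.comp_measurePreserving (measurePreserving_annealed x)

lemma measurable_trans (hf : IsLocal ν f) (x : ℤ) :
    Measurable (fun p : Disorder C × Config => trans x f p.1 p.2) :=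
  hf.measurable.comp ((measurable_shift x).prodMap (measurable_shift x))

lemma integrable_mul_trans [IsProbabilityMeasure ν] (hf : IsLocal ν f) (hg : IsLocal ν g)
    (x y : ℤ) :
    Integrable (fun p : Disorder C × Config => trans x f p.1 p.2 * trans y g p.1 p.2)
      (annealed ν) :=
  (hf.memLp_trans x).integrable_mul (hg.memLp_trans y)

lemma measurable_section (hf : IsLocal ν f) (m : Disorder C) : Measurable (f m) :=
  hf.measurable.comp (measurable_const.prodMk measurable_id)

lemma expect_eq_zero [IsProbabilityMeasure ν] (hf : IsLocal ν f) (hg : IsLocal ν g)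
    {s t : Finset ℤ} (hs : DependsOnBox f s) (ht : DependsOnBox g t) {x : ℤ}
    (hx : x ∉ Finset.image₂ (fun a b => a - b) s t) :
    expect ν (f * trans x g) = 0 := by
  classical
  have hint : Integrable (fun p : Disorder C × Config => f p.1 p.2 * trans x g p.1 p.2)
      (annealed ν) := by
    have := hf.integrable_mul_trans hg 0 x
    rwa [trans_zero] at this
  have : expect ν (f * trans x g) =
      ∫ m, ∫ ω, f m ω * trans x g m ω ∂gibbs ∂(disorderLaw ν) :=
    integral_prod _ hint
  rw [this]
  refine integral_eq_zero_of_ae (Eventually.of_forall fun m => ?_)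
  let t' : Finset ℤ := t.image (fun z => x + z)
  have hdisj : Disjoint s t' := by
    rw [Finset.disjoint_left]
    intro a ha ha'
    obtain ⟨b, hb, rfl⟩ := Finset.mem_image.1 ha'
    exact hx (Finset.mem_image₂.2 ⟨x + b, ha, b, hb, by ring⟩)
  let ext : (u : Finset ℤ) → (u → ℝ) → Config :=
    fun u v z => if hz : z ∈ u then v ⟨z, hz⟩ else 0
  have hext : ∀ u, Measurable (ext u) := by
    intro u
    refine measurable_pi_lambda _ fun z => ?_
    by_cases hz : z ∈ u
    · simpa [ext, hz] using measurable_pi_apply (⟨z, hz⟩ : u)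
    · simp [ext, hz]
  have hmg : Measurable (trans x g m) :=
    (hg.measurable_section (shift x m)).comp (measurable_shift x)
  have hind : IndepFun (fun ω : Config => fun i : s => ω i) (fun ω : Config => fun i : t' => ω i)
      gibbs := by
    have h0 : iIndepFun (fun (i : ℤ) (ω : Config) => ω i) gibbs :=
      iIndepFun_infinitePi (P := fun _ : ℤ => gaussianReal 0 1) (X := fun _ a => a)
        (fun _ => measurable_id)
    exact h0.indepFun_finset s t' hdisj fun i => measurable_pi_apply i
  have hind2 := hind.comp ((hf.measurable_section m).comp (hext s)) (hmg.comp (hext t'))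
  have e1 : (f m ∘ ext s) ∘ (fun ω : Config => fun i : s => ω i) = f m := by
    funext ω
    exact hs _ _ _ _ (fun _ _ => rfl) fun z hz => by simp [ext, hz]
  have e2 : (trans x g m ∘ ext t') ∘ (fun ω : Config => fun i : t' => ω i) = trans x g m := by
    funext ω
    refine ht _ _ _ _ (fun _ _ => rfl) fun z hz => ?_
    have : x + z ∈ t' := Finset.mem_image_of_mem _ hz
    simp [ext, shift, this]
  rw [e1, e2] at hind2
  have := hind2.integral_fun_mul_eq_mul_integral
    (hf.measurable_section m).aestronglyMeasurable hmg.aestronglyMeasurable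
  rw [hf.mean_zero m, zero_mul] at this
  exact this

lemma finite_support [IsProbabilityMeasure ν] (hf : IsLocal ν f) (hg : IsLocal ν g) :
    (Function.support fun x => expect ν (f * trans x g)).Finite := by
  classical
  obtain ⟨s, hs⟩ := hf.cylinder
  obtain ⟨t, ht⟩ := hg.cylinder
  refine (Finset.finite_toSet (Finset.image₂ (fun a b => a - b) s t)).subset fun x hx => ?_
  by_contra hx'
  exact hx (hf.expect_eq_zero hg hs ht hx')

lemma summable [IsProbabilityMeasure ν] (hf : IsLocal ν f) (hg : IsLocal ν g) :
    Summable fun x => expect ν (f * trans x g) :=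
  summable_of_hasFiniteSupport (hf.finite_support hg)

lemma expect_trans_mul_trans [IsProbabilityMeasure ν] (hf : IsLocal ν f) (hg : IsLocal ν g)
    (i j : ℤ) : expect ν (trans i f * trans j g) = expect ν (f * trans (j - i) g) := by
  have := expect_trans (ν := ν) (f := f * trans (j - i) g)
    (hf.measurable.mul (hg.measurable_trans _)) i
  rw [← this, trans_mul, trans_trans]
  congr 3; ring

lemma star_comm [IsProbabilityMeasure ν] (hf : IsLocal ν f) (hg : IsLocal ν g) :
    starProd ν f g = starProd ν g f := by
  unfold starProd
  rw [← (Equiv.neg ℤ).tsum_eq]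
  refine tsum_congr fun x => ?_
  have h := hf.expect_trans_mul_trans hg x 0
  rw [trans_zero, zero_sub] at h
  rw [Equiv.neg_apply, ← h, mul_comm]

lemma add [IsProbabilityMeasure ν] (hf : IsLocal ν f) (hg : IsLocal ν g) :
    IsLocal ν (f + g) where
  cylinder := by
    classical
    obtain ⟨s, hs⟩ := hf.cylinder
    obtain ⟨t, ht⟩ := hg.cylinder
    refine ⟨s ∪ t, fun m m' ω ω' h1 h2 => ?_⟩
    simp only [Pi.add_apply]
    rw [hs m m' ω ω' (fun x hx => h1 x (Finset.mem_union_left _ hx))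
        (fun x hx => h2 x (Finset.mem_union_left _ hx)),
      ht m m' ω ω' (fun x hx => h1 x (Finset.mem_union_right _ hx))
        (fun x hx => h2 x (Finset.mem_union_right _ hx))]
  measurable := hf.measurable.add hg.measurable
  continuous_disorder ω := (hf.continuous_disorder ω).add (hg.continuous_disorder ω)
  memLp_gibbs m := (hf.memLp_gibbs m).add (hg.memLp_gibbs m)
  mean_zero m := by
    have := integral_add ((hf.memLp_gibbs m).integrable one_le_two)
      ((hg.memLp_gibbs m).integrable one_le_two)
    rw [hf.mean_zero, hg.mean_zero, add_zero] at this
    exact this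
  memLp_annealed := hf.memLp_annealed.add hg.memLp_annealed

lemma smul (c : ℝ) (hf : IsLocal ν f) : IsLocal ν (c • f) where
  cylinder := by
    obtain ⟨s, hs⟩ := hf.cylinder
    exact ⟨s, fun m m' ω ω' h1 h2 => by
      simp only [Pi.smul_apply]; rw [hs m m' ω ω' h1 h2]⟩
  measurable := hf.measurable.const_smul c
  continuous_disorder ω := (hf.continuous_disorder ω).const_smul c
  memLp_gibbs m := (hf.memLp_gibbs m).const_smul c
  mean_zero m := by
    have := integral_smul (μ := gibbs) c (f m)
    rw [hf.mean_zero, smul_zero] at this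
    exact this
  memLp_annealed := hf.memLp_annealed.const_smul c

lemma zero : IsLocal ν (0 : Obs C) where
  cylinder := ⟨∅, fun _ _ _ _ _ _ => rfl⟩
  measurable := measurable_const
  continuous_disorder _ := continuous_const
  memLp_gibbs _ := MemLp.zero
  mean_zero _ := by simp
  memLp_annealed := MemLp.zero

lemma star_add_left [IsProbabilityMeasure ν] (hf : IsLocal ν f) (hg : IsLocal ν g)
    (hh : IsLocal ν h) : starProd ν (f + g) h = starProd ν f h + starProd ν g h := by
  unfold starProd
  rw [← (hf.summable hh).tsum_add (hg.summable hh)]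
  refine tsum_congr fun x => ?_
  have i1 := hf.integrable_mul_trans hh 0 x
  have i2 := hg.integrable_mul_trans hh 0 x
  rw [trans_zero] at i1 i2
  unfold expect
  refine Eq.trans (integral_congr_ae (Eventually.of_forall fun p => ?_)) (integral_add i1 i2)
  simp only [Pi.mul_apply, Pi.add_apply]
  ring

lemma star_smul_left (c : ℝ) : starProd ν (c • f) g = c * starProd ν f g := by
  unfold starProd
  rw [← tsum_mul_left]
  refine tsum_congr fun x => ?_
  unfold expect
  rw [← integral_const_mul]
  refine integral_congr_ae (Eventually.of_forall fun p => ?_)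
  simp only [Pi.mul_apply, Pi.smul_apply, smul_eq_mul]
  ring

/-- Positivity of `≪f, f≫_⋆`, through its expression as an asymptotic variance per site. -/
lemma star_self_nonneg [IsProbabilityMeasure ν] (hf : IsLocal ν f) : 0 ≤ starProd ν f f := by
  classical
  set a : ℤ → ℝ := fun x => expect ν (f * trans x f) with ha
  have hsum : Summable a := hf.summable hf
  obtain ⟨R, hR⟩ : ∃ R : ℕ, ∀ x : ℤ, a x ≠ 0 → |x| ≤ R := by
    obtain ⟨R, hR⟩ := ((hf.finite_support hf).image Int.natAbs).bddAbove
    refine ⟨R, fun x hx => ?_⟩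
    have := hR (Set.mem_image_of_mem Int.natAbs (show x ∈ Function.support a from hx))
    rw [Int.abs_eq_natAbs]
    exact_mod_cast this
  set B : ℝ := ∑' x, |a x| with hB
  have hB0 : 0 ≤ B := tsum_nonneg fun x => abs_nonneg _
  have key : ∀ M : ℕ, -((2 * R : ℕ) * B) ≤ M * starProd ν f f := by
    intro M
    set I : Finset ℤ := Finset.Ico 0 (M : ℤ) with hI
    set J : Finset ℤ := Finset.Ico (-(R : ℤ)) (M + R) with hJ
    have hIJ : I ⊆ J := by
      intro x hx
      rw [hI, Finset.mem_Ico] at hx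
      rw [hJ, Finset.mem_Ico]
      omega
    have e1 : ∀ i ∈ I, ∑ j ∈ J, a (j - i) = starProd ν f f := by
      intro i hi
      have h1 : ∑' j, a (j - i) = starProd ν f f := (Equiv.subRight i).tsum_eq a
      rw [← h1, tsum_eq_sum]
      intro j hj
      by_contra hne
      have := abs_le.1 (hR _ hne)
      rw [hI, Finset.mem_Ico] at hi
      rw [hJ, Finset.mem_Ico] at hj
      omega
    have e2 : (M : ℝ) * starProd ν f f = ∑ i ∈ I, ∑ j ∈ J, a (j - i) := by
      rw [Finset.sum_congr rfl e1, Finset.sum_const, nsmul_eq_mul, hI]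
      simp
    have e3 : 0 ≤ ∑ i ∈ I, ∑ j ∈ I, a (j - i) := by
      have : ∑ i ∈ I, ∑ j ∈ I, a (j - i) =
          ∫ p, (∑ i ∈ I, trans i f p.1 p.2) ^ 2 ∂(annealed ν) := by
        have h2 : ∀ p : Disorder C × Config, (∑ i ∈ I, trans i f p.1 p.2) ^ 2 =
            ∑ i ∈ I, ∑ j ∈ I, trans i f p.1 p.2 * trans j f p.1 p.2 := by
          intro p
          rw [sq, Finset.sum_mul_sum]
        simp_rw [h2]
        rw [integral_finsetSum _ fun i _ =>
          integrable_finsetSum _ fun j _ => hf.integrable_mul_trans hf i j]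
        refine Finset.sum_congr rfl fun i _ => ?_
        rw [integral_finsetSum _ fun j _ => hf.integrable_mul_trans hf i j]
        refine Finset.sum_congr rfl fun j _ => ?_
        exact (hf.expect_trans_mul_trans hf i j).symm
      rw [this]
      exact integral_nonneg fun p => sq_nonneg _
    have e4 : ∑ i ∈ I, ∑ j ∈ J, a (j - i) =
        ∑ j ∈ J \ I, ∑ i ∈ I, a (j - i) + ∑ i ∈ I, ∑ j ∈ I, a (j - i) := by
      rw [Finset.sum_comm, ← Finset.sum_sdiff hIJ]
      congr 1
      exact Finset.sum_comm
    have e5 : ∀ j, -B ≤ ∑ i ∈ I, a (j - i) := by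
      intro j
      have h1 : ∑ i ∈ I, |a (j - i)| ≤ B := by
        rw [hB, ← (Equiv.subLeft j).tsum_eq (fun x => |a x|)]
        exact Summable.sum_le_tsum I (fun _ _ => abs_nonneg _)
          ((Equiv.subLeft j).summable_iff.2 hsum.abs)
      have h2 := Finset.abs_sum_le_sum_abs (fun i => a (j - i)) I
      exact (abs_le.1 (h2.trans h1)).1
    have e6 : -((2 * R : ℕ) * B) ≤ ∑ j ∈ J \ I, ∑ i ∈ I, a (j - i) := by
      have hcard : (J \ I).card = 2 * R := by
        rw [Finset.card_sdiff_of_subset hIJ, hI, hJ, Int.card_Ico, Int.card_Ico]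
        omega
      have := Finset.card_nsmul_le_sum (J \ I) (fun j => ∑ i ∈ I, a (j - i)) (-B)
        fun j _ => e5 j
      rw [hcard, nsmul_eq_mul] at this
      linarith
    rw [e2, e4]
    linarith
  by_contra hneg
  push Not at hneg
  obtain ⟨M, hM⟩ := exists_nat_gt ((2 * R : ℕ) * B / (-starProd ν f f))
  rw [div_lt_iff₀ (by linarith)] at hM
  linarith [key M]

end IsLocal

/-- The antisymmetric current is a cylinder function of the class `𝒞`. -/
lemma isLocal_currentA [IsProbabilityMeasure ν] (hC : 0 < C) :
    IsLocal ν (currentA : Obs C) := by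
  have hm : ∀ (m : Disorder C) (x : ℤ), C⁻¹ ≤ (m x : ℝ) := fun m x => (m x).2.1
  have hCi : 0 < C⁻¹ := inv_pos.2 hC
  have hpos : ∀ m : Disorder C, C⁻¹ ≤ √((m 0 : ℝ) * m 1) := fun m =>
    Real.le_sqrt_of_sq_le (by nlinarith [hm m 0, hm m 1])
  have hid : ∀ x : ℤ, MemLp (fun ω : Config => ω x) 4 gibbs := fun x =>
    (memLp_id_gaussianReal' (μ := 0) (v := 1) 4 (by simp)).comp_measurePreserving
      (measurePreserving_eval_infinitePi (fun _ : ℤ => gaussianReal 0 1) x)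
  have hprod : MemLp (fun ω : Config => ω 0 * ω 1) 2 gibbs := by
    have : ENNReal.HolderTriple 4 4 2 := ⟨by
      rw [← two_mul, show (4 : ENNReal) = 2 * 2 by norm_num,
        ENNReal.mul_inv (by simp) (by simp), ← mul_assoc,
        ENNReal.mul_inv_cancel (by simp) (by simp), one_mul]⟩
    exact (hid 1).mul (hid 0)
  have hform : ∀ (m : Disorder C) (ω : Config),
      currentA m ω = (2 / √((m 0 : ℝ) * m 1)) * (ω 0 * ω 1) := fun m ω => by
    simp only [currentA]; ring
  have hcont : Continuous fun m : Disorder C => 2 / √((m 0 : ℝ) * m 1) := by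
    refine continuous_const.div (by fun_prop) fun m => (hCi.trans_le (hpos m)).ne'
  have hmeas : Measurable (fun p : Disorder C × Config => currentA p.1 p.2) := by
    simp_rw [hform]
    have h1 : Measurable fun m : Disorder C => 2 / √((m 0 : ℝ) * m 1) := by fun_prop
    have h2 : Measurable fun ω : Config => ω 0 * ω 1 := by fun_prop
    exact (h1.comp measurable_fst).mul (h2.comp measurable_snd)
  refine ⟨⟨{0, 1}, ?_⟩, hmeas, ?_, ?_, ?_, ?_⟩
  · intro m m' ω ω' h1 h2
    simp only [currentA]
    rw [h1 0 (by simp), h1 1 (by simp), h2 0 (by simp), h2 1 (by simp)]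
  · intro ω
    simp_rw [hform]
    exact hcont.mul continuous_const
  · intro m
    have : (currentA m : Config → ℝ) = fun ω => (2 / √((m 0 : ℝ) * m 1)) * (ω 0 * ω 1) :=
      funext (hform m)
    rw [this]
    exact hprod.const_mul _
  · intro m
    simp_rw [hform]
    rw [integral_const_mul]
    have h0 : iIndepFun (fun (i : ℤ) (ω : Config) => ω i) gibbs :=
      iIndepFun_infinitePi (P := fun _ : ℤ => gaussianReal 0 1) (X := fun _ a => a)
        (fun _ => measurable_id)
    have h1 := (h0.indepFun (show (0 : ℤ) ≠ 1 by norm_num)).integral_fun_mul_eq_mul_integral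
      (measurable_pi_apply 0).aestronglyMeasurable (measurable_pi_apply 1).aestronglyMeasurable
    have h2 : ∫ ω : Config, ω 0 ∂gibbs = 0 := by
      have h3 := measurePreserving_eval_infinitePi (fun _ : ℤ => gaussianReal 0 1) 0
      have h4 : ∫ t, t ∂(gaussianReal 0 1) = ∫ ω : Config, ω 0 ∂gibbs := by
        rw [← h3.map_eq]
        exact integral_map h3.measurable.aemeasurable measurable_id.aestronglyMeasurable
      rw [← h4, integral_id_gaussianReal]
    rw [h1, h2]
    simp
  · have hsnd : MemLp (fun p : Disorder C × Config => p.2 0 * p.2 1) 2 (annealed ν) :=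
      hprod.comp_measurePreserving (measurePreserving_snd (μ := disorderLaw ν) (ν := gibbs))
    refine (hsnd.const_mul (2 * C)).mono hmeas.aestronglyMeasurable
      (Eventually.of_forall fun p => ?_)
    rw [hform, norm_mul, norm_mul (2 * C)]
    gcongr
    have h1 : 0 < √((p.1 0 : ℝ) * p.1 1) := hCi.trans_le (hpos p.1)
    rw [Real.norm_of_nonneg (by positivity), Real.norm_of_nonneg (by positivity),
      div_le_iff₀ h1]
    calc (2 : ℝ) = 2 * C * C⁻¹ := by field_simp
      _ ≤ 2 * C * √((p.1 0 : ℝ) * p.1 1) := by gcongr; exact hpos p.1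

end Facts

/-! ## The Hilbert space `L²_⋆` -/

/-- The space `𝒞` as a real vector space. -/
def localSubmodule (ν : Measure (Set.Icc C⁻¹ C)) [IsProbabilityMeasure ν] :
    Submodule ℝ (Obs C) where
  carrier := {f | IsLocal ν f}
  add_mem' := IsLocal.add
  zero_mem' := IsLocal.zero
  smul_mem' c _ hf := IsLocal.smul c hf

/-- The space `𝒞`, to be equipped with the semi-inner product `≪·,·≫_⋆`. -/
def Local (ν : Measure (Set.Icc C⁻¹ C)) [IsProbabilityMeasure ν] : Type :=
  localSubmodule ν

/-- An element of `𝒞`. -/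
def Local.mk {ν : Measure (Set.Icc C⁻¹ C)} [IsProbabilityMeasure ν] (f : Obs C)
    (hf : IsLocal ν f) : Local ν := (⟨f, hf⟩ : localSubmodule ν)

instance (ν : Measure (Set.Icc C⁻¹ C)) [IsProbabilityMeasure ν] : AddCommGroup (Local ν) :=
  inferInstanceAs (AddCommGroup (localSubmodule ν))

instance (ν : Measure (Set.Icc C⁻¹ C)) [IsProbabilityMeasure ν] : Module ℝ (Local ν) :=
  inferInstanceAs (Module ℝ (localSubmodule ν))

instance (ν : Measure (Set.Icc C⁻¹ C)) [IsProbabilityMeasure ν] :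
    PreInnerProductSpace.Core ℝ (Local ν) where
  inner f g := starProd ν f.1 g.1
  conj_inner_symm f g := IsLocal.star_comm g.2 f.2
  re_inner_nonneg f := IsLocal.star_self_nonneg f.2
  add_left f g h := IsLocal.star_add_left f.2 g.2 h.2
  smul_left _ _ c := IsLocal.star_smul_left c

instance (ν : Measure (Set.Icc C⁻¹ C)) [IsProbabilityMeasure ν] :
    SeminormedAddCommGroup (Local ν) :=
  InnerProductSpace.Core.toSeminormedAddCommGroup (𝕜 := ℝ)

instance (ν : Measure (Set.Icc C⁻¹ C)) [IsProbabilityMeasure ν] :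
    InnerProductSpace ℝ (Local ν) := .ofCore _

/-- The Hilbert space `L²_⋆`: the completion of `𝒞` for `≪·,·≫_⋆`. -/
abbrev HilbertStar (ν : Measure (Set.Icc C⁻¹ C)) [IsProbabilityMeasure ν] : Type :=
  UniformSpace.Completion (Local ν)

/-- The class in `L²_⋆` of a function of `𝒞`. -/
def toHilbert {ν : Measure (Set.Icc C⁻¹ C)} [IsProbabilityMeasure ν] (f : Obs C)
    (hf : IsLocal ν f) : HilbertStar ν := ((Local.mk f hf : Local ν) : HilbertStar ν)

lemma inner_toHilbert {ν : Measure (Set.Icc C⁻¹ C)} [IsProbabilityMeasure ν] {f g : Obs C}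
    (hf : IsLocal ν f) (hg : IsLocal ν g) :
    inner ℝ (toHilbert f hf) (toHilbert g hg) = starProd ν f g :=
  UniformSpace.Completion.inner_coe _ _

/-! ## The generator on `L²_⋆` and its resolvent -/

/-- Functions that are continuously differentiable in the particle variables, and that have, with
their first derivatives, at most polynomial growth, uniformly in the disorder. -/
structure IsSmooth (f : Obs C) : Prop where
  differentiable : ∀ m ω x, Differentiable ℝ (fun t => f m (Function.update ω x t))
  continuous_deriv : ∀ m x, Continuous (partialDeriv x f m)
  growth : ∃ (s : Finset ℤ) (K : ℝ) (n : ℕ), ∀ m ω x,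
    |f m ω| ≤ K * (1 + ∑ y ∈ s, |ω y|) ^ n ∧
    |partialDeriv x f m ω| ≤ K * (1 + ∑ y ∈ s, |ω y|) ^ n

/-- The graph of `ℒ^m` on the smooth cylinder functions of `𝒞` that are mapped to `𝒞`. -/
def generatorGraph (ν : Measure (Set.Icc C⁻¹ C)) [IsProbabilityMeasure ν] (lam gam : ℝ) :
    Set (HilbertStar ν × HilbertStar ν) :=
  {p | ∃ (f : Obs C) (hf : IsLocal ν f) (hLf : IsLocal ν (gen lam gam f)),
    IsSmooth f ∧ p = (toHilbert f hf, toHilbert (gen lam gam f) hLf)}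

/-- `u` solves the resolvent equation `(z - ℒ^m) u = v` in `L²_⋆`, where `ℒ^m` is the closure of
the generator defined on smooth cylinder functions: `(u, z u - v)` is in the closed graph. -/
def SolvesResolvent (ν : Measure (Set.Icc C⁻¹ C)) [IsProbabilityMeasure ν] (lam gam z : ℝ)
    (v u : HilbertStar ν) : Prop :=
  (u, z • u - v) ∈ closure (generatorGraph ν lam gam)

end DisorderedChain

end

/-! Let `K` be the completion of 𝒬 for the energy form ≪f, -𝒮g≫_⋆, with canonical map `i`. The heart
of the matter is a sector condition: |≪𝒜f, g≫_⋆| ≤ c ‖i f‖ ‖i g‖ on 𝒬, together with |≪j^A, g≫_⋆| ≤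
c' ‖i g‖. Thus 𝒜 becomes a bounded antisymmetric operator `B` on `K`, and j^A becomes a vector `k`.
Since ⟨Bx, x⟩ = 0, both 1 - B and 1 + B are onto. Let `h` solve (1 - B)h = k. Every coefficient in
the theorem equals λ + ‖h‖²/2.

Green-Kubo side. On the closed span of 𝒬 in L²_⋆ the map `i` extends to a bounded ι, and the
resolvent equation reads z u + ι*(1 - B)ι u = j^A. Lax-Milgram solves it; as z → 0, ι u_z → h, so
≪j^A, u_z≫_⋆ = ⟨k, ι u_z⟩ → ⟨k, h⟩ = ‖h‖² (`exists_resolvent_limit`). Uniqueness in all of L²_⋆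
follows from dissipativity of the closed generator (`SolvesResolvent.unique`), where antisymmetry of
𝒜 on smooth functions comes from Stein's identity.

Variational side. The suprema over g and a are Riesz representations, and the three formulas become
explicit quadratic minimisation problems on `K` (`iInf_norm_sq_add_norm_sub_sq`,
`iInf_norm_add_sub_sq`, `forall_exists_norm_add_sq_lt_iff`). The gradient ω₁² - ω₀² vanishes in L²_⋆
but has first moment 2, and ≪𝒜f≫_⋆⋆ = ≪f, j^A≫_⋆ (`starStar_genA`); this produces the scalar terms
of those problems.

Sector condition (`abs_starProd_genA_le`). Translations are invisible in L²_⋆, so a quadratic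
function has orthogonal coordinates r :ω₀²: and c_k :ω₀ω_k:, k ≥ 1. Flips multiply the off-diagonal
part by -4, which gives a gap 4γ there; exchanges give the diagonal part the energy 2λ‖r - τ₁r‖².
The operator 𝒜 is bounded on the off-diagonal part, sees the diagonal part only through r - τ₁r, and
has no diagonal-diagonal matrix element. -/

set_option linter.unusedSectionVars false

/-! ### Abstract Hilbert space theory: coercivity, vanishing viscosity, quadratic minimisation. -/

section HilbertSpace

variable {V : Type*} [AddCommGroup V] [Module ℝ V]
  {H : Type*} [NormedAddCommGroup H] [InnerProductSpace ℝ H]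
  {K : Type*} [NormedAddCommGroup K] [InnerProductSpace ℝ K]

/-- Lax-Milgram for the bilinear form ⟨Tx, y⟩: by uniqueness, the isomorphism attached to the form
is `T`. -/
lemma surjective_of_coercive [CompleteSpace K] (T : K →L[ℝ] K) {c : ℝ} (hc : 0 < c)
    (hT : ∀ x, c * ‖x‖ ^ 2 ≤ inner ℝ (T x) x) : Function.Surjective T := by
  let b : K →L[ℝ] K →L[ℝ] ℝ := (innerSL ℝ).comp T
  have hb : IsCoercive b := ⟨c, hc, fun x => by
    have := hT x
    simp only [b, ContinuousLinearMap.comp_apply, innerSL_apply_apply]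
    nlinarith⟩
  intro y
  obtain ⟨x, hx⟩ := hb.continuousLinearEquivOfBilin.surjective y
  refine ⟨x, ?_⟩
  rw [← hx]
  exact hb.unique_continuousLinearEquivOfBilin fun w => by simp [b]

/-- A functional that is bounded with respect to `‖i ·‖` is represented by a vector. -/
lemma exists_inner_eq_of_bound [CompleteSpace K] (i : V →ₗ[ℝ] K) (hi : DenseRange i)
    (l : V →ₗ[ℝ] ℝ) {c : ℝ}
    (hl : ∀ f, |l f| ≤ c * ‖i f‖) : ∃ k : K, ∀ f, inner ℝ k (i f) = l f := by
  refine ⟨(InnerProductSpace.toDual ℝ K).symm (l.extendOfNorm i), fun f => ?_⟩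
  rw [InnerProductSpace.toDual_symm_apply]
  exact LinearMap.extendOfNorm_eq hi ⟨c, hl⟩ f

/-- A bilinear form that is bounded with respect to `‖i ·‖` is represented by an operator. -/
lemma exists_operator_of_bound [CompleteSpace K] (i : V →ₗ[ℝ] K) (hi : DenseRange i)
    (b : V →ₗ[ℝ] V →ₗ[ℝ] ℝ)
    {c : ℝ} (hc : 0 ≤ c) (hb : ∀ f g, |b f g| ≤ c * ‖i f‖ * ‖i g‖) :
    ∃ B : K →L[ℝ] K, ∀ f g, inner ℝ (B (i f)) (i g) = b f g := by
  choose T hT using fun f => exists_inner_eq_of_bound i hi (b f) (c := c * ‖i f‖) (hb f)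
  have hext : ∀ x y : K, (∀ g, inner ℝ x (i g) = inner ℝ y (i g)) → x = y := fun x y h =>
    hi.eq_of_inner_left ℝ h
  let L : V →ₗ[ℝ] K :=
    { toFun := T
      map_add' := fun f g => hext _ _ fun k => by simp [inner_add_left, hT]
      map_smul' := fun a f => hext _ _ fun k => by simp [inner_smul_left, hT] }
  have hL : ∀ f, ‖L f‖ ≤ c * ‖i f‖ := by
    intro f
    have hle : ∀ k : K, inner ℝ (T f) k ≤ c * ‖i f‖ * ‖k‖ := by
      intro k
      refine hi.induction_on (p := fun k => inner ℝ (T f) k ≤ c * ‖i f‖ * ‖k‖) k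
        (isClosed_le (by fun_prop) (by fun_prop)) fun g => ?_
      rw [hT]
      exact (le_abs_self _).trans (hb f g)
    -- Testing against the vector itself turns the bound on the functional into a bound on its norm.
    have h := hle (T f)
    rw [real_inner_self_eq_norm_sq] at h
    change ‖T f‖ ≤ _
    by_contra hlt
    push Not at hlt
    have h0 : 0 ≤ c * ‖i f‖ := by positivity
    nlinarith
  refine ⟨L.extendOfNorm i, fun f g => ?_⟩
  rw [LinearMap.extendOfNorm_eq hi ⟨c, hL⟩]
  exact hT f g

/-- This replaces an extremum over 𝒬, taken in the extended reals, by the value at an explicit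
extremal point of the completion, which need not come from 𝒬. -/
lemma iSup_coe_eq_of_denseRange {X Y : Type*} [TopologicalSpace Y] {i : X → Y}
    (hi : DenseRange i) {F : Y → ℝ} (hF : Continuous F) {y : Y} (hy : ∀ x, F x ≤ F y) :
    ⨆ x, ((F (i x) : ℝ) : EReal) = (F y : EReal) := by
  refine le_antisymm (iSup_le fun x => EReal.coe_le_coe_iff.2 (hy _)) ?_
  refine EReal.ge_of_forall_gt_iff_ge.1 fun z hz => ?_
  obtain ⟨x, hx⟩ := hi.exists_mem_open (isOpen_lt continuous_const hF)
    (show {y | z < F y}.Nonempty from ⟨y, EReal.coe_lt_coe_iff.1 hz⟩)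
  exact (EReal.coe_le_coe_iff.2 hx.le).trans (le_iSup (fun x => ((F (i x) : ℝ) : EReal)) x)

lemma iInf_coe_eq_of_denseRange {X Y : Type*} [TopologicalSpace Y] {i : X → Y}
    (hi : DenseRange i) {F : Y → ℝ} (hF : Continuous F) {y : Y} (hy : ∀ x, F y ≤ F x) :
    ⨅ x, ((F (i x) : ℝ) : EReal) = (F y : EReal) := by
  refine le_antisymm ?_ (le_iInf fun x => EReal.coe_le_coe_iff.2 (hy _))
  refine EReal.le_of_forall_lt_iff_le.1 fun z hz => ?_
  obtain ⟨x, hx⟩ := hi.exists_mem_open (isOpen_lt hF continuous_const)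
    (show {y | F y < z}.Nonempty from ⟨y, EReal.coe_lt_coe_iff.1 hz⟩)
  exact (iInf_le (fun x => ((F (i x) : ℝ) : EReal)) x).trans (EReal.coe_le_coe_iff.2 hx.le)

/-- The vanishing viscosity limit for the resolvent of a bounded coercive form on `K`, viewed
as an operator of `H` through a bounded map `ι : H → K` with dense range. -/
lemma tendsto_of_viscous_equation (ι : H →L[ℝ] K) (hι : DenseRange ι) (G : K →L[ℝ] K)
    (hG : ∀ x, inner ℝ (G x) x = ‖x‖ ^ 2) (h : K) (u : ℝ → H)
    (hu : ∀ z, 0 < z → ∀ v, z * inner ℝ (u z) v + inner ℝ (G (ι (u z))) (ι v)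
      = inner ℝ (G h) (ι v)) :
    Tendsto (fun z => ι (u z)) (𝓝[>] 0) (𝓝 h) := by
  rw [Metric.tendsto_nhds]
  intro ε hε
  set M := ‖G‖ + 1 with hM
  have hM0 : 0 < M := by positivity
  -- The limit `h` need not lie in the range of ι, so the equation is tested with `u z - v`, where ι
  -- v is close to `h`.
  obtain ⟨v, hv⟩ : ∃ v, ‖h - ι v‖ < ε / (2 * M) := by
    obtain ⟨v, hv⟩ := hι.exists_dist_lt h (show 0 < ε / (2 * M) by positivity)
    exact ⟨v, by rwa [dist_eq_norm] at hv⟩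
  have hsmall : ∀ᶠ z : ℝ in 𝓝[>] 0, z * (‖v‖ ^ 2 + 1) < ε ^ 2 / 2 := by
    have : Tendsto (fun z : ℝ => z * (‖v‖ ^ 2 + 1)) (𝓝[>] 0) (𝓝 (0 * (‖v‖ ^ 2 + 1))) :=
      ((continuous_id.mul continuous_const).tendsto 0).mono_left nhdsWithin_le_nhds
    rw [zero_mul] at this
    exact this.eventually_lt_const (by positivity)
  filter_upwards [hsmall, self_mem_nhdsWithin] with z hz hz0
  have hz0 : 0 < z := hz0
  rw [dist_eq_norm]
  set w := ι (u z) - h with hw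
  have e := hu z hz0 (u z - v)
  have e1 : ι (u z - v) = w + (h - ι v) := by rw [map_sub, hw]; abel
  have e2 : inner ℝ (G w) (w + (h - ι v)) = -(z * inner ℝ (u z) (u z - v)) := by
    rw [← e1, hw, map_sub, inner_sub_left]; linarith
  rw [inner_add_right, hG, inner_sub_right (u z), real_inner_self_eq_norm_sq] at e2
  have e3 : |inner ℝ (G w) (h - ι v)| ≤ M * ‖w‖ * ‖h - ι v‖ := by
    refine (abs_real_inner_le_norm _ _).trans ?_
    gcongr
    exact (G.le_opNorm w).trans (by gcongr; simp [hM])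
  have e4 : inner ℝ (u z) v ≤ ‖u z‖ * ‖v‖ := real_inner_le_norm _ _
  have e5 : M * ‖w‖ * ‖h - ι v‖ ≤ ‖w‖ * (ε / 2) := by
    have : M * ‖h - ι v‖ ≤ ε / 2 := by
      calc M * ‖h - ι v‖ ≤ M * (ε / (2 * M)) := by gcongr
        _ = ε / 2 := by field_simp
    nlinarith [norm_nonneg w]
  have e6 : ‖w‖ ^ 2 ≤ ‖w‖ * (ε / 2) + z * ‖v‖ ^ 2 := by
    have := (abs_le.1 e3).1
    -- Completing the square absorbs ‖u z‖, so no a priori bound on `u z` is needed; what remains is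
    -- z‖v‖², which tends to zero.
    have h7 : z * (‖u z‖ * ‖v‖ - ‖u z‖ ^ 2) ≤ z * ‖v‖ ^ 2 := by
      gcongr; nlinarith [sq_nonneg (‖u z‖ - ‖v‖), sq_nonneg (‖u z‖), sq_nonneg ‖v‖]
    nlinarith
  by_contra hcon
  push Not at hcon
  nlinarith

/-- The hypothesis `hb` is the sector condition: it makes the form of `A` continuous for the energy
norm, and antisymmetry passes to `K` by density. -/
lemma exists_antisymmetric_operator [CompleteSpace K]
    (J : V →ₗ[ℝ] H) (i : V →ₗ[ℝ] K) (hi : DenseRange i)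
    (A : V →ₗ[ℝ] V) {c : ℝ} (hc : 0 ≤ c)
    (hA : ∀ f g, inner ℝ (J f) (J (A g)) = -inner ℝ (J (A f)) (J g))
    (hb : ∀ f g, |inner ℝ (J (A f)) (J g)| ≤ c * ‖i f‖ * ‖i g‖) :
    ∃ B : K →L[ℝ] K, (∀ x y, inner ℝ (B x) y = -inner ℝ x (B y)) ∧
      ∀ f g, inner ℝ (B (i f)) (i g) = inner ℝ (J (A f)) (J g) := by
  obtain ⟨B, hB⟩ := exists_operator_of_bound i hi
    (LinearMap.mk₂ ℝ (fun f g => inner ℝ (J (A f)) (J g))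
      (fun _ _ _ => by simp only [map_add, inner_add_left])
      (fun _ _ _ => by simp only [map_smul, inner_smul_left]; rfl)
      (fun _ _ _ => by simp only [map_add, inner_add_right])
      (fun _ _ _ => by simp only [map_smul, inner_smul_right]; rfl)) hc hb
  replace hB : ∀ f g, inner ℝ (B (i f)) (i g) = inner ℝ (J (A f)) (J g) := hB
  refine ⟨B, fun x y => ?_, hB⟩
  refine hi.induction_on₂ (p := fun x y => inner ℝ (B x) y = -inner ℝ x (B y))
    (isClosed_eq (by fun_prop) (by fun_prop)) (fun f g => ?_) x y
  have h1 := hA g f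
  rw [real_inner_comm (B (i g)), hB, hB, real_inner_comm, h1]

lemma inner_antisymm_self {B : K →L[ℝ] K} (hB : ∀ x y, inner ℝ (B x) y = -inner ℝ x (B y))
    (x : K) : inner ℝ (B x) x = 0 := by
  have := hB x x
  rw [real_inner_comm (B x) x] at this
  linarith

/-- Antisymmetry kills ⟨Bx, x⟩, so the identity minus or plus `B` is coercive with constant one. -/
lemma exists_sub_antisymm_eq [CompleteSpace K] {B : K →L[ℝ] K}
    (hB : ∀ x y, inner ℝ (B x) y = -inner ℝ x (B y)) (k : K) : ∃ h, h - B h = k :=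
  surjective_of_coercive (ContinuousLinearMap.id ℝ K - B) one_pos (fun x => by
    change 1 * ‖x‖ ^ 2 ≤ inner ℝ (x - B x) x
    rw [inner_sub_left, inner_antisymm_self hB, real_inner_self_eq_norm_sq]
    linarith) k

lemma exists_add_antisymm_eq [CompleteSpace K] {B : K →L[ℝ] K}
    (hB : ∀ x y, inner ℝ (B x) y = -inner ℝ x (B y)) (k : K) : ∃ h, h + B h = k :=
  surjective_of_coercive (ContinuousLinearMap.id ℝ K + B) one_pos (fun x => by
    change 1 * ‖x‖ ^ 2 ≤ inner ℝ (x + B x) x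
    rw [inner_add_left, inner_antisymm_self hB, real_inner_self_eq_norm_sq]
    linarith) k

/-- The bound `hc` extends `i` to ι : H → K. The operator ι*(1 - B)ι is then a bounded extension of
-(S + A), nonnegative as a form, so adding z makes it coercive. -/
lemma exists_resolvent_limit [CompleteSpace H] [CompleteSpace K]
    (J : V →ₗ[ℝ] H) (hJ : DenseRange J) (i : V →ₗ[ℝ] K) (hi : DenseRange i)
    (A S : V →ₗ[ℝ] V) (j : V) {c : ℝ}
    (hS : ∀ f g, inner ℝ (i f) (i g) = -inner ℝ (J (S f)) (J g))
    (hc : ∀ f, ‖i f‖ ≤ c * ‖J f‖)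
    {B : K →L[ℝ] K} (hB : ∀ x y, inner ℝ (B x) y = -inner ℝ x (B y))
    (hBA : ∀ f g, inner ℝ (B (i f)) (i g) = inner ℝ (J (A f)) (J g))
    {k h : K} (hk : ∀ f, inner ℝ k (i f) = inner ℝ (J j) (J f)) (hh : h - B h = k) :
    ∃ u : ℝ → H, (∀ z, 0 < z → (u z, z • u z - J j) ∈
          closure (Set.range fun f => (J f, J (S f + A f)))) ∧
        Tendsto (fun z => inner ℝ (J j) (u z)) (𝓝[>] 0) (𝓝 (‖h‖ ^ 2)) := by
  obtain ⟨G, hGx⟩ : ∃ G : K →L[ℝ] K, ∀ x, G x = x - B x :=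
    ⟨ContinuousLinearMap.id ℝ K - B, fun _ => rfl⟩
  have hGc : ∀ x, inner ℝ (G x) x = ‖x‖ ^ 2 := fun x => by
    rw [hGx, inner_sub_left, inner_antisymm_self hB, sub_zero, real_inner_self_eq_norm_sq]
  rw [← hGx] at hh
  obtain ⟨ι, hι⟩ : ∃ ι : H →L[ℝ] K, ∀ f, ι (J f) = i f :=
    ⟨i.extendOfNorm J, LinearMap.extendOfNorm_eq hJ ⟨c, hc⟩⟩
  have hιd : DenseRange ι := hi.mono (by rintro _ ⟨f, rfl⟩; exact ⟨J f, hι f⟩)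
  obtain ⟨ι', hι'⟩ : ∃ ι' : K →L[ℝ] H, ∀ x y, inner ℝ (ι' x) y = inner ℝ x (ι y) :=
    ⟨ContinuousLinearMap.adjoint ι, fun x y => ContinuousLinearMap.adjoint_inner_left _ _ _⟩
  obtain ⟨T, hT⟩ : ∃ T : H →L[ℝ] H, ∀ x y, inner ℝ (T x) y = inner ℝ (G (ι x)) (ι y) :=
    ⟨ι' ∘L G ∘L ι, fun x y => hι' _ _⟩
  have hTJ : ∀ f, T (J f) = -J (S f + A f) := by
    intro f
    refine hJ.eq_of_inner_left ℝ fun g => ?_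
    rw [hT, hι, hι, hGx, inner_sub_left, hBA, hS, inner_neg_left, map_add, inner_add_left]
    ring
  have hkJ : ι' k = J j := by
    refine hJ.eq_of_inner_left ℝ fun g => ?_
    rw [hι', hι, hk]
  have hex : ∀ z : ℝ, ∃ u : H, 0 < z → z • u + T u = J j := by
    intro z
    by_cases hz : 0 < z
    · obtain ⟨u, hu⟩ := surjective_of_coercive (z • ContinuousLinearMap.id ℝ H + T) hz
        (fun x => by
          change z * ‖x‖ ^ 2 ≤ inner ℝ (z • x + T x) x
          rw [inner_add_left, real_inner_smul_left, hT, hGc, real_inner_self_eq_norm_sq]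
          nlinarith [sq_nonneg ‖ι x‖]) (J j)
      exact ⟨u, fun _ => hu⟩
    · exact ⟨0, fun h => absurd h hz⟩
  choose u hu using hex
  refine ⟨u, fun z hz => ?_, ?_⟩
  · have hc : Continuous fun x : H => (x, -T x) := by fun_prop
    have h4 : u z ∈ closure (Set.range J) := by rw [hJ.closure_range]; trivial
    -- As `T` is bounded, the graph of -T over all of `H` lies in the closure of its graph over the
    -- dense range of `J`.
    rw [show z • u z - J j = -T (u z) by rw [← hu z hz]; abel]
    refine map_mem_closure (f := fun x : H => (x, -T x)) hc h4 ?_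
    rintro _ ⟨f, rfl⟩
    exact ⟨f, by simp [hTJ]⟩
  · have hlim : Tendsto (fun z => ι (u z)) (𝓝[>] 0) (𝓝 h) := by
      refine tendsto_of_viscous_equation ι hιd G hGc h u fun z hz v => ?_
      rw [hh, ← hT, ← hι', hkJ, ← hu z hz, inner_add_left, real_inner_smul_left]
    -- The limit ⟨k, h⟩ equals ⟨h - Bh, h⟩ = ‖h‖², and ⟨k, ι u⟩ is the inner product of `J j` with
    -- `u`.
    have h7 : Tendsto (fun z => inner ℝ k (ι (u z))) (𝓝[>] 0) (𝓝 (inner ℝ k h)) :=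
      tendsto_const_nhds.inner hlim
    rw [← hh, hGc] at h7
    refine h7.congr fun z => ?_
    rw [hh, ← hι', hkJ]

/-! ### Three minimisation problems on `K`, all solved in terms of `h`. -/

section Variational

variable {X : Type*} {i : X → K} (hi : DenseRange i) {B : K →L[ℝ] K}
  (hB : ∀ x y, inner ℝ (B x) y = -inner ℝ x (B y)) {k h : K} (hh : h - B h = k)
include hi hB hh

/-- With p = h + x the functional equals ‖h‖² + ‖p + Bp - h‖², because p and Bp are orthogonal. The
last square vanishes when (1 + B)p = h. -/
lemma iInf_norm_sq_add_norm_sub_sq [CompleteSpace K] :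
    ⨅ f, ((‖i f‖ ^ 2 + ‖k - B (i f)‖ ^ 2 : ℝ) : EReal) = ((‖h‖ ^ 2 : ℝ) : EReal) := by
  have key : ∀ x, ‖x‖ ^ 2 + ‖k - B x‖ ^ 2 = ‖h‖ ^ 2 + ‖(h + x) + B (h + x) - h‖ ^ 2 := by
    intro x
    have e1 : k - B x = h - B (h + x) := by rw [← hh, map_add]; abel
    have e2 : x = (h + x) - h := by abel
    generalize h + x = p at *
    rw [e1, e2]
    have e3 := inner_antisymm_self hB p
    have e4 := norm_sub_sq_real p h
    have e5 := norm_sub_sq_real h (B p)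
    have e6 := norm_sub_sq_real (p + B p) h
    have e7 := norm_add_sq_real p (B p)
    rw [inner_add_left] at e6
    rw [real_inner_comm] at e7
    rw [real_inner_comm] at e5
    linarith
  obtain ⟨p, hp⟩ := exists_add_antisymm_eq hB h
  have := iInf_coe_eq_of_denseRange hi (F := fun x => ‖x‖ ^ 2 + ‖k - B x‖ ^ 2) (by fun_prop)
    (y := p - h) fun x => by
      rw [key, key, show h + (p - h) = p by abel, hp, sub_self]
      simp
  rw [this, key, show h + (p - h) = p by abel, hp, sub_self]
  simp

/-- Put y = x + Bx - k and s = ⟨k, x⟩. Antisymmetry gives s = ⟨y, h⟩ + ‖h‖², and the functional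
becomes 2l + ‖h‖² + ‖y + h‖² + s²/(2l). Both squares vanish at y = -h, which is attained since 1 + B
is onto. -/
lemma iInf_norm_add_sub_sq [CompleteSpace K] {l : ℝ} (hl : 0 < l) :
    ⨅ f, ((‖i f + B (i f) - k‖ ^ 2 + (2 * l + inner ℝ k (i f)) ^ 2 / (2 * l) : ℝ) : EReal)
      = ((2 * l + ‖h‖ ^ 2 : ℝ) : EReal) := by
  have hkh : inner ℝ k h = ‖h‖ ^ 2 := by
    rw [← hh, inner_sub_left, inner_antisymm_self hB, real_inner_self_eq_norm_sq, sub_zero]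
  have key : ∀ x, inner ℝ k x = inner ℝ (x + B x - k) h + ‖h‖ ^ 2 := by
    intro x
    have e1 := hB h x
    have e2 : inner ℝ k x = inner ℝ h x - inner ℝ (B h) x := by rw [← hh, inner_sub_left]
    rw [inner_sub_left, hkh, inner_add_left, e2, e1, real_inner_comm x h,
      real_inner_comm (B x) h]
    ring
  obtain ⟨p, hp⟩ := exists_add_antisymm_eq hB (k - h)
  have hval : ∀ x, ‖x + B x - k‖ ^ 2 + (2 * l + inner ℝ k x) ^ 2 / (2 * l) =
      2 * l + ‖h‖ ^ 2 + ‖(x + B x - k) + h‖ ^ 2 +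
        (inner ℝ (x + B x - k) h + ‖h‖ ^ 2) ^ 2 / (2 * l) := by
    intro x
    rw [key, norm_add_sq_real]
    field_simp
    ring
  have h0 : p + B p - k + h = 0 := by rw [hp]; abel
  have h1 : inner ℝ (p + B p - k) h + ‖h‖ ^ 2 = 0 := by
    rw [← real_inner_self_eq_norm_sq, ← inner_add_left, h0, inner_zero_left]
  have h2 := hval p
  rw [h0, h1, norm_zero] at h2
  have := iInf_coe_eq_of_denseRange hi
    (F := fun x => ‖x + B x - k‖ ^ 2 + (2 * l + inner ℝ k x) ^ 2 / (2 * l)) (by fun_prop)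
    (y := p) fun x => by
      rw [h2, hval x]
      have : 0 ≤ (inner ℝ (x + B x - k) h + ‖h‖ ^ 2) ^ 2 / (2 * l) := by positivity
      have h3 := sq_nonneg ‖x + B x - k + h‖
      simp only [ne_eq, OfNat.ofNat_ne_zero, not_false_eq_true, zero_pow, zero_div]
      linarith
  rw [this, h2]
  congr 1
  ring

/-- Since k + x - Bx = (1 - B)(h + x), smallness of the first square forces x towards -h, hence ⟨k,
x⟩ towards -‖h‖², and the second square then pins down c. -/
lemma forall_exists_norm_add_sq_lt_iff {l c : ℝ} (hl : 0 < l) :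
    (∀ ε : ℝ, 0 < ε → ∃ f, ‖k + i f - B (i f)‖ ^ 2 + (c - inner ℝ k (i f)) ^ 2 / (2 * l) < ε)
      ↔ c = -‖h‖ ^ 2 := by
  have hkh : inner ℝ k h = ‖h‖ ^ 2 := by
    rw [← hh, inner_sub_left, inner_antisymm_self hB, real_inner_self_eq_norm_sq, sub_zero]
  have hG : ∀ x, k + x - B x = (h + x) - B (h + x) := fun x => by rw [← hh, map_add]; abel
  constructor
  · intro H
    by_contra hne
    set d := |c + ‖h‖ ^ 2| with hd
    have hd0 : 0 < d := abs_pos.2 fun h => hne (by linarith)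
    set M := ‖k‖ + 1 with hM
    have hM0 : 0 < M := by positivity
    -- The first bound makes |⟨k, h + x⟩| at most d/2, the second makes |c - ⟨k, x⟩| less than d/2;
    -- together they contradict the value d of |c + ‖h‖²|.
    obtain ⟨f, hf⟩ := H (min ((d / (2 * M)) ^ 2) ((d / 2) ^ 2 / (2 * l))) (by positivity)
    obtain ⟨hf1, hf2⟩ := lt_min_iff.1 hf
    set x := i f
    have a1 : ‖h + x‖ ^ 2 ≤ ‖k + x - B x‖ * ‖h + x‖ := by
      have := real_inner_le_norm (k + x - B x) (h + x)
      rwa [hG, inner_sub_left, inner_antisymm_self hB, real_inner_self_eq_norm_sq, sub_zero,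
        ← hG] at this
    have a2 : ‖h + x‖ ≤ ‖k + x - B x‖ := by
      by_contra hlt
      push Not at hlt
      nlinarith [norm_nonneg (k + x - B x)]
    have a3 : ‖k + x - B x‖ < d / (2 * M) := by
      have : 0 ≤ (c - inner ℝ k x) ^ 2 / (2 * l) := by positivity
      exact lt_of_pow_lt_pow_left₀ 2 (by positivity) (by linarith)
    have a4 : |c - inner ℝ k x| < d / 2 := by
      have : 0 ≤ ‖k + x - B x‖ ^ 2 := by positivity
      have h5 : (c - inner ℝ k x) ^ 2 / (2 * l) < (d / 2) ^ 2 / (2 * l) := by linarith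
      have h6 := (div_lt_div_iff_of_pos_right (by positivity)).1 h5
      exact abs_lt_of_sq_lt_sq h6 (by positivity)
    have a5 : |inner ℝ k (h + x)| ≤ d / 2 := by
      refine (abs_real_inner_le_norm _ _).trans ?_
      calc ‖k‖ * ‖h + x‖ ≤ M * (d / (2 * M)) := by
            gcongr
            · simp [hM]
            · exact a2.trans a3.le
        _ = d / 2 := by field_simp
    rw [inner_add_right, hkh] at a5
    have a6 : c + ‖h‖ ^ 2 = (c - inner ℝ k x) + (‖h‖ ^ 2 + inner ℝ k x) := by ring
    have a7 := abs_add_le (c - inner ℝ k x) (‖h‖ ^ 2 + inner ℝ k x)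
    rw [← a6, ← hd] at a7
    linarith
  · rintro rfl ε hε
    have hF : Continuous fun x : K =>
        ‖k + x - B x‖ ^ 2 + (-‖h‖ ^ 2 - inner ℝ k x) ^ 2 / (2 * l) := by fun_prop
    obtain ⟨f, hf⟩ := hi.exists_mem_open (isOpen_lt hF continuous_const)
      (show {x | _ < ε}.Nonempty from ⟨-h, by
        rw [Set.mem_ofPred_eq, hG, add_neg_cancel, map_zero, inner_neg_right, hkh]
        simpa using hε⟩)
    exact ⟨f, hf⟩

end Variational

end HilbertSpace

namespace DisorderedChain

/-! ### The Gaussian product measure: invariances, Stein's identity, moments. -/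

section Gibbs

/-- Resampling one coordinate independently leaves a product measure unchanged. This is how one
coordinate is integrated out without splitting the infinite product. -/
lemma measurePreserving_update (x : ℤ) :
    MeasurePreserving (fun p : Config × ℝ => Function.update p.1 x p.2)
      (gibbs.prod (gaussianReal 0 1)) gibbs := by
  have hmeas : Measurable (fun p : Config × ℝ => Function.update p.1 x p.2) := by
    refine measurable_pi_lambda _ fun z => ?_
    by_cases hz : z = x
    · subst hz; simpa using measurable_snd
    · simp only [Function.update_of_ne hz]
      exact (measurable_pi_apply z).comp measurable_fst
  refine ⟨hmeas, ?_⟩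
  refine Measure.eq_infinitePi _ fun s t ht => ?_
  rw [Measure.map_apply hmeas (MeasurableSet.pi s.countable_toSet fun i _ => ht i)]
  by_cases hx : x ∈ s
  · have : (fun p : Config × ℝ => Function.update p.1 x p.2) ⁻¹' (Set.pi s t) =
        (Set.pi (s.erase x) t) ×ˢ (t x) := by
      ext p
      simp only [Set.mem_preimage, Set.mem_pi, Set.mem_prod, Finset.mem_coe, Finset.mem_erase]
      constructor
      · intro h
        exact ⟨fun i hi => by simpa [Function.update_of_ne hi.1] using h i hi.2,
          by simpa using h x hx⟩
      · rintro ⟨h1, h2⟩ i hi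
        by_cases hix : i = x
        · subst hix; simpa using h2
        · simpa [Function.update_of_ne hix] using h1 i ⟨hix, hi⟩
    rw [this, Measure.prod_prod, gibbs, Measure.infinitePi_pi _ (fun i _ => ht i), mul_comm,
      Finset.mul_prod_erase s (fun i => gaussianReal 0 1 (t i)) hx]
  · have : (fun p : Config × ℝ => Function.update p.1 x p.2) ⁻¹' (Set.pi s t) =
        (Set.pi s t) ×ˢ Set.univ := by
      ext p
      simp only [Set.mem_preimage, Set.mem_pi, Set.mem_prod, Finset.mem_coe, Set.mem_univ,
        and_true]
      refine forall₂_congr fun i hi => ?_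
      rw [Function.update_of_ne (by rintro rfl; exact hx hi)]
    rw [this, Measure.prod_prod, gibbs, Measure.infinitePi_pi _ (fun i _ => ht i)]
    simp

lemma flipSite_involutive (x : ℤ) : Function.Involutive (flipSite x) := by
  intro ω; simp [flipSite]

lemma exch_involutive (x : ℤ) : Function.Involutive (exch x) := by
  intro ω; funext z; simp [exch]

lemma flipSite_apply (x z : ℤ) (ω : Config) :
    flipSite x ω z = if z = x then -ω z else ω z := by
  by_cases h : z = x
  · subst h; simp [flipSite]
  · simp [flipSite, h]

lemma measurePreserving_flipSite (x : ℤ) : MeasurePreserving (flipSite x) gibbs gibbs := by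
  have h : flipSite x = fun (ω : Config) z => (if z = x then (fun t : ℝ => -t) else id) (ω z) := by
    funext ω z
    rw [flipSite_apply]
    split_ifs <;> rfl
  have hm : ∀ z : ℤ, Measurable (if z = x then (fun t : ℝ => -t) else id) := fun z => by
    split_ifs
    · exact measurable_neg
    · exact measurable_id
  rw [h]
  refine ⟨measurable_pi_lambda _ fun z => (hm z).comp (measurable_pi_apply z), ?_⟩
  rw [gibbs, Measure.infinitePi_map_pi (μ := fun _ : ℤ => gaussianReal 0 1) hm]
  congr 1
  funext z
  split_ifs
  · rw [gaussianReal_map_neg, neg_zero]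
  · exact Measure.map_id

lemma measurePreserving_exch (x : ℤ) : MeasurePreserving (exch x) gibbs gibbs :=
  ⟨measurable_pi_lambda _ fun _ => measurable_pi_apply _,
    Measure.map_infinitePi_infinitePi_of_inj (P := fun _ : ℤ => gaussianReal 0 1)
      (f := fun z : ℤ => Equiv.swap x (x + 1) z) (Equiv.injective _)⟩

lemma integral_comp_of_involutive {σ : Config → Config} (hσ : MeasurePreserving σ gibbs gibbs)
    (hi : Function.Involutive σ) (F : Config → ℝ) : ∫ ω, F (σ ω) ∂gibbs = ∫ ω, F ω ∂gibbs :=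
  hσ.integral_comp (MeasurableEquiv.ofInvolutive σ hi hσ.measurable).measurableEmbedding F

/-- The integral of a function that is odd in one coordinate vanishes. -/
lemma integral_eq_zero_of_flip (x : ℤ) {F : Config → ℝ} (hF : ∀ ω, F (flipSite x ω) = -F ω) :
    ∫ ω, F ω ∂gibbs = 0 := by
  have h := integral_comp_of_involutive (measurePreserving_flipSite x) (flipSite_involutive x) F
  simp_rw [hF] at h
  rw [integral_neg] at h
  linarith

lemma memLp_eval (x : ℤ) (p : ENNReal) (hp : p ≠ ⊤) : MemLp (fun ω : Config => ω x) p gibbs :=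
  (memLp_id_gaussianReal' (μ := 0) (v := 1) p hp).comp_measurePreserving
    (measurePreserving_eval_infinitePi (fun _ : ℤ => gaussianReal 0 1) x)

lemma integral_eval (x : ℤ) {φ : ℝ → ℝ} (hφ : Measurable φ) :
    ∫ ω : Config, φ (ω x) ∂gibbs = ∫ t, φ t ∂(gaussianReal 0 1) := by
  have h3 := measurePreserving_eval_infinitePi (fun _ : ℤ => gaussianReal 0 1) x
  rw [← h3.map_eq]
  exact (integral_map h3.measurable.aemeasurable hφ.aestronglyMeasurable).symm

lemma memLp_boxSum_pow (s : Finset ℤ) (n : ℕ) (p : ENNReal) (hp : p ≠ ⊤) :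
    MemLp (fun ω : Config => (1 + ∑ y ∈ s, |ω y|) ^ n) p gibbs := by
  by_cases hn : n = 0
  · subst hn; simpa using memLp_const (1 : ℝ)
  -- The base is put in L^(pn), so that its n-th power lies in L^p.
  have h1 : MemLp (fun ω : Config => 1 + ∑ y ∈ s, |ω y|) (p * n) gibbs :=
    (memLp_const (1 : ℝ)).add (memLp_finsetSum _ fun y _ =>
      (memLp_eval y _ (ENNReal.mul_ne_top hp (by simp))).abs)
  have h2 := h1.norm_rpow_div (n : ENNReal)
  rw [ENNReal.mul_div_cancel_right (by simpa using hn) (by simp)] at h2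
  refine h2.congr_norm (Measurable.aestronglyMeasurable (by measurability)) (Eventually.of_forall fun ω => ?_)
  have h0 : 0 ≤ 1 + ∑ y ∈ s, |ω y| := by positivity
  simp [abs_of_nonneg h0]

/-- Functions of polynomial growth belong to every `L^p(μ₁)`, `p < ∞`. -/
lemma memLp_of_growth {F : Config → ℝ} (hF : Measurable F) {s : Finset ℤ} {c : ℝ} {n : ℕ}
    (h : ∀ ω, |F ω| ≤ c * (1 + ∑ y ∈ s, |ω y|) ^ n) (p : ENNReal) (hp : p ≠ ⊤) :
    MemLp F p gibbs := by
  refine ((memLp_boxSum_pow s n p hp).const_mul c).mono hF.aestronglyMeasurable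
    (Eventually.of_forall fun ω => ?_)
  exact (h ω).trans (le_abs_self _)

lemma hasDerivAt_gaussianPDFReal (x : ℝ) :
    HasDerivAt (gaussianPDFReal 0 1) (-(x * gaussianPDFReal 0 1 x)) x := by
  have h1 : HasDerivAt (fun x : ℝ => -(x - 0) ^ 2 / (2 * ((1 : NNReal) : ℝ))) (-x) x := by
    have := (((hasDerivAt_id x).sub_const 0).pow 2).neg.div_const (2 * ((1 : NNReal) : ℝ))
    refine this.congr_deriv ?_
    simp
    ring
  have h2 := h1.exp.const_mul (√(2 * Real.pi * ((1 : NNReal) : ℝ)))⁻¹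
  refine h2.congr_deriv ?_
  rw [gaussianPDFReal]
  ring

/-- Stein's identity on the line. -/
lemma integral_deriv_gaussianReal {f f' : ℝ → ℝ} (hf : ∀ t, HasDerivAt f (f' t) t)
    (h0 : Integrable f (gaussianReal 0 1)) (h1 : Integrable f' (gaussianReal 0 1))
    (h2 : Integrable (fun t => t * f t) (gaussianReal 0 1)) :
    ∫ t, f' t ∂(gaussianReal 0 1) = ∫ t, t * f t ∂(gaussianReal 0 1) := by
  have hint : ∀ g : ℝ → ℝ, Integrable g (gaussianReal 0 1) →
      Integrable (fun t => g t * gaussianPDFReal 0 1 t) := by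
    intro g hg
    rw [gaussianReal_of_var_ne_zero 0 one_ne_zero,
      integrable_withDensity_iff_integrable_smul' (measurable_gaussianPDF 0 1)
        (Eventually.of_forall fun t => gaussianPDF_lt_top)] at hg
    refine hg.congr (Eventually.of_forall fun t => ?_)
    simp only [toReal_gaussianPDF, smul_eq_mul]
    ring
  rw [integral_gaussianReal_eq_integral_smul one_ne_zero,
    integral_gaussianReal_eq_integral_smul one_ne_zero]
  -- Integration by parts against the density φ, with φ'(t) = -tφ(t); integrability makes the
  -- boundary terms vanish.
  have := integral_mul_deriv_eq_deriv_mul_of_integrable (u := f) (v := gaussianPDFReal 0 1)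
    (u' := f') (v' := fun x => -(x * gaussianPDFReal 0 1 x)) (fun t _ => hf t)
    (fun t _ => hasDerivAt_gaussianPDFReal t)
    ((hint _ h2).neg.congr (Eventually.of_forall fun t => by simp; ring)) (hint _ h1) (hint _ h0)
  have e1 : ∫ t, f t * -(t * gaussianPDFReal 0 1 t) =
      -∫ t, gaussianPDFReal 0 1 t • (t * f t) := by
    rw [← integral_neg]
    congr 1; funext t; simp only [smul_eq_mul]; ring
  rw [e1, neg_inj] at this
  rw [this]
  congr 1; funext t; simp only [smul_eq_mul]; ring

/-- Stein's identity in one coordinate of a configuration. -/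
lemma integral_deriv_update {G : Config → ℝ} {x : ℤ}
    (hG : ∀ ω, Differentiable ℝ fun t => G (Function.update ω x t))
    (h0 : Integrable G gibbs)
    (h1 : Integrable (fun ω => deriv (fun t => G (Function.update ω x t)) (ω x)) gibbs)
    (h2 : Integrable (fun ω => ω x * G ω) gibbs) :
    ∫ ω, deriv (fun t => G (Function.update ω x t)) (ω x) ∂gibbs = ∫ ω, ω x * G ω ∂gibbs := by
  have hp := measurePreserving_update x
  have hI : ∀ F : Config → ℝ, Integrable F gibbs →
      ∫ ω, F ω ∂gibbs = ∫ ω, ∫ t, F (Function.update ω x t) ∂(gaussianReal 0 1) ∂gibbs := by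
    intro F hF
    have h3 : Integrable F
        ((gibbs.prod (gaussianReal 0 1)).map fun p : Config × ℝ => Function.update p.1 x p.2) := by
      rwa [hp.map_eq]
    conv_lhs => rw [← hp.map_eq]
    rw [integral_map hp.measurable.aemeasurable h3.aestronglyMeasurable]
    exact integral_prod _ (hp.integrable_comp_of_integrable hF)
  rw [hI _ h1, hI _ h2]
  refine integral_congr_ae ?_
  -- For almost every ω the sections in the resampled coordinate are integrable, and there the
  -- one-dimensional identity applies.
  filter_upwards [(hp.integrable_comp_of_integrable h0).prod_right_ae,
    (hp.integrable_comp_of_integrable h1).prod_right_ae,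
    (hp.integrable_comp_of_integrable h2).prod_right_ae] with ω a0 a1 a2
  simp only [Function.comp_apply, Function.update_idem, Function.update_self] at a0 a1 a2 ⊢
  exact integral_deriv_gaussianReal (fun t => (hG ω t).hasDerivAt) a0 a1 a2

lemma integrable_pow_gaussianReal (n : ℕ) : Integrable (fun t : ℝ => t ^ n) (gaussianReal 0 1) := by
  by_cases hn : n = 0
  · subst hn; simp
  have := (memLp_id_gaussianReal' (μ := 0) (v := 1) n (by simp)).integrable_norm_pow hn
  refine this.mono (by fun_prop) (Eventually.of_forall fun t => by simp)

/-- Stein's identity with t, and then with t³, yields the second and fourth moments. -/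
lemma integral_sq_gaussianReal : ∫ t, t ^ 2 ∂(gaussianReal 0 1) = 1 := by
  have := integral_deriv_gaussianReal (f := fun t => t) (f' := fun _ => 1)
    (fun t => hasDerivAt_id t) (by simpa using integrable_pow_gaussianReal 1) (by simp)
    (by simpa [sq] using integrable_pow_gaussianReal 2)
  simpa [sq] using this.symm

lemma integral_pow_four_gaussianReal : ∫ t, t ^ 4 ∂(gaussianReal 0 1) = 3 := by
  have := integral_deriv_gaussianReal (f := fun t => t ^ 3) (f' := fun t => 3 * t ^ 2)
    (fun t => by simpa using hasDerivAt_pow 3 t) (integrable_pow_gaussianReal 3)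
    ((integrable_pow_gaussianReal 2).const_mul 3)
    ((integrable_pow_gaussianReal 4).congr (Eventually.of_forall fun t => by simp; ring))
  rw [integral_const_mul, integral_sq_gaussianReal] at this
  rw [show (3 : ℝ) = 3 * 1 by norm_num, this]
  congr 1; funext t; ring

lemma compressibility_eq : compressibility = 2 := by
  rw [compressibility, integral_pow_four_gaussianReal, integral_sq_gaussianReal]
  norm_num

end Gibbs

/-! ### Flips and exchanges treated together: symmetry, translation covariance, Dirichlet forms. -/

section Moves

variable {C : ℝ} {ν : Measure (Set.Icc C⁻¹ C)} [IsProbabilityMeasure ν]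

/-- A translation covariant family of local involutions that preserve the Gibbs measure. -/
structure IsMove (σ : ℤ → Config → Config) : Prop where
  involutive : ∀ z, Function.Involutive (σ z)
  measurePreserving : ∀ z, MeasurePreserving (σ z) gibbs gibbs
  apply_shift : ∀ z x ω, σ z (shift x ω) = shift x (σ (z + x) ω)
  eventually_eq : ∀ s : Finset ℤ, ∃ t : Finset ℤ, ∀ z ∉ t, ∀ ω, ∀ x ∈ s, σ z ω x = ω x
  cylinder : ∀ z (s : Finset ℤ), ∃ t : Finset ℤ, ∀ ω ω', (∀ x ∈ t, ω x = ω' x) →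
    ∀ x ∈ s, σ z ω x = σ z ω' x

lemma isMove_flipSite : IsMove flipSite where
  involutive := flipSite_involutive
  measurePreserving := measurePreserving_flipSite
  apply_shift z x ω := by
    funext y
    simp only [flipSite_apply, shift]
    by_cases h : y = z
    · subst h; simp [add_comm]
    · rw [if_neg h, if_neg (by omega)]
  eventually_eq s := ⟨s, fun z hz ω x hx => by
    rw [flipSite_apply, if_neg]; rintro rfl; exact hz hx⟩
  cylinder z s := ⟨s, fun ω ω' h x hx => by simp only [flipSite_apply, h x hx]⟩

lemma swap_succ_apply (x z : ℤ) : Equiv.swap x (x + 1) z =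
    if z = x then x + 1 else if z = x + 1 then x else z := Equiv.swap_apply_def _ _ _

lemma isMove_exch : IsMove exch where
  involutive := exch_involutive
  measurePreserving := measurePreserving_exch
  apply_shift z x ω := by
    funext y
    simp only [exch, shift, swap_succ_apply]
    congr 1
    split_ifs <;> omega
  eventually_eq s := ⟨s ∪ s.image (fun x => x - 1), fun z hz ω x hx => by
    simp only [Finset.mem_union, Finset.mem_image, not_or, not_exists, not_and] at hz
    have h1 : x ≠ z := by rintro rfl; exact hz.1 hx
    have h2 : x ≠ z + 1 := fun h => hz.2 x hx (by omega)
    simp [exch, swap_succ_apply, h1, h2]⟩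
  cylinder z s := ⟨s.image (Equiv.swap z (z + 1)), fun ω ω' h x hx =>
    h _ (Finset.mem_image_of_mem _ hx)⟩

/-- `∇_z f = f ∘ σ_z - f`. -/
def moveDiff (σ : ℤ → Config → Config) (z : ℤ) (f : Obs C) : Obs C :=
  fun m ω => f m (σ z ω) - f m ω

/-- The generator `∑_z ∇_z`. -/
noncomputable def genMove (σ : ℤ → Config → Config) (f : Obs C) : Obs C :=
  fun m ω => ∑' z : ℤ, (f m (σ z ω) - f m ω)

/-- `∇₀ Γ_f`. -/
noncomputable def gradMove (σ : ℤ → Config → Config) (f : Obs C) : Obs C :=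
  fun m ω => ∑' x : ℤ, (trans x f m (σ 0 ω) - trans x f m ω)

lemma genS_eq (lam gam : ℝ) (f : Obs C) :
    genS lam gam f = gam • genMove flipSite f + lam • genMove exch f := rfl

lemma gradFlip_eq (f : Obs C) : gradFlip f = gradMove flipSite f := rfl

lemma gradExch_eq (f : Obs C) : gradExch f = gradMove exch f := rfl

lemma continuous_shift {α : Type*} [TopologicalSpace α] (x : ℤ) :
    Continuous (shift x : (ℤ → α) → ℤ → α) :=
  continuous_pi fun z => continuous_apply (x + z)

lemma IsLocal.sub {f g : Obs C} (hf : IsLocal ν f) (hg : IsLocal ν g) : IsLocal ν (f - g) :=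
  (localSubmodule ν).sub_mem hf hg

lemma IsLocal.sum {ι : Type*} {s : Finset ι} {f : ι → Obs C} (hf : ∀ i ∈ s, IsLocal ν (f i)) :
    IsLocal ν (∑ i ∈ s, f i) :=
  (localSubmodule ν).sum_mem hf

lemma DependsOnBox.trans {f : Obs C} {s : Finset ℤ} (hs : DependsOnBox f s) (x : ℤ) :
    DependsOnBox (trans x f) (s.image fun z => x + z) := fun _ _ _ _ h1 h2 =>
  hs _ _ _ _ (fun _ hz => h1 _ (Finset.mem_image_of_mem _ hz))
    (fun _ hz => h2 _ (Finset.mem_image_of_mem _ hz))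

lemma IsLocal.trans {f : Obs C} (hf : IsLocal ν f) (x : ℤ) : IsLocal ν (trans x f) where
  cylinder := by
    obtain ⟨s, hs⟩ := hf.cylinder
    exact ⟨_, hs.trans x⟩
  measurable := hf.measurable_trans x
  continuous_disorder ω := (hf.continuous_disorder (shift x ω)).comp (continuous_shift x)
  memLp_gibbs m := (hf.memLp_gibbs (shift x m)).comp_measurePreserving
    (measurePreserving_shift _ x)
  mean_zero m := by
    have h := measurePreserving_shift (gaussianReal 0 1) x
    have h1 := hf.mean_zero (shift x m)
    change ∫ ω, f (shift x m) ω ∂(Measure.infinitePi fun _ => gaussianReal 0 1) = 0 at h1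
    rw [← h.map_eq, integral_map h.measurable.aemeasurable
      (hf.measurable_section _).aestronglyMeasurable] at h1
    exact h1
  memLp_annealed := hf.memLp_trans x

lemma IsLocal.integrable_mul {f g : Obs C} (hf : IsLocal ν f) (hg : IsLocal ν g) :
    Integrable (fun p : Disorder C × Config => f p.1 p.2 * g p.1 p.2) (annealed ν) :=
  hf.memLp_annealed.integrable_mul hg.memLp_annealed

lemma expect_sum_right {ι : Type*} {s : Finset ι} {f : Obs C} {g : ι → Obs C}
    (hf : IsLocal ν f) (hg : ∀ i ∈ s, IsLocal ν (g i)) :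
    expect ν (f * ∑ i ∈ s, g i) = ∑ i ∈ s, expect ν (f * g i) := by
  refine Eq.trans (integral_congr_ae (Eventually.of_forall fun p => ?_))
    (integral_finsetSum s fun i hi => hf.integrable_mul (hg i hi))
  simp [Finset.mul_sum]

lemma expect_mul_comm (f g : Obs C) : expect ν (f * g) = expect ν (g * f) := by rw [mul_comm]

lemma trans_moveDiff {σ : ℤ → Config → Config} (hσ : IsMove σ) (x z : ℤ) (f : Obs C) :
    trans x (moveDiff σ z f) = moveDiff σ (z + x) (trans x f) := by
  funext m ω; simp only [trans, moveDiff, hσ.apply_shift]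

lemma moveDiff_trans {σ : ℤ → Config → Config} (hσ : IsMove σ) (x z : ℤ) (f : Obs C) :
    moveDiff σ z (trans x f) = trans x (moveDiff σ (z - x) f) := by
  rw [trans_moveDiff hσ, sub_add_cancel]

lemma IsLocal.comp_move {σ : ℤ → Config → Config} (hσ : IsMove σ) {f : Obs C}
    (hf : IsLocal ν f) (z : ℤ) : IsLocal ν (fun m ω => f m (σ z ω)) where
  cylinder := by
    classical
    obtain ⟨s, hs⟩ := hf.cylinder
    obtain ⟨t, ht⟩ := hσ.cylinder z s
    exact ⟨s ∪ t, fun m m' ω ω' h1 h2 => hs _ _ _ _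
      (fun x hx => h1 x (Finset.mem_union_left _ hx))
      (ht _ _ fun x hx => h2 x (Finset.mem_union_right _ hx))⟩
  measurable := hf.measurable.comp
    (measurable_fst.prodMk ((hσ.measurePreserving z).measurable.comp measurable_snd))
  continuous_disorder ω := hf.continuous_disorder (σ z ω)
  memLp_gibbs m := (hf.memLp_gibbs m).comp_measurePreserving (hσ.measurePreserving z)
  mean_zero m := by
    rw [integral_comp_of_involutive (hσ.measurePreserving z) (hσ.involutive z) (f m)]
    exact hf.mean_zero m
  memLp_annealed := hf.memLp_annealed.comp_measurePreserving
    ((MeasurePreserving.id (disorderLaw ν)).prod (hσ.measurePreserving z))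

lemma IsLocal.moveDiff {σ : ℤ → Config → Config} (hσ : IsMove σ) {f : Obs C}
    (hf : IsLocal ν f) (z : ℤ) : IsLocal ν (moveDiff σ z f) :=
  (hf.comp_move hσ z).sub hf

lemma expect_comp_move {σ : ℤ → Config → Config} (hσ : IsMove σ) {f : Obs C}
    (hf : Measurable (fun p : Disorder C × Config => f p.1 p.2)) (z : ℤ) :
    expect ν (fun m ω => f m (σ z ω)) = expect ν f := by
  have h := (MeasurePreserving.id (disorderLaw ν)).prod (hσ.measurePreserving z)
  have h' : MeasurePreserving (Prod.map id (σ z)) (annealed ν) (annealed ν) := h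
  unfold expect
  conv_rhs => rw [← h'.map_eq]
  rw [integral_map h'.measurable.aemeasurable hf.aestronglyMeasurable]
  rfl

/-- Composition with a measure preserving involution is self-adjoint. -/
lemma expect_moveDiff_mul {σ : ℤ → Config → Config} (hσ : IsMove σ) {f g : Obs C}
    (hf : IsLocal ν f) (hg : IsLocal ν g) (z : ℤ) :
    expect ν (moveDiff σ z f * g) = expect ν (f * moveDiff σ z g) := by
  have h1 : expect ν ((fun m ω => f m (σ z ω)) * g) = expect ν (f * fun m ω => g m (σ z ω)) := by
    rw [← expect_comp_move hσ ((hf.comp_move hσ z).measurable.mul hg.measurable) z]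
    congr 1
    funext m ω
    simp [hσ.involutive z ω]
  have e1 : expect ν (moveDiff σ z f * g) =
      expect ν ((fun m ω => f m (σ z ω)) * g) - expect ν (f * g) := by
    refine Eq.trans (integral_congr_ae (Eventually.of_forall fun p => ?_))
      (integral_sub ((hf.comp_move hσ z).integrable_mul hg) (hf.integrable_mul hg))
    simp only [moveDiff, Pi.mul_apply]; ring
  have e2 : expect ν (f * moveDiff σ z g) =
      expect ν (f * fun m ω => g m (σ z ω)) - expect ν (f * g) := by
    refine Eq.trans (integral_congr_ae (Eventually.of_forall fun p => ?_))
      (integral_sub (hf.integrable_mul (hg.comp_move hσ z)) (hf.integrable_mul hg))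
    simp only [moveDiff, Pi.mul_apply]; ring
  rw [e1, e2, h1]

lemma moveDiff_moveDiff {σ : ℤ → Config → Config} (hσ : IsMove σ) (f : Obs C) (z : ℤ) :
    moveDiff σ z (moveDiff σ z f) = (-2 : ℝ) • moveDiff σ z f := by
  funext m ω
  simp only [moveDiff, hσ.involutive z ω, Pi.smul_apply, smul_eq_mul]
  ring

lemma expect_mul_smul (c : ℝ) (f g : Obs C) : expect ν (f * c • g) = c * expect ν (f * g) := by
  unfold expect
  rw [← integral_const_mul]
  congr 1; funext p; simp only [Pi.mul_apply, Pi.smul_apply, smul_eq_mul]; ring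

lemma expect_moveDiff_mul_moveDiff {σ : ℤ → Config → Config} (hσ : IsMove σ) {f g : Obs C}
    (hf : IsLocal ν f) (hg : IsLocal ν g) (z : ℤ) :
    expect ν (moveDiff σ z f * moveDiff σ z g) = -2 * expect ν (f * moveDiff σ z g) := by
  rw [expect_moveDiff_mul hσ hf (hg.moveDiff hσ z), moveDiff_moveDiff hσ, expect_mul_smul]

lemma exists_moveDiff_eq_zero {σ : ℤ → Config → Config} (hσ : IsMove σ) {f : Obs C}
    (hf : IsLocal ν f) : ∃ t : Finset ℤ, ∀ z ∉ t, moveDiff σ z f = 0 := by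
  obtain ⟨s, hs⟩ := hf.cylinder
  obtain ⟨t, ht⟩ := hσ.eventually_eq s
  refine ⟨t, fun z hz => ?_⟩
  funext m ω
  simp only [moveDiff, Pi.zero_apply]
  rw [hs m m (σ z ω) ω (fun _ _ => rfl) (ht z hz ω), sub_self]

lemma genMove_eq_sum {σ : ℤ → Config → Config} {f : Obs C} {t : Finset ℤ}
    (ht : ∀ z ∉ t, moveDiff σ z f = 0) : genMove σ f = ∑ z ∈ t, moveDiff σ z f := by
  funext m ω
  simp only [Finset.sum_apply]
  exact tsum_eq_sum fun z hz => congrFun (congrFun (ht z hz) m) ω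

lemma gradMove_eq_sum {σ : ℤ → Config → Config} {f : Obs C} {t : Finset ℤ}
    (ht : ∀ x ∉ t, moveDiff σ 0 (trans x f) = 0) :
    gradMove σ f = ∑ x ∈ t, moveDiff σ 0 (trans x f) := by
  funext m ω
  simp only [Finset.sum_apply]
  exact tsum_eq_sum fun z hz => congrFun (congrFun (ht z hz) m) ω

/-- By covariance ∇₀τ_x f = τ_x∇_{-x} f, so the set of relevant translations is the reflection of
the set of relevant moves. -/
lemma moveDiff_zero_trans_eq_zero {σ : ℤ → Config → Config} (hσ : IsMove σ) {f : Obs C}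
    {t : Finset ℤ} (ht : ∀ z ∉ t, moveDiff σ z f = 0) :
    ∀ x ∉ t.image Neg.neg, moveDiff σ 0 (trans x f) = 0 := by
  intro x hx
  rw [moveDiff_trans hσ, ht]
  · rfl
  · intro h
    exact hx (Finset.mem_image.2 ⟨_, h, by ring⟩)

lemma IsLocal.genMove {σ : ℤ → Config → Config} (hσ : IsMove σ) {f : Obs C}
    (hf : IsLocal ν f) : IsLocal ν (genMove σ f) := by
  obtain ⟨t, ht⟩ := exists_moveDiff_eq_zero hσ hf
  rw [genMove_eq_sum ht]
  exact IsLocal.sum fun z _ => hf.moveDiff hσ z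

lemma IsLocal.gradMove {σ : ℤ → Config → Config} (hσ : IsMove σ) {f : Obs C}
    (hf : IsLocal ν f) : IsLocal ν (gradMove σ f) := by
  obtain ⟨t, ht⟩ := exists_moveDiff_eq_zero hσ hf
  rw [gradMove_eq_sum (moveDiff_zero_trans_eq_zero hσ ht)]
  exact IsLocal.sum fun z _ => (hf.trans z).moveDiff hσ 0

lemma IsLocal.genS {f : Obs C} (hf : IsLocal ν f) (lam gam : ℝ) : IsLocal ν (genS lam gam f) :=
  ((hf.genMove isMove_flipSite).smul gam).add ((hf.genMove isMove_exch).smul lam)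

lemma genMove_add {σ : ℤ → Config → Config} (hσ : IsMove σ) {f g : Obs C}
    (hf : IsLocal ν f) (hg : IsLocal ν g) : genMove σ (f + g) = genMove σ f + genMove σ g := by
  classical
  obtain ⟨s, hs⟩ := exists_moveDiff_eq_zero hσ hf
  obtain ⟨t, ht⟩ := exists_moveDiff_eq_zero hσ hg
  have hadd : ∀ z, moveDiff σ z (f + g) = moveDiff σ z f + moveDiff σ z g := fun z => by
    funext m ω; simp only [moveDiff, Pi.add_apply]; ring
  have h1 : ∀ z ∉ s ∪ t, moveDiff σ z f = 0 := fun z hz =>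
    hs z fun h => hz (Finset.mem_union_left _ h)
  have h2 : ∀ z ∉ s ∪ t, moveDiff σ z g = 0 := fun z hz =>
    ht z fun h => hz (Finset.mem_union_right _ h)
  rw [genMove_eq_sum h1, genMove_eq_sum h2, genMove_eq_sum (t := s ∪ t), ← Finset.sum_add_distrib]
  · exact Finset.sum_congr rfl fun z _ => hadd z
  · intro z hz
    rw [hadd, h1 z hz, h2 z hz, add_zero]

lemma genMove_smul (σ : ℤ → Config → Config) (c : ℝ) (f : Obs C) :
    genMove σ (c • f) = c • genMove σ f := by
  funext m ω
  simp only [genMove, Pi.smul_apply, smul_eq_mul, ← mul_sub]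
  exact tsum_mul_left

lemma genS_add {f g : Obs C} (hf : IsLocal ν f) (hg : IsLocal ν g) (lam gam : ℝ) :
    genS lam gam (f + g) = genS lam gam f + genS lam gam g := by
  simp only [genS_eq, genMove_add isMove_flipSite hf hg, genMove_add isMove_exch hf hg, smul_add]
  abel

lemma genS_smul (lam gam c : ℝ) (f : Obs C) : genS lam gam (c • f) = c • genS lam gam f := by
  simp only [genS_eq, genMove_smul, smul_add, smul_comm _ c]

lemma star_smul_right (c : ℝ) (f g : Obs C) : starProd ν f (c • g) = c * starProd ν f g := by
  unfold starProd
  rw [← tsum_mul_left]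
  exact tsum_congr fun x => expect_mul_smul c f (trans x g)

lemma star_add_right {f g h : Obs C} (hf : IsLocal ν f) (hg : IsLocal ν g) (hh : IsLocal ν h) :
    starProd ν f (g + h) = starProd ν f g + starProd ν f h := by
  rw [hf.star_comm (hg.add hh), hg.star_add_left hh hf, hg.star_comm hf, hh.star_comm hf]

/-- The Dirichlet form of the dynamics of formal sums. -/
lemma expect_gradMove_mul {σ : ℤ → Config → Config} (hσ : IsMove σ) {f g : Obs C}
    (hf : IsLocal ν f) (hg : IsLocal ν g) :
    expect ν (gradMove σ f * gradMove σ g) = -2 * starProd ν f (genMove σ g) := by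
  classical
  obtain ⟨s, hs⟩ := exists_moveDiff_eq_zero hσ hf
  obtain ⟨t, ht⟩ := exists_moveDiff_eq_zero hσ hg
  -- Both sides of the identity are the sum over ℤ² of this array, up to the factor -2. The array
  -- has finite support because f and g are local, so the order of summation is free.
  set Φ : ℤ → ℤ → ℝ := fun z w => expect ν (f * moveDiff σ z (trans w g)) with hΦ
  have hz1 : ∀ z w, z ∉ s → Φ z w = 0 := by
    intro z w hz
    rw [hΦ]
    simp only
    rw [← expect_moveDiff_mul hσ hf (hg.trans w), hs z hz, zero_mul]
    simp [expect]
  have hz2 : ∀ z w, z - w ∉ t → Φ z w = 0 := by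
    intro z w hz
    rw [hΦ]
    simp only
    rw [moveDiff_trans hσ, ht _ hz]
    simp [expect, DisorderedChain.trans]
  have hsum : Summable (Function.uncurry Φ) := by
    refine summable_of_ne_finset_zero (s := s ×ˢ Finset.image₂ (fun a b => a - b) s t) ?_
    rintro ⟨z, w⟩ h
    simp only [Function.uncurry]
    by_contra hne
    refine h (Finset.mem_product.2 ⟨?_, Finset.mem_image₂.2 ⟨z, ?_, z - w, ?_, by simp⟩⟩)
    · exact by_contra fun h' => hne (hz1 z w h')
    · exact by_contra fun h' => hne (hz1 z w h')
    · exact by_contra fun h' => hne (hz2 z w h')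
  have hR : starProd ν f (genMove σ g) = ∑' z, ∑' w, Φ z w := by
    rw [← hsum.tsum_comm (f := Φ)]
    unfold starProd
    refine tsum_congr fun w => ?_
    have e1 : DisorderedChain.trans w (genMove σ g) =
        ∑ z ∈ t, moveDiff σ (z + w) (DisorderedChain.trans w g) := by
      rw [genMove_eq_sum ht]
      funext m ω
      simp only [← trans_moveDiff hσ, DisorderedChain.trans, Finset.sum_apply]
    rw [e1, expect_sum_right hf fun z _ => (hg.trans w).moveDiff hσ _,
      ← (Equiv.addRight w).tsum_eq fun z => Φ z w]
    refine (tsum_eq_sum fun z hz => hz2 _ _ ?_).symm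
    simpa using hz
  have hL : expect ν (gradMove σ f * gradMove σ g) = -2 * ∑' x, ∑' y, Φ (-x) (y - x) := by
    rw [gradMove_eq_sum (moveDiff_zero_trans_eq_zero hσ hs),
      gradMove_eq_sum (moveDiff_zero_trans_eq_zero hσ ht), expect_sum_right
        (IsLocal.sum fun x _ => (hf.trans x).moveDiff hσ 0)
        (fun y _ => (hg.trans y).moveDiff hσ 0)]
    rw [tsum_eq_sum (s := s.image Neg.neg), Finset.mul_sum]
    · have : ∀ y, expect ν ((∑ x ∈ s.image Neg.neg, moveDiff σ 0 (DisorderedChain.trans x f)) *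
          moveDiff σ 0 (DisorderedChain.trans y g)) =
          ∑ x ∈ s.image Neg.neg, -2 * Φ (-x) (y - x) := by
        intro y
        rw [expect_mul_comm, expect_sum_right ((hg.trans y).moveDiff hσ 0)
          (fun x _ => (hf.trans x).moveDiff hσ 0)]
        refine Finset.sum_congr rfl fun x _ => ?_
        rw [expect_mul_comm, expect_moveDiff_mul_moveDiff hσ (hf.trans x) (hg.trans y)]
        congr 1
        -- Translation by x carries the move at -x to the move at 0; translation invariance of ℙ⋆
        -- then identifies the entry as Φ(-x, y - x).
        have e2 : DisorderedChain.trans x f * moveDiff σ 0 (DisorderedChain.trans y g) =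
            DisorderedChain.trans x (f * moveDiff σ (-x) (DisorderedChain.trans (y - x) g)) := by
          rw [trans_mul, trans_moveDiff hσ, trans_trans, neg_add_cancel, sub_add_cancel]
        rw [e2, expect_trans]
        exact hf.measurable.mul ((hg.trans _).moveDiff hσ _).measurable
      rw [Finset.sum_congr rfl fun y _ => this y, Finset.sum_comm]
      refine Finset.sum_congr rfl fun x _ => ?_
      rw [← Finset.mul_sum]
      congr 1
      refine (tsum_eq_sum fun y hy => hz2 _ _ fun h => hy ?_).symm
      exact Finset.mem_image.2 ⟨_, h, by ring⟩
    · intro x hx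
      have : ∀ y, Φ (-x) (y - x) = 0 := fun y => hz1 _ _ fun h =>
        hx (Finset.mem_image.2 ⟨_, h, by ring⟩)
      simp [this]
  rw [hL, hR]
  congr 1
  rw [← (Equiv.neg ℤ).tsum_eq fun z => ∑' w, Φ z w]
  refine tsum_congr fun x => ?_
  exact (Equiv.subRight x).tsum_eq fun w => Φ (-x) w

lemma starProd_genMove_comm {σ : ℤ → Config → Config} (hσ : IsMove σ) {f g : Obs C}
    (hf : IsLocal ν f) (hg : IsLocal ν g) :
    starProd ν f (genMove σ g) = starProd ν (genMove σ f) g := by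
  have h1 := expect_gradMove_mul hσ hf hg
  have h2 := expect_gradMove_mul hσ hg hf
  rw [expect_mul_comm] at h2
  rw [(hf.genMove hσ).star_comm hg]
  linarith

lemma starProd_genMove_nonpos {σ : ℤ → Config → Config} (hσ : IsMove σ) {f : Obs C}
    (hf : IsLocal ν f) : starProd ν f (genMove σ f) ≤ 0 := by
  have h1 := expect_gradMove_mul hσ hf hf
  have h2 : 0 ≤ expect ν (gradMove σ f * gradMove σ f) :=
    integral_nonneg fun p => mul_self_nonneg _
  linarith

lemma starProd_genS {f g : Obs C} (hf : IsLocal ν f) (hg : IsLocal ν g) (lam gam : ℝ) :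
    starProd ν f (genS lam gam g) =
      gam * starProd ν f (genMove flipSite g) + lam * starProd ν f (genMove exch g) := by
  rw [genS_eq, star_add_right hf ((hg.genMove isMove_flipSite).smul gam)
    ((hg.genMove isMove_exch).smul lam), star_smul_right, star_smul_right]

lemma starProd_genS_comm {f g : Obs C} (hf : IsLocal ν f) (hg : IsLocal ν g) (lam gam : ℝ) :
    starProd ν f (genS lam gam g) = starProd ν (genS lam gam f) g := by
  rw [(hf.genS lam gam).star_comm hg, starProd_genS hf hg, starProd_genS hg hf,
    starProd_genMove_comm isMove_flipSite hf hg, starProd_genMove_comm isMove_exch hf hg,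
    hg.star_comm (hf.genMove isMove_flipSite), hg.star_comm (hf.genMove isMove_exch)]

lemma starProd_genS_nonpos {f : Obs C} (hf : IsLocal ν f) {lam gam : ℝ} (hlam : 0 ≤ lam)
    (hgam : 0 ≤ gam) : starProd ν f (genS lam gam f) ≤ 0 := by
  rw [starProd_genS hf hf]
  nlinarith [starProd_genMove_nonpos isMove_flipSite hf, starProd_genMove_nonpos isMove_exch hf]

end Moves

/-! ### Functions of polynomial growth, closed under the operations used below and integrable. -/

section PolynomialGrowth

/-- Measurable functions of at most polynomial growth in finitely many coordinates. -/
def PolyGrowth (F : Config → ℝ) : Prop :=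
  Measurable F ∧ ∃ (s : Finset ℤ) (c : ℝ) (n : ℕ), ∀ ω, |F ω| ≤ c * (1 + ∑ y ∈ s, |ω y|) ^ n

lemma one_le_boxSum (s : Finset ℤ) (ω : Config) : 1 ≤ 1 + ∑ y ∈ s, |ω y| :=
  le_add_of_nonneg_right (Finset.sum_nonneg fun _ _ => abs_nonneg _)

lemma boxSum_pow_mono {s t : Finset ℤ} (hst : s ⊆ t) {n k : ℕ} (hnk : n ≤ k) (ω : Config) :
    (1 + ∑ y ∈ s, |ω y|) ^ n ≤ (1 + ∑ y ∈ t, |ω y|) ^ k := by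
  refine (pow_le_pow_left₀ (by have := one_le_boxSum s ω; linarith) ?_ n).trans
    (pow_le_pow_right₀ (one_le_boxSum t ω) hnk)
  gcongr

namespace PolyGrowth

variable {F G : Config → ℝ}

lemma mul (hF : PolyGrowth F) (hG : PolyGrowth G) : PolyGrowth (fun ω => F ω * G ω) := by
  classical
  obtain ⟨hF0, s, c, n, hF⟩ := hF
  obtain ⟨hG0, t, d, k, hG⟩ := hG
  refine ⟨hF0.mul hG0, s ∪ t, c * d, n + k, fun ω => ?_⟩
  have hc : 0 ≤ c * (1 + ∑ y ∈ s, |ω y|) ^ n := (abs_nonneg _).trans (hF ω)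
  have hc0 : 0 ≤ c := by
    have : 0 < (1 + ∑ y ∈ s, |ω y|) ^ n := pow_pos (by have := one_le_boxSum s ω; linarith) n
    exact nonneg_of_mul_nonneg_left hc this
  have hd0 : 0 ≤ d := by
    have : 0 < (1 + ∑ y ∈ t, |ω y|) ^ k := pow_pos (by have := one_le_boxSum t ω; linarith) k
    exact nonneg_of_mul_nonneg_left ((abs_nonneg _).trans (hG ω)) this
  calc |F ω * G ω| = |F ω| * |G ω| := abs_mul _ _
    _ ≤ (c * (1 + ∑ y ∈ s ∪ t, |ω y|) ^ n) * (d * (1 + ∑ y ∈ s ∪ t, |ω y|) ^ k) := by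
        refine mul_le_mul ((hF ω).trans ?_) ((hG ω).trans ?_) (abs_nonneg _) ?_
        · exact mul_le_mul_of_nonneg_left (boxSum_pow_mono Finset.subset_union_left le_rfl ω) hc0
        · exact mul_le_mul_of_nonneg_left (boxSum_pow_mono Finset.subset_union_right le_rfl ω) hd0
        · have := one_le_boxSum (s ∪ t) ω
          positivity
    _ = c * d * (1 + ∑ y ∈ s ∪ t, |ω y|) ^ (n + k) := by ring

lemma add (hF : PolyGrowth F) (hG : PolyGrowth G) : PolyGrowth (fun ω => F ω + G ω) := by
  classical
  obtain ⟨hF0, s, c, n, hF⟩ := hF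
  obtain ⟨hG0, t, d, k, hG⟩ := hG
  refine ⟨hF0.add hG0, s ∪ t, |c| + |d|, max n k, fun ω => ?_⟩
  calc |F ω + G ω| ≤ |F ω| + |G ω| := abs_add_le _ _
    _ ≤ |c| * (1 + ∑ y ∈ s, |ω y|) ^ n + |d| * (1 + ∑ y ∈ t, |ω y|) ^ k := by
        have h1 := one_le_boxSum s ω
        have h2 := one_le_boxSum t ω
        refine add_le_add ((hF ω).trans ?_) ((hG ω).trans ?_)
        · exact mul_le_mul_of_nonneg_right (le_abs_self c) (by positivity)
        · exact mul_le_mul_of_nonneg_right (le_abs_self d) (by positivity)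
    _ ≤ |c| * (1 + ∑ y ∈ s ∪ t, |ω y|) ^ (max n k)
        + |d| * (1 + ∑ y ∈ s ∪ t, |ω y|) ^ (max n k) :=
        add_le_add
          (mul_le_mul_of_nonneg_left
            (boxSum_pow_mono Finset.subset_union_left (le_max_left _ _) ω) (abs_nonneg _))
          (mul_le_mul_of_nonneg_left
            (boxSum_pow_mono Finset.subset_union_right (le_max_right _ _) ω) (abs_nonneg _))
    _ = _ := by ring

lemma const (c : ℝ) : PolyGrowth (fun _ => c) :=
  ⟨measurable_const, ∅, |c|, 0, fun ω => by simp⟩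

lemma eval (x : ℤ) : PolyGrowth (fun ω => ω x) :=
  ⟨measurable_pi_apply x, {x}, 1, 1, fun ω => by simp⟩

lemma sum {ι : Type*} {s : Finset ι} {F : ι → Config → ℝ} (hF : ∀ i ∈ s, PolyGrowth (F i)) :
    PolyGrowth (fun ω => ∑ i ∈ s, F i ω) := by
  classical
  induction s using Finset.induction_on with
  | empty => simpa using const 0
  | insert a s ha ih =>
    simp only [Finset.sum_insert ha]
    exact (hF a (Finset.mem_insert_self _ _)).add
      (ih fun i hi => hF i (Finset.mem_insert_of_mem hi))

lemma integrable (hF : PolyGrowth F) : Integrable F gibbs := by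
  obtain ⟨hF0, s, c, n, hF⟩ := hF
  exact (memLp_of_growth hF0 hF 1 (by simp)).integrable le_rfl

lemma comp_shift (hF : PolyGrowth F) (x : ℤ) : PolyGrowth (fun ω => F (shift x ω)) := by
  obtain ⟨hF0, s, c, n, hF⟩ := hF
  refine ⟨hF0.comp (measurable_shift x), s.image (fun y => x + y), c, n, fun ω => ?_⟩
  rw [Finset.sum_image (fun a _ b _ h => by simpa using h)]
  exact hF (shift x ω)

end PolyGrowth

end PolynomialGrowth

/-! ### The Hamiltonian derivation and its antisymmetry in L²(μ₁) for a fixed disorder. -/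

section Hamiltonian

variable {C : ℝ}

/-- The derivative in the coordinate `x`. -/
noncomputable def coordDeriv (x : ℤ) (F : Config → ℝ) : Config → ℝ :=
  fun ω => deriv (fun t => F (Function.update ω x t)) (ω x)

/-- The Hamiltonian vector field. -/
noncomputable def drift (m : Disorder C) (x : ℤ) (ω : Config) : ℝ :=
  ω (x + 1) / √((m x : ℝ) * m (x + 1)) - ω (x - 1) / √((m (x - 1) : ℝ) * m x)

/-- The Hamiltonian derivation for a fixed disorder. -/
noncomputable def hamil (m : Disorder C) (F : Config → ℝ) : Config → ℝ :=
  fun ω => ∑' x : ℤ, drift m x ω * coordDeriv x F ω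

lemma genA_apply (f : Obs C) (m : Disorder C) : genA f m = hamil m (f m) := rfl

/-- Differentiable functions of finitely many coordinates, of polynomial growth. -/
structure SmoothCyl (F : Config → ℝ) : Prop where
  cylinder : ∃ s : Finset ℤ, ∀ ω ω', (∀ x ∈ s, ω x = ω' x) → F ω = F ω'
  differentiable : ∀ ω x, Differentiable ℝ (fun t => F (Function.update ω x t))
  growth : PolyGrowth F
  growth_deriv : ∀ x, PolyGrowth (coordDeriv x F)

variable {F G : Config → ℝ} {m : Disorder C}

lemma coordDeriv_eq_zero {s : Finset ℤ} (hs : ∀ ω ω', (∀ x ∈ s, ω x = ω' x) → F ω = F ω')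
    {x : ℤ} (hx : x ∉ s) : coordDeriv x F = 0 := by
  funext ω
  have : (fun t => F (Function.update ω x t)) = fun _ => F ω := funext fun t =>
    hs _ _ fun y hy => Function.update_of_ne (by rintro rfl; exact hx hy) _ _
  simp [coordDeriv, this]

lemma hamil_eq_sum {s : Finset ℤ} (hs : ∀ ω ω', (∀ x ∈ s, ω x = ω' x) → F ω = F ω') :
    hamil m F = fun ω => ∑ x ∈ s, drift m x ω * coordDeriv x F ω := by
  funext ω
  exact tsum_eq_sum fun x hx => by rw [coordDeriv_eq_zero hs hx]; simp

namespace SmoothCyl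

lemma coordDeriv_mul (hF : SmoothCyl F) (hG : SmoothCyl G) (x : ℤ) :
    coordDeriv x (fun ω => F ω * G ω) =
      fun ω => coordDeriv x F ω * G ω + F ω * coordDeriv x G ω := by
  funext ω
  have := ((hF.differentiable ω x (ω x)).hasDerivAt.fun_mul
    (hG.differentiable ω x (ω x)).hasDerivAt).deriv
  simpa [coordDeriv] using this

lemma mul (hF : SmoothCyl F) (hG : SmoothCyl G) : SmoothCyl (fun ω => F ω * G ω) where
  cylinder := by
    classical
    obtain ⟨s, hs⟩ := hF.cylinder
    obtain ⟨t, ht⟩ := hG.cylinder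
    exact ⟨s ∪ t, fun ω ω' h => by
      rw [hs ω ω' fun x hx => h x (Finset.mem_union_left _ hx),
        ht ω ω' fun x hx => h x (Finset.mem_union_right _ hx)]⟩
  differentiable ω x := (hF.differentiable ω x).mul (hG.differentiable ω x)
  growth := hF.growth.mul hG.growth
  growth_deriv x := by
    rw [hF.coordDeriv_mul hG]
    exact ((hF.growth_deriv x).mul hG.growth).add (hF.growth.mul (hG.growth_deriv x))

lemma comp_shift (hF : SmoothCyl F) (x : ℤ) : SmoothCyl (fun ω => F (shift x ω)) := by
  have hup : ∀ (ω : Config) (y : ℤ) (t : ℝ),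
      shift x (Function.update ω y t) = Function.update (shift x ω) (y - x) t := by
    intro ω y t
    funext z
    by_cases h : z = y - x
    · subst h; simp [shift]
    · have : x + z ≠ y := by omega
      simp [shift, h, this]
  have hd : ∀ y, coordDeriv y (fun ω => F (shift x ω)) =
      fun ω => coordDeriv (y - x) F (shift x ω) := by
    intro y
    funext ω
    simp [coordDeriv, hup, shift]
  refine ⟨?_, fun ω y => ?_, hF.growth.comp_shift x, fun y => ?_⟩
  · obtain ⟨s, hs⟩ := hF.cylinder
    exact ⟨s.image fun z => x + z, fun ω ω' h => hs _ _ fun z hz =>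
      h _ (Finset.mem_image_of_mem _ hz)⟩
  · simp only [hup]
    exact hF.differentiable _ _
  · rw [hd]
    exact (hF.growth_deriv _).comp_shift x

lemma hamil_mul (hF : SmoothCyl F) (hG : SmoothCyl G) (ω : Config) :
    hamil m (fun ω => F ω * G ω) ω = hamil m F ω * G ω + F ω * hamil m G ω := by
  classical
  obtain ⟨s, hs⟩ := hF.cylinder
  obtain ⟨t, ht⟩ := hG.cylinder
  have hs' : ∀ ω ω', (∀ x ∈ s ∪ t, ω x = ω' x) → F ω = F ω' := fun ω ω' h =>
    hs ω ω' fun x hx => h x (Finset.mem_union_left _ hx)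
  have ht' : ∀ ω ω', (∀ x ∈ s ∪ t, ω x = ω' x) → G ω = G ω' := fun ω ω' h =>
    ht ω ω' fun x hx => h x (Finset.mem_union_right _ hx)
  rw [hamil_eq_sum hs', hamil_eq_sum ht', hamil_eq_sum (s := s ∪ t)
    (fun ω ω' h => by rw [hs' ω ω' h, ht' ω ω' h]), Finset.sum_mul, Finset.mul_sum,
    ← Finset.sum_add_distrib]
  refine Finset.sum_congr rfl fun x _ => ?_
  rw [hF.coordDeriv_mul hG]
  ring

end SmoothCyl

lemma polyGrowth_drift (x : ℤ) : PolyGrowth (drift m x) := by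
  have h : drift m x = fun ω => (√((m x : ℝ) * m (x + 1)))⁻¹ * ω (x + 1) +
      (-(√((m (x - 1) : ℝ) * m x))⁻¹) * ω (x - 1) := by
    funext ω; simp only [drift]; ring
  rw [h]
  exact ((PolyGrowth.const _).mul (.eval _)).add ((PolyGrowth.const _).mul (.eval _))

lemma SmoothCyl.polyGrowth_hamil (hF : SmoothCyl F) : PolyGrowth (hamil m F) := by
  obtain ⟨s, hs⟩ := hF.cylinder
  rw [hamil_eq_sum hs]
  exact PolyGrowth.sum fun x _ => (polyGrowth_drift x).mul (hF.growth_deriv x)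

/-- The Gibbs measure is invariant for the Hamiltonian dynamics. -/
lemma SmoothCyl.integral_hamil (hF : SmoothCyl F) : ∫ ω, hamil m F ω ∂gibbs = 0 := by
  obtain ⟨s, hs⟩ := hF.cylinder
  -- The expectation attached to the bond {x, x + 1}; it vanishes by parity as soon as `F` ignores
  -- one end of the bond.
  set e : ℤ → ℝ := fun x => ∫ ω, (ω x * ω (x + 1) / √((m x : ℝ) * m (x + 1))) * F ω ∂gibbs
    with he
  have hflip : ∀ y ∉ s, ∀ ω, F (flipSite y ω) = F ω := fun y hy ω => hs _ _ fun x hx => by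
    rw [flipSite_apply, if_neg]; rintro rfl; exact hy hx
  have he0 : ∀ x, ¬ (x ∈ s ∧ x + 1 ∈ s) → e x = 0 := by
    intro x hx
    by_cases h : x ∈ s
    · have h1 : x + 1 ∉ s := fun h' => hx ⟨h, h'⟩
      refine integral_eq_zero_of_flip (x + 1) fun ω => ?_
      rw [hflip _ h1, flipSite_apply, flipSite_apply, if_neg (by omega), if_pos rfl]
      ring
    · refine integral_eq_zero_of_flip x fun ω => ?_
      rw [hflip _ h, flipSite_apply, flipSite_apply, if_pos rfl, if_neg (by omega)]
      ring
  -- The drift at x does not involve ω_x, so Stein's identity trades ∂_x for multiplication by ω_x;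
  -- the product of ω_x with the drift is a difference of two consecutive bond terms, and the sum
  -- telescopes.
  have hstein : ∀ x, ∫ ω, drift m x ω * coordDeriv x F ω ∂gibbs = e x - e (x - 1) := by
    intro x
    have hup : ∀ (ω : Config) t, drift m x (Function.update ω x t) = drift m x ω := by
      intro ω t; simp [drift]
    have hG := integral_deriv_update (G := fun ω => drift m x ω * F ω) (x := x)
      (fun ω => by simp only [hup]; exact (hF.differentiable ω x).const_mul _)
      ((polyGrowth_drift x).mul hF.growth).integrable
      (by
        simp only [hup]
        simp_rw [deriv_const_mul_field]
        exact ((polyGrowth_drift x).mul (hF.growth_deriv x)).integrable)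
      ((PolyGrowth.eval x).mul ((polyGrowth_drift x).mul hF.growth)).integrable
    simp only [hup] at hG
    simp_rw [deriv_const_mul_field] at hG
    refine Eq.trans hG ?_
    have hint : ∀ x, Integrable
        (fun ω : Config => (ω x * ω (x + 1) / √((m x : ℝ) * m (x + 1))) * F ω) gibbs := by
      intro x
      refine Integrable.congr ((((PolyGrowth.eval x).mul (.eval (x + 1))).mul
        (.const (√((m x : ℝ) * m (x + 1)))⁻¹)).mul hF.growth).integrable
        (Eventually.of_forall fun ω => ?_)
      simp only [div_eq_mul_inv]
    rw [he]
    simp only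
    rw [← integral_sub (hint x) (hint (x - 1))]
    congr 1
    funext ω
    simp only [drift, sub_add_cancel]
    ring
  rw [hamil_eq_sum hs, integral_finsetSum _ fun x _ =>
    ((polyGrowth_drift x).mul (hF.growth_deriv x)).integrable,
    Finset.sum_congr rfl fun x _ => hstein x, Finset.sum_sub_distrib, sub_eq_zero]
  have h1 : ∑' x, e x = ∑ x ∈ s, e x := tsum_eq_sum fun x hx => he0 x fun h => hx h.1
  have h2 : ∑' x, e (x - 1) = ∑ x ∈ s, e (x - 1) := tsum_eq_sum fun x hx =>
    he0 _ fun h => hx (by simpa using h.2)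
  rw [← h1, ← h2]
  exact ((Equiv.subRight (1 : ℤ)).tsum_eq e).symm

/-- Invariance of the measure applied to the product FG, expanded by the Leibniz rule. -/
lemma SmoothCyl.integral_mul_hamil (hF : SmoothCyl F) (hG : SmoothCyl G) :
    ∫ ω, F ω * hamil m G ω ∂gibbs = -∫ ω, hamil m F ω * G ω ∂gibbs := by
  have h := (hF.mul hG).integral_hamil (m := m)
  simp_rw [hF.hamil_mul hG] at h
  rw [integral_add (hF.polyGrowth_hamil.mul hG.growth).integrable
    (hF.growth.mul hG.polyGrowth_hamil).integrable] at h
  linarith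

lemma hamil_shift (x : ℤ) (F : Config → ℝ) (ω : Config) :
    hamil (shift x m) F (shift x ω) = hamil m (fun ω => F (shift x ω)) ω := by
  unfold hamil
  conv_rhs => rw [← (Equiv.addLeft x).tsum_eq]
  refine tsum_congr fun y => ?_
  have hup : ∀ t : ℝ,
      Function.update (shift x ω) y t = shift x (Function.update ω (x + y) t) := by
    intro t
    funext z
    by_cases h : z = y
    · subst h; simp [shift]
    · simp [shift, h]
  simp only [Equiv.coe_addLeft, drift, coordDeriv, hup, shift]
  simp only [add_assoc, add_sub_assoc]

lemma trans_genA (x : ℤ) (f : Obs C) : trans x (genA f) = genA (trans x f) := by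
  funext m ω
  exact hamil_shift x (f (shift x m)) ω

end Hamiltonian

/-! ### Dissipativity of the generator on L²_⋆ and uniqueness for the resolvent equation. -/

section Antisymmetry

variable {C : ℝ} {ν : Measure (Set.Icc C⁻¹ C)} [IsProbabilityMeasure ν] {f g : Obs C}

lemma IsSmooth.smoothCyl (hf : IsSmooth f) (hl : IsLocal ν f) (m : Disorder C) :
    SmoothCyl (f m) where
  cylinder := by
    obtain ⟨s, hs⟩ := hl.cylinder
    exact ⟨s, fun ω ω' h => hs _ _ _ _ (fun _ _ => rfl) h⟩
  differentiable ω x := hf.differentiable m ω x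
  growth := by
    obtain ⟨s, c, n, h⟩ := hf.growth
    exact ⟨hl.measurable_section m, s, c, n, fun ω => (h m ω 0).1⟩
  growth_deriv x := by
    obtain ⟨s, c, n, h⟩ := hf.growth
    exact ⟨(hf.continuous_deriv m x).measurable, s, c, n, fun ω => (h m ω x).2⟩

/-- Since 𝒜 commutes with translations, antisymmetry in L²(μ₁) for each fixed disorder can be used
term by term in the sum over x. -/
lemma starProd_genA (hf : IsLocal ν f) (hg : IsLocal ν g) (hfs : IsSmooth f) (hgs : IsSmooth g)
    (hAf : IsLocal ν (genA f)) (hAg : IsLocal ν (genA g)) :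
    starProd ν f (genA g) = -starProd ν (genA f) g := by
  unfold starProd
  rw [← tsum_neg]
  refine tsum_congr fun x => ?_
  have e1 : expect ν (f * trans x (genA g)) =
      ∫ m, ∫ ω, f m ω * trans x (genA g) m ω ∂gibbs ∂(disorderLaw ν) :=
    integral_prod _ (hf.integrable_mul (hAg.trans x))
  have e2 : expect ν (genA f * trans x g) =
      ∫ m, ∫ ω, genA f m ω * trans x g m ω ∂gibbs ∂(disorderLaw ν) :=
    integral_prod _ (hAf.integrable_mul (hg.trans x))
  rw [e1, e2, ← integral_neg]
  congr 1
  funext m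
  rw [trans_genA]
  exact (hfs.smoothCyl hf m).integral_mul_hamil
    ((hgs.smoothCyl hg (shift x m)).comp_shift x)

lemma starProd_gen_nonpos (hf : IsLocal ν f) (hfs : IsSmooth f) {lam gam : ℝ} (hlam : 0 ≤ lam)
    (hgam : 0 ≤ gam) (hL : IsLocal ν (gen lam gam f)) : starProd ν f (gen lam gam f) ≤ 0 := by
  -- Only the image under the full generator is assumed to be in 𝒞; its Hamiltonian part is
  -- recovered by subtracting 𝒮f.
  have hA : IsLocal ν (genA f) := by
    have := hL.sub (hf.genS lam gam)
    rwa [gen, add_sub_cancel_right] at this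
  have h1 := starProd_genA hf hf hfs hfs hA hA
  rw [hA.star_comm hf] at h1
  rw [gen, star_add_right hf hA (hf.genS lam gam)]
  linarith [starProd_genS_nonpos hf hlam hgam]

lemma partialDeriv_add (hf : IsSmooth f) (hg : IsSmooth g) (x : ℤ) :
    partialDeriv x (f + g) = partialDeriv x f + partialDeriv x g := by
  funext m ω
  exact ((hf.differentiable m ω x (ω x)).hasDerivAt.add
    (hg.differentiable m ω x (ω x)).hasDerivAt).deriv

lemma partialDeriv_smul (c : ℝ) (f : Obs C) (x : ℤ) :
    partialDeriv x (c • f) = c • partialDeriv x f := by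
  funext m ω
  simp only [partialDeriv, Pi.smul_apply, smul_eq_mul, deriv_const_mul_field]

lemma IsSmooth.add (hf : IsSmooth f) (hg : IsSmooth g) : IsSmooth (f + g) where
  differentiable m ω x := (hf.differentiable m ω x).add (hg.differentiable m ω x)
  continuous_deriv m x := by
    rw [partialDeriv_add hf hg]
    exact (hf.continuous_deriv m x).add (hg.continuous_deriv m x)
  growth := by
    classical
    obtain ⟨s, c, n, h⟩ := hf.growth
    obtain ⟨t, d, k, h'⟩ := hg.growth
    refine ⟨s ∪ t, |c| + |d|, max n k, fun m ω x => ?_⟩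
    have h1 := one_le_boxSum s ω
    have h2 := one_le_boxSum t ω
    have key : c * (1 + ∑ y ∈ s, |ω y|) ^ n + d * (1 + ∑ y ∈ t, |ω y|) ^ k ≤
        (|c| + |d|) * (1 + ∑ y ∈ s ∪ t, |ω y|) ^ (max n k) := by
      rw [add_mul]
      refine add_le_add ?_ ?_
      · exact (mul_le_mul_of_nonneg_right (le_abs_self c) (by positivity)).trans
          (mul_le_mul_of_nonneg_left
            (boxSum_pow_mono Finset.subset_union_left (le_max_left _ _) ω) (abs_nonneg _))
      · exact (mul_le_mul_of_nonneg_right (le_abs_self d) (by positivity)).trans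
          (mul_le_mul_of_nonneg_left
            (boxSum_pow_mono Finset.subset_union_right (le_max_right _ _) ω) (abs_nonneg _))
    rw [partialDeriv_add hf hg]
    exact ⟨(abs_add_le _ _).trans ((add_le_add (h m ω x).1 (h' m ω x).1).trans key),
      (abs_add_le _ _).trans ((add_le_add (h m ω x).2 (h' m ω x).2).trans key)⟩

lemma IsSmooth.smul (c : ℝ) (hf : IsSmooth f) : IsSmooth (c • f) where
  differentiable m ω x := (hf.differentiable m ω x).const_smul c
  continuous_deriv m x := by
    rw [partialDeriv_smul]
    exact (hf.continuous_deriv m x).const_smul c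
  growth := by
    obtain ⟨s, d, n, h⟩ := hf.growth
    refine ⟨s, |c| * d, n, fun m ω x => ?_⟩
    rw [partialDeriv_smul]
    simp only [Pi.smul_apply, smul_eq_mul, abs_mul, mul_assoc]
    exact ⟨mul_le_mul_of_nonneg_left (h m ω x).1 (abs_nonneg _),
      mul_le_mul_of_nonneg_left (h m ω x).2 (abs_nonneg _)⟩

lemma IsSmooth.zero : IsSmooth (0 : Obs C) := by
  have h : ∀ x, partialDeriv x (0 : Obs C) = 0 := fun x => by
    funext m ω; simp [partialDeriv]
  refine ⟨fun m ω x => by simp, fun m x => ?_, ⟨∅, 0, 0, fun m ω x => by simp [h]⟩⟩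
  rw [h]; exact continuous_const

lemma genA_add (hf : IsLocal ν f) (hg : IsLocal ν g) (hfs : IsSmooth f) (hgs : IsSmooth g) :
    genA (f + g) = genA f + genA g := by
  classical
  funext m ω
  obtain ⟨s, hs⟩ := (hfs.smoothCyl hf m).cylinder
  obtain ⟨t, ht⟩ := (hgs.smoothCyl hg m).cylinder
  have hs' : ∀ ω ω', (∀ x ∈ s ∪ t, ω x = ω' x) → f m ω = f m ω' := fun ω ω' h =>
    hs ω ω' fun x hx => h x (Finset.mem_union_left _ hx)
  have ht' : ∀ ω ω', (∀ x ∈ s ∪ t, ω x = ω' x) → g m ω = g m ω' := fun ω ω' h =>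
    ht ω ω' fun x hx => h x (Finset.mem_union_right _ hx)
  simp only [genA_apply, Pi.add_apply]
  rw [hamil_eq_sum hs', hamil_eq_sum ht', hamil_eq_sum (F := f m + g m) (s := s ∪ t)
    (fun ω ω' h => by simp only [Pi.add_apply]; rw [hs' ω ω' h, ht' ω ω' h]),
    ← Finset.sum_add_distrib]
  refine Finset.sum_congr rfl fun x _ => ?_
  have := congrFun (congrFun (partialDeriv_add hfs hgs x) m) ω
  change coordDeriv x (f m + g m) ω = coordDeriv x (f m) ω + coordDeriv x (g m) ω at this
  rw [this]
  ring

lemma genA_smul (c : ℝ) (f : Obs C) : genA (c • f) = c • genA f := by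
  funext m ω
  simp only [genA, partialDeriv_smul, Pi.smul_apply, smul_eq_mul]
  rw [← tsum_mul_left]
  exact tsum_congr fun x => by ring

lemma gen_add (hf : IsLocal ν f) (hg : IsLocal ν g) (hfs : IsSmooth f) (hgs : IsSmooth g)
    (lam gam : ℝ) : gen lam gam (f + g) = gen lam gam f + gen lam gam g := by
  simp only [gen, genA_add hf hg hfs hgs, genS_add hf hg]
  abel

lemma gen_smul (lam gam c : ℝ) (f : Obs C) : gen lam gam (c • f) = c • gen lam gam f := by
  simp only [gen, genA_smul, genS_smul, smul_add]

lemma toHilbert_add (hf : IsLocal ν f) (hg : IsLocal ν g) :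
    toHilbert (f + g) (hf.add hg) = toHilbert f hf + toHilbert g hg := by
  unfold toHilbert
  rw [← UniformSpace.Completion.coe_add]
  rfl

lemma toHilbert_smul (c : ℝ) (hf : IsLocal ν f) :
    toHilbert (c • f) (hf.smul c) = c • toHilbert f hf := by
  unfold toHilbert
  rw [← UniformSpace.Completion.coe_smul]
  rfl

lemma sub_mem_generatorGraph {lam gam : ℝ} {p q : HilbertStar ν × HilbertStar ν}
    (hp : p ∈ generatorGraph ν lam gam) (hq : q ∈ generatorGraph ν lam gam) :
    p - q ∈ generatorGraph ν lam gam := by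
  obtain ⟨f, hf, hLf, hfs, rfl⟩ := hp
  obtain ⟨g, hg, hLg, hgs, rfl⟩ := hq
  have hadd := gen_add hf (hg.smul (-1)) hfs (hgs.smul (-1)) lam gam
  rw [gen_smul] at hadd
  refine ⟨f + (-1 : ℝ) • g, hf.add (hg.smul _), ?_, hfs.add (hgs.smul _), ?_⟩
  · rw [hadd]
    exact hLf.add (hLg.smul _)
  · simp only [hadd]
    rw [toHilbert_add hf (hg.smul _), toHilbert_add hLf (hLg.smul _), toHilbert_smul _ hg,
      toHilbert_smul _ hLg]
    simp [sub_eq_add_neg]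

/-- The closure of the generator is dissipative. -/
lemma inner_nonpos_of_mem_closure {lam gam : ℝ} (hlam : 0 ≤ lam) (hgam : 0 ≤ gam)
    {p : HilbertStar ν × HilbertStar ν} (hp : p ∈ closure (generatorGraph ν lam gam)) :
    inner ℝ p.1 p.2 ≤ 0 := by
  have hcl : IsClosed {p : HilbertStar ν × HilbertStar ν | inner ℝ p.1 p.2 ≤ (0 : ℝ)} :=
    isClosed_le (by fun_prop) continuous_const
  refine closure_minimal ?_ hcl hp
  rintro _ ⟨f, hf, hLf, hfs, rfl⟩
  exact (inner_toHilbert hf hLf).trans_le (starProd_gen_nonpos hf hfs hlam hgam hLf)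

/-- The difference w of two solutions satisfies (w, zw) ∈ closed graph, and dissipativity gives
z‖w‖² ≤ 0. -/
lemma SolvesResolvent.unique {lam gam z : ℝ} (hlam : 0 ≤ lam) (hgam : 0 ≤ gam) (hz : 0 < z)
    {v u u' : HilbertStar ν} (hu : SolvesResolvent ν lam gam z v u)
    (hu' : SolvesResolvent ν lam gam z v u') : u = u' := by
  have hsub := map_mem_closure₂ continuous_sub hu hu' fun p hp q hq =>
    sub_mem_generatorGraph hp hq
  have h := inner_nonpos_of_mem_closure hlam hgam hsub
  have e : (z • u - v) - (z • u' - v) = z • (u - u') := by rw [smul_sub]; abel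
  simp only [Prod.mk_sub_mk, e, real_inner_smul_right, real_inner_self_eq_norm_sq] at h
  have h0 : ‖u - u'‖ ^ 2 ≤ 0 := by
    by_contra hlt
    push Not at hlt
    nlinarith
  have h1 : ‖u - u'‖ = 0 := by nlinarith [norm_nonneg (u - u')]
  exact sub_eq_zero.1 (norm_eq_zero.1 h1)

end Antisymmetry

/-! ### Continuous cylinder functions of the disorder, which serve as coefficients. -/

section Coefficients

variable {C : ℝ}

/-- The algebra of continuous cylinder functions of the disorder. -/
def coeff (C : ℝ) : Subalgebra ℝ (Disorder C → ℝ) where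
  carrier := {r | Continuous r ∧ ∃ t : Finset ℤ, ∀ m m', (∀ x ∈ t, m x = m' x) → r m = r m'}
  mul_mem' := by
    classical
    rintro r r' ⟨h, t, ht⟩ ⟨h', t', ht'⟩
    refine ⟨h.mul h', t ∪ t', fun m m' hm => ?_⟩
    simp only [Pi.mul_apply]
    rw [ht m m' fun x hx => hm x (Finset.mem_union_left _ hx),
      ht' m m' fun x hx => hm x (Finset.mem_union_right _ hx)]
  add_mem' := by
    classical
    rintro r r' ⟨h, t, ht⟩ ⟨h', t', ht'⟩
    refine ⟨h.add h', t ∪ t', fun m m' hm => ?_⟩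
    simp only [Pi.add_apply]
    rw [ht m m' fun x hx => hm x (Finset.mem_union_left _ hx),
      ht' m m' fun x hx => hm x (Finset.mem_union_right _ hx)]
  algebraMap_mem' c := ⟨continuous_const, ∅, fun _ _ _ => rfl⟩

lemma coeff_continuous (r : coeff C) : Continuous (r : Disorder C → ℝ) := r.2.1

lemma coeff_measurable (r : coeff C) : Measurable (r : Disorder C → ℝ) := r.2.1.measurable

/-- The disorder space is compact, being a product of compact intervals. -/
lemma coeff_bounded (r : coeff C) : ∃ b : ℝ, 0 ≤ b ∧ ∀ m, |(r : Disorder C → ℝ) m| ≤ b := by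
  obtain ⟨b, hb⟩ := isCompact_univ.exists_bound_of_continuousOn (coeff_continuous r).continuousOn
  exact ⟨max b 0, le_max_right _ _, fun m => (hb m trivial).trans (le_max_left _ _)⟩

/-- Translation of the coefficients. -/
def coeffShift (x : ℤ) : coeff C →ₗ[ℝ] coeff C where
  toFun r := ⟨fun m => (r : Disorder C → ℝ) (shift x m),
    r.2.1.comp (continuous_shift x), by
      obtain ⟨t, ht⟩ := r.2.2
      exact ⟨t.image fun z => x + z, fun m m' h => ht _ _ fun z hz =>
        h _ (Finset.mem_image_of_mem _ hz)⟩⟩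
  map_add' _ _ := rfl
  map_smul' _ _ := rfl

lemma coeffShift_apply (x : ℤ) (r : coeff C) (m : Disorder C) :
    (coeffShift x r : Disorder C → ℝ) m = (r : Disorder C → ℝ) (shift x m) := rfl

lemma coeffShift_coeffShift (x y : ℤ) (r : coeff C) :
    coeffShift x (coeffShift y r) = coeffShift (y + x) r := by
  ext m; simp only [coeffShift_apply, shift_shift]

lemma shift_zero {α : Type*} (η : ℤ → α) : shift 0 η = η := by
  funext z; simp [shift]

lemma coeffShift_zero (r : coeff C) : coeffShift 0 r = r := by
  ext m; simp only [coeffShift_apply, shift_zero]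

lemma coeffShift_mul (x : ℤ) (r r' : coeff C) :
    coeffShift x (r * r') = coeffShift x r * coeffShift x r' := rfl

lemma sqrt_mass_ge (hC : 0 < C) (m : Disorder C) (x : ℤ) :
    C⁻¹ ≤ √((m x : ℝ) * m (x + 1)) := by
  have hCi : 0 < C⁻¹ := inv_pos.2 hC
  have h1 := (m x).2.1
  have h2 := (m (x + 1)).2.1
  exact Real.le_sqrt_of_sq_le (by nlinarith)

/-- The coupling constant `1 / √(m_x m_{x+1})`. -/
noncomputable def coupling (hC : 0 < C) (x : ℤ) : coeff C :=
  ⟨fun m => (√((m x : ℝ) * m (x + 1)))⁻¹, by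
    refine Continuous.inv₀ (by fun_prop) fun m => ?_
    exact ((inv_pos.2 hC).trans_le (sqrt_mass_ge hC m x)).ne',
    {x, x + 1}, fun m m' h => by simp only [h x (by simp), h (x + 1) (by simp)]⟩

lemma coupling_apply (hC : 0 < C) (x : ℤ) (m : Disorder C) :
    (coupling hC x : Disorder C → ℝ) m = (√((m x : ℝ) * m (x + 1)))⁻¹ := rfl

lemma coeffShift_coupling (hC : 0 < C) (x y : ℤ) :
    coeffShift x (coupling hC y) = coupling hC (x + y) := by
  ext m
  simp only [coeffShift_apply, coupling_apply, shift, add_assoc]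

lemma abs_coupling_le (hC : 0 < C) (x : ℤ) (m : Disorder C) :
    |(coupling hC x : Disorder C → ℝ) m| ≤ C := by
  have h := sqrt_mass_ge hC m x
  have hCi : 0 < C⁻¹ := inv_pos.2 hC
  rw [coupling_apply, abs_of_nonneg (by positivity)]
  calc (√((m x : ℝ) * m (x + 1)))⁻¹ ≤ (C⁻¹)⁻¹ := inv_anti₀ hCi h
    _ = C := inv_inv C

end Coefficients

/-! ### Wick products of two coordinates and their covariances. -/

section Wick

/-- The Wick product `:ω_i ω_j:`. -/
def wick (i j : ℤ) (ω : Config) : ℝ := ω i * ω j - if i = j then 1 else 0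

lemma wick_comm (i j : ℤ) : wick i j = wick j i := by
  funext ω
  simp only [wick, mul_comm, eq_comm]

lemma polyGrowth_wick (i j : ℤ) : PolyGrowth (wick i j) := by
  have := ((PolyGrowth.eval i).mul (.eval j)).add (.const (-if i = j then 1 else 0))
  simp only [← sub_eq_add_neg] at this
  exact this

lemma integral_eval_sq (i : ℤ) : ∫ ω : Config, ω i ^ 2 ∂gibbs = 1 := by
  rw [integral_eval i (φ := fun t => t ^ 2) (by fun_prop), integral_sq_gaussianReal]

lemma wick_flip {i j z : ℤ} (hi : z ≠ i) (hj : z ≠ j) (ω : Config) :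
    wick i j (flipSite z ω) = wick i j ω := by
  simp [wick, flipSite_apply, hi.symm, hj.symm]

lemma wick_flip_left {i j : ℤ} (h : i ≠ j) (ω : Config) :
    wick i j (flipSite i ω) = -wick i j ω := by
  simp [wick, flipSite_apply, h, h.symm]

lemma wick_flip_right {i j : ℤ} (h : i ≠ j) (ω : Config) :
    wick i j (flipSite j ω) = -wick i j ω := by
  simp [wick, flipSite_apply, h]

lemma wick_flip_self (i z : ℤ) (ω : Config) : wick i i (flipSite z ω) = wick i i ω := by
  simp only [wick, flipSite_apply]
  split_ifs <;> ring

lemma integral_wick (i j : ℤ) : ∫ ω, wick i j ω ∂gibbs = 0 := by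
  by_cases h : i = j
  · subst h
    have h1 : Integrable (fun ω : Config => ω i * ω i) gibbs :=
      ((PolyGrowth.eval i).mul (.eval i)).integrable
    simp only [wick, if_true]
    rw [integral_sub h1 (by simp)]
    have := integral_eval_sq i
    simp only [sq] at this
    simp [this]
  · exact integral_eq_zero_of_flip i fun ω => wick_flip_left h ω

lemma iIndepFun_eval : iIndepFun (fun (i : ℤ) (ω : Config) => ω i) gibbs :=
  iIndepFun_infinitePi (P := fun _ : ℤ => gaussianReal 0 1) (X := fun _ a => a)
    (fun _ => measurable_id)

lemma integral_mul_eval {i j : ℤ} (h : i ≠ j) {φ ψ : ℝ → ℝ} (hφ : Measurable φ)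
    (hψ : Measurable ψ) : ∫ ω : Config, φ (ω i) * ψ (ω j) ∂gibbs =
      (∫ t, φ t ∂(gaussianReal 0 1)) * ∫ t, ψ t ∂(gaussianReal 0 1) := by
  have h1 := ((iIndepFun_eval.indepFun h).comp hφ hψ).integral_fun_mul_eq_mul_integral
    (hφ.comp (measurable_pi_apply i)).aestronglyMeasurable
    (hψ.comp (measurable_pi_apply j)).aestronglyMeasurable
  simp only [Function.comp_apply] at h1
  rw [h1, integral_eval i hφ, integral_eval j hψ]

lemma integral_wick_mul_wick_of_odd {i j k l : ℤ} (h : i ≠ j) (hk : i ≠ k) (hl : i ≠ l) :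
    ∫ ω, wick i j ω * wick k l ω ∂gibbs = 0 :=
  integral_eq_zero_of_flip i fun ω => by rw [wick_flip_left h, wick_flip hk hl]; ring

lemma integral_wick_off_mul_wick_off {i j : ℤ} (h : i ≠ j) :
    ∫ ω, wick i j ω * wick i j ω ∂gibbs = 1 := by
  have := integral_mul_eval h (φ := fun t => t ^ 2) (ψ := fun t => t ^ 2) (by fun_prop)
    (by fun_prop)
  rw [integral_sq_gaussianReal, one_mul] at this
  rw [← this]
  congr 1; funext ω; simp only [wick, h, if_false]; ring

lemma integral_wick_diag_mul_wick_diag (i j : ℤ) :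
    ∫ ω, wick i i ω * wick j j ω ∂gibbs = if i = j then 2 else 0 := by
  have h1 : ∫ t : ℝ, (t ^ 2 - 1) ∂(gaussianReal 0 1) = 0 := by
    rw [integral_sub (integrable_pow_gaussianReal 2) (by simp), integral_sq_gaussianReal]
    simp
  split_ifs with h
  · subst h
    have h2 : ∫ t : ℝ, (t ^ 4 - (2 * t ^ 2 - 1)) ∂(gaussianReal 0 1) = 2 := by
      have i2 := (integrable_pow_gaussianReal 2).const_mul 2
      have i3 : Integrable (fun t : ℝ => 2 * t ^ 2 - 1) (gaussianReal 0 1) :=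
        i2.sub (integrable_const 1)
      rw [integral_sub (integrable_pow_gaussianReal 4) i3,
        integral_sub i2 (by simp), integral_const_mul, integral_sq_gaussianReal,
        integral_pow_four_gaussianReal]
      simp; norm_num
    rw [← integral_eval i (φ := fun t => t ^ 4 - (2 * t ^ 2 - 1)) (by fun_prop)] at h2
    rw [← h2]
    congr 1; funext ω; simp only [wick, if_true]; ring
  · have := integral_mul_eval h (φ := fun t => t ^ 2 - 1) (ψ := fun t => t ^ 2 - 1)
      (by fun_prop) (by fun_prop)
    rw [h1, zero_mul] at this
    rw [← this]
    congr 1; funext ω; simp only [wick, if_true]; ring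

lemma integral_wick_off_mul_wick_diag {i j : ℤ} (h : i ≠ j) (k : ℤ) :
    ∫ ω, wick i j ω * wick k k ω ∂gibbs = 0 :=
  integral_eq_zero_of_flip i fun ω => by rw [wick_flip_left h, wick_flip_self]; ring

end Wick

/-! ### Action of the generator on the observables r(m) :ω_iω_j:. -/

section QuadTerm

variable {C : ℝ} {ν : Measure (Set.Icc C⁻¹ C)} [IsProbabilityMeasure ν]

/-- The quadratic observable `r(m) :ω_i ω_j:`. -/
def quadTerm (i j : ℤ) : (Disorder C → ℝ) →ₗ[ℝ] Obs C where
  toFun r := fun m ω => r m * wick i j ω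
  map_add' r r' := by funext m ω; simp only [Pi.add_apply]; ring
  map_smul' c r := by
    funext m ω; simp only [Pi.smul_apply, smul_eq_mul, RingHom.id_apply]; ring

lemma quadTerm_apply (i j : ℤ) (r : Disorder C → ℝ) (m : Disorder C) (ω : Config) :
    quadTerm i j r m ω = r m * wick i j ω := rfl

lemma quadTerm_comm (i j : ℤ) (r : Disorder C → ℝ) : quadTerm i j r = quadTerm j i r := by
  funext m ω; rw [quadTerm_apply, quadTerm_apply, wick_comm]

lemma trans_quadTerm (x i j : ℤ) (r : coeff C) :
    trans x (quadTerm i j (r : Disorder C → ℝ)) = quadTerm (x + i) (x + j) (coeffShift x r) := by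
  funext m ω
  simp only [trans, quadTerm_apply, coeffShift_apply, wick, shift, add_right_inj]

lemma isLocal_quadTerm (i j : ℤ) (r : coeff C) : IsLocal ν (quadTerm i j (r : Disorder C → ℝ)) := by
  obtain ⟨b, hb0, hb⟩ := coeff_bounded r
  have hw : MemLp (wick i j) 2 gibbs := by
    obtain ⟨h0, s, c, n, h⟩ := polyGrowth_wick i j
    exact memLp_of_growth h0 h 2 (by simp)
  have hmeas : Measurable (fun p : Disorder C × Config => quadTerm i j r p.1 p.2) :=
    ((coeff_measurable r).comp measurable_fst).mul ((polyGrowth_wick i j).1.comp measurable_snd)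
  refine ⟨?_, hmeas, fun ω => (coeff_continuous r).mul continuous_const,
    fun m => hw.const_mul _, fun m => ?_, ?_⟩
  · obtain ⟨t, ht⟩ := r.2.2
    refine ⟨t ∪ {i, j}, fun m m' ω ω' h1 h2 => ?_⟩
    rw [quadTerm_apply, quadTerm_apply, ht m m' fun x hx => h1 x (Finset.mem_union_left _ hx),
      wick, wick, h2 i (by simp), h2 j (by simp)]
  · simp only [quadTerm_apply]
    rw [integral_const_mul, integral_wick, mul_zero]
  · have hsnd : MemLp (fun p : Disorder C × Config => wick i j p.2) 2 (annealed ν) :=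
      hw.comp_measurePreserving (measurePreserving_snd (μ := disorderLaw ν) (ν := gibbs))
    refine (hsnd.const_mul b).mono hmeas.aestronglyMeasurable
      (Eventually.of_forall fun p => ?_)
    rw [quadTerm_apply, norm_mul, norm_mul b, Real.norm_of_nonneg hb0]
    exact mul_le_mul_of_nonneg_right (hb p.1) (norm_nonneg _)

lemma hasDerivAt_update_apply (ω : Config) (x i : ℤ) (t : ℝ) :
    HasDerivAt (fun t => Function.update ω x t i) (if x = i then 1 else 0) t := by
  by_cases h : x = i
  · subst h; simpa using hasDerivAt_id' t
  · simpa [h, Function.update_of_ne (Ne.symm h)] using hasDerivAt_const t (ω i)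

lemma hasDerivAt_quadTerm (i j x : ℤ) (r : Disorder C → ℝ) (m : Disorder C) (ω : Config)
    (t : ℝ) : HasDerivAt (fun t => quadTerm i j r m (Function.update ω x t))
      (r m * ((if x = i then 1 else 0) * Function.update ω x t j +
        Function.update ω x t i * (if x = j then 1 else 0))) t :=
  (((hasDerivAt_update_apply ω x i t).mul (hasDerivAt_update_apply ω x j t)).sub_const
    _).const_mul (r m)

lemma partialDeriv_quadTerm (i j x : ℤ) (r : Disorder C → ℝ) (m : Disorder C) (ω : Config) :
    partialDeriv x (quadTerm i j r) m ω =
      r m * ((if x = i then 1 else 0) * ω j + ω i * (if x = j then 1 else 0)) := by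
  rw [partialDeriv, (hasDerivAt_quadTerm i j x r m ω (ω x)).deriv, Function.update_eq_self]

lemma isSmooth_quadTerm (i j : ℤ) (r : coeff C) : IsSmooth (quadTerm i j (r : Disorder C → ℝ)) := by
  obtain ⟨b, hb0, hb⟩ := coeff_bounded r
  refine ⟨fun m ω x t => (hasDerivAt_quadTerm i j x r m ω t).differentiableAt, fun m x => ?_,
    {i, j}, 2 * b, 2, fun m ω x => ?_⟩
  · have : partialDeriv x (quadTerm i j r) m = fun ω => (r : Disorder C → ℝ) m *
        ((if x = i then 1 else 0) * ω j + ω i * (if x = j then 1 else 0)) :=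
      funext fun ω => partialDeriv_quadTerm i j x r m ω
    rw [this]
    fun_prop
  · have hi : |ω i| ≤ ∑ y ∈ ({i, j} : Finset ℤ), |ω y| :=
      Finset.single_le_sum (f := fun y => |ω y|) (fun y _ => abs_nonneg _) (by simp)
    have hj : |ω j| ≤ ∑ y ∈ ({i, j} : Finset ℤ), |ω y| :=
      Finset.single_le_sum (f := fun y => |ω y|) (fun y _ => abs_nonneg _) (by simp)
    generalize ∑ y ∈ ({i, j} : Finset ℤ), |ω y| = q at hi hj
    have hq : 0 ≤ q := (abs_nonneg _).trans hi
    constructor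
    · rw [quadTerm_apply, abs_mul]
      have h1 : |wick i j ω| ≤ 2 * (1 + q) ^ 2 := by
        have h2 : |wick i j ω| ≤ |ω i| * |ω j| + 1 := by
          rw [wick, ← abs_mul]
          refine (abs_sub _ _).trans (add_le_add le_rfl ?_)
          split_ifs <;> simp
        nlinarith [mul_le_mul hi hj (abs_nonneg _) hq]
      calc _ ≤ b * (2 * (1 + q) ^ 2) := mul_le_mul (hb m) h1 (abs_nonneg _) hb0
        _ = _ := by ring
    · rw [partialDeriv_quadTerm, abs_mul]
      have h1 : |(if x = i then 1 else 0) * ω j + ω i * (if x = j then 1 else 0)|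
          ≤ 2 * (1 + q) ^ 2 := by
        have h2 : |(if x = i then 1 else 0) * ω j + ω i * (if x = j then 1 else 0)|
            ≤ |ω j| + |ω i| := by
          refine (abs_add_le _ _).trans (add_le_add ?_ ?_)
          · split_ifs <;> simp
          · split_ifs <;> simp
        nlinarith
      calc _ ≤ b * (2 * (1 + q) ^ 2) := mul_le_mul (hb m) h1 (abs_nonneg _) hb0
        _ = _ := by ring

/-- By Leibniz, each factor is replaced in turn by its drift. The Wick constants cause no error:
diagonal terms appear only when i and j are neighbours, and then two of them occur with the same
coefficient and opposite signs. -/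
lemma genA_quadTerm (hC : 0 < C) (i j : ℤ) (r : coeff C) :
    genA (quadTerm i j (r : Disorder C → ℝ)) =
      quadTerm (i + 1) j (r * coupling hC i : coeff C)
      - quadTerm (i - 1) j (r * coupling hC (i - 1) : coeff C)
      + quadTerm i (j + 1) (r * coupling hC j : coeff C)
      - quadTerm i (j - 1) (r * coupling hC (j - 1) : coeff C) := by
  funext m ω
  have h1 : genA (quadTerm i j (r : Disorder C → ℝ)) m ω =
      ∑' x, ((if x = i then drift m i ω * ((r : Disorder C → ℝ) m * ω j) else 0) +
        (if x = j then drift m j ω * ((r : Disorder C → ℝ) m * ω i) else 0)) := by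
    refine tsum_congr fun x => ?_
    rw [partialDeriv_quadTerm]
    change drift m x ω * _ = _
    by_cases hi : x = i <;> by_cases hj : x = j <;> simp [hi, hj] <;> (try subst hi) <;>
      (try subst hj) <;> (simp_all; try ring)
  rw [h1, Summable.tsum_add (summable_of_ne_finset_zero (s := {i}) fun x hx => by simp_all)
    (summable_of_ne_finset_zero (s := {j}) fun x hx => by simp_all), tsum_ite_eq, tsum_ite_eq]
  simp only [Pi.add_apply, Pi.sub_apply, quadTerm_apply, MulMemClass.coe_mul, Pi.mul_apply,
    coupling_apply, drift, wick, sub_add_cancel, div_eq_mul_inv]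
  by_cases ha : j = i + 1
  · subst ha
    simp only [add_sub_cancel_right, if_true, show ¬ (i - 1 = i + 1) by omega,
      show ¬ (i = i + 1 + 1) by omega, if_false]
    ring
  by_cases hb : i = j + 1
  · subst hb
    simp only [add_sub_cancel_right, if_true, show ¬ (j + 1 + 1 = j) by omega,
      show ¬ (j + 1 = j - 1) by omega, if_false]
    ring
  · simp only [show ¬ (i + 1 = j) by omega, show ¬ (i - 1 = j) by omega,
      show ¬ (i = j - 1) by omega, hb, if_false]
    ring

lemma genMove_flipSite_quadTerm_diag (i : ℤ) (r : Disorder C → ℝ) :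
    genMove flipSite (quadTerm i i r) = 0 := by
  funext m ω
  simp [genMove, quadTerm_apply, wick_flip_self]

/-- Only the flips at i and at j act, and each contributes -2. This eigenvalue is the source of the
gap of the off-diagonal part. -/
lemma genMove_flipSite_quadTerm {i j : ℤ} (h : i ≠ j) (r : Disorder C → ℝ) :
    genMove flipSite (quadTerm i j r) = (-4 : ℝ) • quadTerm i j r := by
  funext m ω
  simp only [genMove, quadTerm_apply, Pi.smul_apply, smul_eq_mul]
  rw [tsum_eq_sum (s := {i, j}), Finset.sum_pair h, wick_flip_left h, wick_flip_right h]
  · ring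
  · intro z hz
    simp only [Finset.mem_insert, Finset.mem_singleton, not_or] at hz
    rw [wick_flip hz.1 hz.2, sub_self]

lemma wick_exch (x i j : ℤ) (ω : Config) :
    wick i j (exch x ω) = wick (Equiv.swap x (x + 1) i) (Equiv.swap x (x + 1) j) ω := by
  simp [wick, exch]

/-- Only the bonds touching i or j matter. They are listed as a finite set, so that a bond reached
from both sites counts once. -/
lemma genMove_exch_quadTerm (i j : ℤ) (r : Disorder C → ℝ) :
    genMove exch (quadTerm i j r) = ∑ x ∈ ({i - 1, i, j - 1, j} : Finset ℤ),
      (quadTerm (Equiv.swap x (x + 1) i) (Equiv.swap x (x + 1) j) r - quadTerm i j r) := by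
  funext m ω
  simp only [genMove, quadTerm_apply, Finset.sum_apply, Pi.sub_apply, wick_exch]
  refine tsum_eq_sum fun x hx => ?_
  simp only [Finset.mem_insert, Finset.mem_singleton, not_or] at hx
  rw [swap_succ_apply, swap_succ_apply, if_neg (by omega), if_neg (by omega), if_neg (by omega),
    if_neg (by omega), sub_self]

end QuadTerm

/-! ### The space 𝒬 as a span of elementary observables. -/

section Spaces

variable {C : ℝ}

/-- The span of all the quadratic observables `r(m) :ω_i ω_j:`. -/
def quadP (C : ℝ) : Submodule ℝ (Obs C) :=
  Submodule.span ℝ {f | ∃ (i j : ℤ) (r : coeff C), f = quadTerm i j (r : Disorder C → ℝ)}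

/-- The space `𝒬` as a submodule. -/
def quadV (C : ℝ) : Submodule ℝ (Obs C) :=
  Submodule.span ℝ ({f | ∃ (i j : ℤ) (r : coeff C), i ≠ j ∧
      f = quadTerm i j (r : Disorder C → ℝ)} ∪
    {f | ∃ (i : ℤ) (r : coeff C),
      f = quadTerm (i + 1) (i + 1) (r : Disorder C → ℝ) - quadTerm i i (r : Disorder C → ℝ)})

lemma quadTerm_mem_quadP (i j : ℤ) (r : coeff C) :
    quadTerm i j (r : Disorder C → ℝ) ∈ quadP C := Submodule.subset_span ⟨i, j, r, rfl⟩

lemma quadTerm_mem_quadV {i j : ℤ} (h : i ≠ j) (r : coeff C) :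
    quadTerm i j (r : Disorder C → ℝ) ∈ quadV C :=
  Submodule.subset_span (Or.inl ⟨i, j, r, h, rfl⟩)

lemma quadTerm_succ_sub_mem_quadV (i : ℤ) (r : coeff C) :
    quadTerm (i + 1) (i + 1) (r : Disorder C → ℝ) - quadTerm i i (r : Disorder C → ℝ)
      ∈ quadV C :=
  Submodule.subset_span (Or.inr ⟨i, r, rfl⟩)

/-- Telescoping along the sites between i and j with one fixed coefficient. -/
lemma quadTerm_diag_sub_mem_quadV (i j : ℤ) (r : coeff C) :
    quadTerm i i (r : Disorder C → ℝ) - quadTerm j j (r : Disorder C → ℝ) ∈ quadV C := by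
  suffices h : ∀ i : ℤ,
      quadTerm i i (r : Disorder C → ℝ) - quadTerm 0 0 (r : Disorder C → ℝ) ∈ quadV C by
    have := (quadV C).sub_mem (h i) (h j)
    rwa [sub_sub_sub_cancel_right] at this
  intro i
  induction i using Int.induction_on with
  | zero => simp
  | succ n ih =>
    have := (quadV C).add_mem (quadTerm_succ_sub_mem_quadV n r) ih
    rwa [sub_add_sub_cancel] at this
  | pred n ih =>
    have := (quadV C).sub_mem ih (quadTerm_succ_sub_mem_quadV (-n - 1) r)
    simp only [sub_add_cancel] at this
    rwa [sub_sub_sub_cancel_left] at this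

lemma quadV_le_quadP : quadV C ≤ quadP C := by
  refine Submodule.span_le.2 ?_
  rintro _ (⟨i, j, r, -, rfl⟩ | ⟨i, r, rfl⟩)
  · exact quadTerm_mem_quadP _ _ _
  · exact (quadP C).sub_mem (quadTerm_mem_quadP _ _ _) (quadTerm_mem_quadP _ _ _)

lemma quadratic_subset_quadV {f : Obs C} (hf : f ∈ quadratic C) : f ∈ quadV C := by
  obtain ⟨s, ψ, hcyl, hcont, -, -, h⟩ := hf
  let r : ℤ → ℤ → coeff C := fun i j => ⟨ψ i j, hcont i j, hcyl i j⟩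
  have : f = ∑ i ∈ s, (quadTerm (i + 1) (i + 1) (r i i : Disorder C → ℝ) -
      quadTerm i i (r i i : Disorder C → ℝ)) +
      ∑ i ∈ s, ∑ j ∈ s.erase i, quadTerm i j (r i j : Disorder C → ℝ) := by
    funext m ω
    rw [h]
    simp only [Pi.add_apply, Finset.sum_apply, Pi.sub_apply, quadTerm_apply, r]
    congr 1
    · refine Finset.sum_congr rfl fun i _ => ?_
      simp only [wick, if_true]; ring
    · refine Finset.sum_congr rfl fun i _ => Finset.sum_congr rfl fun j hj => ?_
      simp [wick, (Finset.ne_of_mem_erase hj).symm]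
  rw [this]
  refine (quadV C).add_mem ((quadV C).sum_mem fun i _ => quadTerm_succ_sub_mem_quadV _ _)
    ((quadV C).sum_mem fun i _ => (quadV C).sum_mem fun j hj => ?_)
  exact quadTerm_mem_quadV (Finset.ne_of_mem_erase hj).symm _

lemma quadTerm_mem_quadratic {i j : ℤ} (h : i ≠ j) (r : coeff C) :
    quadTerm i j (r : Disorder C → ℝ) ∈ quadratic C := by
  classical
  -- The weight 1/2 compensates for the double sum visiting both (i, j) and (j, i), as the symmetry
  -- of ψ requires.
  refine ⟨{i, j}, fun a b => if (a = i ∧ b = j) ∨ (a = j ∧ b = i) then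
    (1 / 2 : ℝ) • (r : Disorder C → ℝ) else 0, fun a b => ?_, fun a b => ?_, fun a b => ?_,
    fun a b hab => ?_, fun m ω => ?_⟩
  · obtain ⟨t, ht⟩ := r.2.2
    refine ⟨t, fun m m' hm => ?_⟩
    simp only
    split_ifs
    · simp [ht m m' hm]
    · rfl
  · simp only
    split_ifs
    · exact (coeff_continuous r).const_smul _
    · exact continuous_const
  · simp only
    congr 1
    exact propext ⟨fun h => by tauto, fun h => by tauto⟩
  · refine if_neg ?_
    rintro (⟨rfl, rfl⟩ | ⟨rfl, rfl⟩) <;> exact hab (by simp)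
  · have h' := h.symm
    rw [Finset.sum_pair h, Finset.sum_pair h, show ({i, j} : Finset ℤ).erase i = {j} by
      ext; simp; grind, show ({i, j} : Finset ℤ).erase j = {i} by ext; simp; grind]
    simp only [Finset.sum_singleton, quadTerm_apply, wick, h, h', false_and, and_false, or_self,
      if_false, true_and, and_true, true_or, or_true, if_true, Pi.zero_apply, Pi.smul_apply,
      smul_eq_mul]
    ring

lemma quadTerm_succ_sub_mem_quadratic (i : ℤ) (r : coeff C) :
    quadTerm (i + 1) (i + 1) (r : Disorder C → ℝ) - quadTerm i i (r : Disorder C → ℝ)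
      ∈ quadratic C := by
  classical
  refine ⟨{i}, fun a b => if a = i ∧ b = i then (r : Disorder C → ℝ) else 0,
    fun a b => ?_, fun a b => ?_, fun a b => ?_, fun a b hab => ?_, fun m ω => ?_⟩
  · obtain ⟨t, ht⟩ := r.2.2
    refine ⟨t, fun m m' hm => ?_⟩
    simp only
    split_ifs
    · exact ht m m' hm
    · rfl
  · simp only
    split_ifs
    · exact coeff_continuous r
    · exact continuous_const
  · simp only
    congr 1
    exact propext and_comm
  · refine if_neg ?_
    rintro ⟨rfl, rfl⟩
    exact hab (by simp)
  · simp only [Finset.sum_singleton, Pi.sub_apply, quadTerm_apply, wick, and_self, if_true,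
      Finset.erase_singleton, Finset.sum_empty]
    ring

lemma add_mem_quadratic {f g : Obs C} (hf : f ∈ quadratic C) (hg : g ∈ quadratic C) :
    f + g ∈ quadratic C := by
  classical
  -- Two elements of 𝒬 come with different index sets; enlarging the set adds only zero terms, so
  -- both can be written over the union.
  have ext : ∀ (s u : Finset ℤ) (ψ : ℤ → ℤ → Disorder C → ℝ), s ⊆ u →
      (∀ i j, ¬ (i ∈ s ∧ j ∈ s) → ψ i j = 0) → ∀ (m : Disorder C) (ω : Config),
      ∑ i ∈ s, ψ i i m * (ω (i + 1) ^ 2 - ω i ^ 2) +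
        ∑ i ∈ s, ∑ j ∈ s.erase i, ψ i j m * (ω i * ω j) =
      ∑ i ∈ u, ψ i i m * (ω (i + 1) ^ 2 - ω i ^ 2) +
        ∑ i ∈ u, ∑ j ∈ u.erase i, ψ i j m * (ω i * ω j) := by
    intro s u ψ hsu h0 m ω
    congr 1
    · refine Finset.sum_subset hsu fun i _ hi => ?_
      rw [h0 i i fun h => hi h.1]; simp
    · have h1 : ∀ i ∈ s, ∑ j ∈ s.erase i, ψ i j m * (ω i * ω j) =
          ∑ j ∈ u.erase i, ψ i j m * (ω i * ω j) := fun i _ =>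
        Finset.sum_subset (Finset.erase_subset_erase i hsu) fun j hj hj' => by
          rw [h0 i j fun h => hj' (Finset.mem_erase.2 ⟨Finset.ne_of_mem_erase hj, h.2⟩)]; simp
      rw [Finset.sum_congr rfl h1]
      refine Finset.sum_subset hsu fun i _ hi => Finset.sum_eq_zero fun j _ => ?_
      rw [h0 i j fun h => hi h.1]; simp
  obtain ⟨s, ψ, a1, a2, a3, a4, a5⟩ := hf
  obtain ⟨t, φ, b1, b2, b3, b4, b5⟩ := hg
  refine ⟨s ∪ t, fun i j => ψ i j + φ i j, fun i j => ?_, fun i j => (a2 i j).add (b2 i j),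
    fun i j => congrArg₂ (· + ·) (a3 i j) (b3 i j), fun i j h => ?_, fun m ω => ?_⟩
  · obtain ⟨u, hu⟩ := a1 i j
    obtain ⟨v, hv⟩ := b1 i j
    refine ⟨u ∪ v, fun m m' h => ?_⟩
    simp only [Pi.add_apply]
    rw [hu m m' fun x hx => h x (Finset.mem_union_left _ hx),
      hv m m' fun x hx => h x (Finset.mem_union_right _ hx)]
  · simp only
    rw [a4 i j fun h' => h ⟨Finset.mem_union_left _ h'.1, Finset.mem_union_left _ h'.2⟩,
      b4 i j fun h' => h ⟨Finset.mem_union_right _ h'.1, Finset.mem_union_right _ h'.2⟩,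
      add_zero]
  · simp only [Pi.add_apply]
    rw [a5, b5, ext s (s ∪ t) ψ Finset.subset_union_left a4,
      ext t (s ∪ t) φ Finset.subset_union_right b4]
    simp only [add_mul, Finset.sum_add_distrib]
    ring

lemma smul_mem_quadratic (c : ℝ) {f : Obs C} (hf : f ∈ quadratic C) : c • f ∈ quadratic C := by
  obtain ⟨s, ψ, a1, a2, a3, a4, a5⟩ := hf
  refine ⟨s, fun i j => c • ψ i j, fun i j => ?_, fun i j => (a2 i j).const_smul c,
    fun i j => congrArg (c • ·) (a3 i j), fun i j h => by simp only [a4 i j h, smul_zero], fun m ω => ?_⟩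
  · obtain ⟨u, hu⟩ := a1 i j
    exact ⟨u, fun m m' h => by simp only [Pi.smul_apply, hu m m' h]⟩
  · simp only [Pi.smul_apply, smul_eq_mul, a5, mul_add, Finset.mul_sum, mul_assoc]

lemma mem_quadV_iff {f : Obs C} : f ∈ quadV C ↔ f ∈ quadratic C := by
  refine ⟨fun h => ?_, quadratic_subset_quadV⟩
  induction h using Submodule.span_induction with
  | mem f hf =>
    rcases hf with ⟨i, j, r, h, rfl⟩ | ⟨i, r, rfl⟩
    · exact quadTerm_mem_quadratic h r
    · exact quadTerm_succ_sub_mem_quadratic i r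
  | zero => exact ⟨∅, 0, fun _ _ => ⟨∅, fun _ _ _ => rfl⟩, fun _ _ => continuous_const,
      fun _ _ => rfl, fun _ _ _ => rfl, fun m ω => by simp⟩
  | add f g _ _ hf hg => exact add_mem_quadratic hf hg
  | smul c f _ hf => exact smul_mem_quadratic c hf

end Spaces

/-! ### Invariance of the quadratic spaces under both parts of the generator. -/

section Invariance

variable {C : ℝ} (ν : Measure (Set.Icc C⁻¹ C)) [IsProbabilityMeasure ν] {f g : Obs C}

/-- Smooth functions of the class `𝒞`. -/
def smoothLocal : Submodule ℝ (Obs C) where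
  carrier := {f | IsLocal ν f ∧ IsSmooth f}
  add_mem' hf hg := ⟨hf.1.add hg.1, hf.2.add hg.2⟩
  zero_mem' := ⟨IsLocal.zero, IsSmooth.zero⟩
  smul_mem' c _ hf := ⟨hf.1.smul c, hf.2.smul c⟩

lemma quadP_le_smoothLocal : quadP C ≤ smoothLocal ν := by
  refine Submodule.span_le.2 ?_
  rintro _ ⟨i, j, r, rfl⟩
  exact ⟨isLocal_quadTerm i j r, isSmooth_quadTerm i j r⟩

/-- The Hamiltonian part of the generator on smooth functions. -/
noncomputable def genAL : smoothLocal ν →ₗ[ℝ] Obs C where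
  toFun f := genA f.1
  map_add' f g := genA_add f.2.1 g.2.1 f.2.2 g.2.2
  map_smul' c f := genA_smul c f.1

/-- The symmetric part of the generator on smooth functions. -/
noncomputable def genSL (lam gam : ℝ) : smoothLocal ν →ₗ[ℝ] Obs C where
  toFun f := genS lam gam f.1
  map_add' f g := genS_add f.2.1 g.2.1 lam gam
  map_smul' c f := genS_smul lam gam c f.1

/-- Additivity of 𝒜 is available for smooth local functions, so the operators are linear maps on
that submodule; invariance of a span is then checked on its generators. -/
lemma span_induction_linear {s : Set (Obs C)} {S : Submodule ℝ (Obs C)}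
    (T : smoothLocal ν →ₗ[ℝ] Obs C) (hs : Submodule.span ℝ s ≤ smoothLocal ν)
    (h : ∀ f, ∀ hf : f ∈ s, T ⟨f, hs (Submodule.subset_span hf)⟩ ∈ S)
    {f : Obs C} (hf : f ∈ Submodule.span ℝ s) : T ⟨f, hs hf⟩ ∈ S := by
  induction hf using Submodule.span_induction with
  | mem f hf => exact h f hf
  | zero => exact (map_zero T).symm ▸ S.zero_mem
  | add f g hf hg h1 h2 =>
    have := S.add_mem h1 h2
    rwa [← map_add] at this
  | smul c f hf h1 =>
    have := S.smul_mem c h1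
    rwa [← map_smul] at this

lemma quadV_le_smoothLocal : quadV C ≤ smoothLocal ν :=
  quadV_le_quadP.trans (quadP_le_smoothLocal ν)

variable {ν}

lemma isLocal_of_mem_quadP (hf : f ∈ quadP C) : IsLocal ν f := (quadP_le_smoothLocal ν hf).1

lemma isSmooth_of_mem_quadP (ν : Measure (Set.Icc C⁻¹ C)) [IsProbabilityMeasure ν]
    (hf : f ∈ quadP C) : IsSmooth f := (quadP_le_smoothLocal ν hf).2

lemma genA_mem_quadP (ν : Measure (Set.Icc C⁻¹ C)) [IsProbabilityMeasure ν]
    (hC : 0 < C) (hf : f ∈ quadP C) : genA f ∈ quadP C := by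
  refine span_induction_linear ν (genAL ν) (quadP_le_smoothLocal ν) ?_ hf
  rintro _ ⟨i, j, r, rfl⟩
  change genA _ ∈ _
  rw [genA_quadTerm hC]
  exact (quadP C).sub_mem ((quadP C).add_mem ((quadP C).sub_mem (quadTerm_mem_quadP _ _ _)
    (quadTerm_mem_quadP _ _ _)) (quadTerm_mem_quadP _ _ _)) (quadTerm_mem_quadP _ _ _)

/-- Isolated diagonal terms are not in 𝒬, but the two diagonal terms produced by neighbouring i and
j carry the same coefficient with opposite signs, and such a difference is in 𝒬. -/
lemma genA_mem_quadV (ν : Measure (Set.Icc C⁻¹ C)) [IsProbabilityMeasure ν]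
    (hC : 0 < C) (hf : f ∈ quadV C) : genA f ∈ quadV C := by
  have off : ∀ {i j : ℤ} (r : coeff C), i ≠ j →
      quadTerm i j (r : Disorder C → ℝ) ∈ quadV C := fun r h => quadTerm_mem_quadV h r
  refine span_induction_linear ν (genAL ν) (quadV_le_smoothLocal ν) ?_ hf
  rintro _ (⟨i, j, r, h, rfl⟩ | ⟨i, r, rfl⟩)
  · change genA _ ∈ _
    rw [genA_quadTerm hC]
    by_cases ha : j = i + 1
    · subst ha
      have e : ∀ a b c d : Obs C, a - b + c - d = (a - d) - b + c := fun a b c d => by abel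
      rw [e, add_sub_cancel_right]
      exact (quadV C).add_mem ((quadV C).sub_mem (quadTerm_diag_sub_mem_quadV _ _ _)
        (off _ (by omega))) (off _ (by omega))
    by_cases hb : i = j + 1
    · subst hb
      have e : ∀ a b c d : Obs C, a - b + c - d = (c - b) + a - d := fun a b c d => by abel
      rw [e, add_sub_cancel_right]
      exact (quadV C).sub_mem ((quadV C).add_mem (quadTerm_diag_sub_mem_quadV _ _ _)
        (off _ (by omega))) (off _ (by omega))
    · exact (quadV C).sub_mem ((quadV C).add_mem ((quadV C).sub_mem (off _ (by omega))
        (off _ (by omega))) (off _ (by omega))) (off _ (by omega))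
  · have hmem : ∀ i, quadTerm i i (r : Disorder C → ℝ) ∈ smoothLocal ν := fun i =>
      ⟨isLocal_quadTerm i i r, isSmooth_quadTerm i i r⟩
    have e := map_sub (genAL ν) ⟨_, hmem (i + 1)⟩ ⟨_, hmem i⟩
    have hd : ∀ i, genA (quadTerm i i (r : Disorder C → ℝ)) ∈ quadV C := by
      intro i
      rw [genA_quadTerm hC]
      exact (quadV C).sub_mem ((quadV C).add_mem ((quadV C).sub_mem (off _ (by omega))
        (off _ (by omega))) (off _ (by omega))) (off _ (by omega))
    have := (quadV C).sub_mem (hd (i + 1)) (hd i)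
    exact e ▸ this

lemma genS_mem_quadV (ν : Measure (Set.Icc C⁻¹ C)) [IsProbabilityMeasure ν]
    (lam gam : ℝ) (hf : f ∈ quadV C) : genS lam gam f ∈ quadV C := by
  refine span_induction_linear ν (genSL ν lam gam) (quadV_le_smoothLocal ν) ?_ hf
  rintro _ (⟨i, j, r, h, rfl⟩ | ⟨i, r, rfl⟩)
  · change genS lam gam _ ∈ _
    rw [genS_eq, genMove_flipSite_quadTerm h, genMove_exch_quadTerm]
    refine (quadV C).add_mem ((quadV C).smul_mem _ ((quadV C).smul_mem _
      (quadTerm_mem_quadV h r))) ((quadV C).smul_mem _ ((quadV C).sum_mem fun x _ =>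
      (quadV C).sub_mem (quadTerm_mem_quadV ?_ _) (quadTerm_mem_quadV h r)))
    exact fun h' => h ((Equiv.injective _) h')
  · have hmem : ∀ i, quadTerm i i (r : Disorder C → ℝ) ∈ smoothLocal ν := fun i =>
      ⟨isLocal_quadTerm i i r, isSmooth_quadTerm i i r⟩
    have e := map_sub (genSL ν lam gam) ⟨_, hmem (i + 1)⟩ ⟨_, hmem i⟩
    have hd : ∀ i, genS lam gam (quadTerm i i (r : Disorder C → ℝ)) ∈ quadV C := by
      intro i
      rw [genS_eq, genMove_flipSite_quadTerm_diag, genMove_exch_quadTerm, smul_zero, zero_add]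
      exact (quadV C).smul_mem _ ((quadV C).sum_mem fun x _ => quadTerm_diag_sub_mem_quadV _ _ _)
    have := (quadV C).sub_mem (hd (i + 1)) (hd i)
    exact e ▸ this

end Invariance

/-! ### Orthogonal coordinates for the classes of quadratic functions in L²_⋆. -/

section Classes

variable {C : ℝ} (ν : Measure (Set.Icc C⁻¹ C)) [IsProbabilityMeasure ν] {f g : Obs C}

open Classical in
/-- The class in `L²_⋆` of a function of `𝒞`, extended by zero. -/
noncomputable def cls (f : Obs C) : HilbertStar ν :=
  if h : IsLocal ν f then toHilbert f h else 0

variable {ν}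

lemma cls_of_isLocal (hf : IsLocal ν f) : cls ν f = toHilbert f hf := dif_pos hf

lemma inner_cls (hf : IsLocal ν f) (hg : IsLocal ν g) :
    inner ℝ (cls ν f) (cls ν g) = starProd ν f g := by
  rw [cls_of_isLocal hf, cls_of_isLocal hg, inner_toHilbert]

lemma cls_add (hf : IsLocal ν f) (hg : IsLocal ν g) : cls ν (f + g) = cls ν f + cls ν g := by
  rw [cls_of_isLocal hf, cls_of_isLocal hg, cls_of_isLocal (hf.add hg), toHilbert_add hf hg]

lemma cls_smul (c : ℝ) (hf : IsLocal ν f) : cls ν (c • f) = c • cls ν f := by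
  rw [cls_of_isLocal hf, cls_of_isLocal (hf.smul c), toHilbert_smul c hf]

variable (ν) in
/-- The class map on `𝒞`. -/
noncomputable def clsL : localSubmodule ν →ₗ[ℝ] HilbertStar ν where
  toFun f := cls ν f.1
  map_add' f g := cls_add f.2 g.2
  map_smul' c f := cls_smul c f.2

lemma cls_sub (hf : IsLocal ν f) (hg : IsLocal ν g) : cls ν (f - g) = cls ν f - cls ν g :=
  map_sub (clsL ν) ⟨f, hf⟩ ⟨g, hg⟩

lemma cls_sum {ι : Type*} {s : Finset ι} {f : ι → Obs C} (hf : ∀ i, IsLocal ν (f i)) :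
    cls ν (∑ i ∈ s, f i) = ∑ i ∈ s, cls ν (f i) := by
  have h := map_sum (clsL ν) (fun i => (⟨f i, hf i⟩ : localSubmodule ν)) s
  simp only [clsL, LinearMap.coe_mk, AddHom.coe_mk] at h
  rw [← h]
  congr 1
  simp

lemma eq_of_inner_cls {u v : HilbertStar ν}
    (h : ∀ g, IsLocal ν g → inner ℝ u (cls ν g) = inner ℝ v (cls ν g)) : u = v := by
  refine (UniformSpace.Completion.denseRange_coe (α := Local ν)).eq_of_inner_left ℝ
    fun g => ?_
  have := h g.1 g.2
  rwa [cls_of_isLocal g.2] at this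

lemma starProd_trans_left (hf : IsLocal ν f) (hg : IsLocal ν g) (x : ℤ) :
    starProd ν (trans x f) g = starProd ν f g := by
  unfold starProd
  rw [← (Equiv.subRight x).tsum_eq fun y => expect ν (f * trans y g)]
  exact tsum_congr fun y => hf.expect_trans_mul_trans hg x y

/-- The form ≪·,·≫_⋆ sums over all translations, so translating one argument only reindexes the sum.
-/
lemma cls_trans (hf : IsLocal ν f) (x : ℤ) : cls ν (trans x f) = cls ν f :=
  eq_of_inner_cls fun g hg => by
    rw [inner_cls (hf.trans x) hg, inner_cls hf hg, starProd_trans_left hf hg]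

variable (ν)

/-- The class of `r(m) :ω_i ω_j:`. -/
noncomputable def kap (i j : ℤ) : coeff C →ₗ[ℝ] HilbertStar ν where
  toFun r := cls ν (quadTerm i j (r : Disorder C → ℝ))
  map_add' r r' := by
    rw [← cls_add (isLocal_quadTerm i j r) (isLocal_quadTerm i j r'), ← map_add]; rfl
  map_smul' c r := by
    rw [RingHom.id_apply, ← cls_smul c (isLocal_quadTerm i j r), ← map_smul]; rfl

lemma cls_quadTerm (i j : ℤ) (r : coeff C) :
    cls ν (quadTerm i j (r : Disorder C → ℝ)) = kap ν i j r := rfl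

lemma kap_comm (i j : ℤ) (r : coeff C) : kap ν i j r = kap ν j i r := by
  rw [← cls_quadTerm, quadTerm_comm, cls_quadTerm]

lemma kap_shift (x i j : ℤ) (r : coeff C) :
    kap ν (x + i) (x + j) (coeffShift x r) = kap ν i j r := by
  rw [← cls_quadTerm, ← trans_quadTerm, cls_trans (isLocal_quadTerm i j r), cls_quadTerm]

/-- The `L²` inner product of two coefficients. -/
noncomputable def cinner (r r' : coeff C) : ℝ :=
  ∫ m, (r : Disorder C → ℝ) m * (r' : Disorder C → ℝ) m ∂(disorderLaw ν)

lemma integrable_coeff (r : coeff C) : Integrable (r : Disorder C → ℝ) (disorderLaw ν) := by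
  obtain ⟨b, -, hb⟩ := coeff_bounded r
  exact Integrable.of_bound (coeff_measurable r).aestronglyMeasurable b (Eventually.of_forall hb)

lemma cinner_self_nonneg (r : coeff C) : 0 ≤ cinner ν r r :=
  integral_nonneg fun _ => mul_self_nonneg _

lemma cinner_shift (x : ℤ) (r r' : coeff C) :
    cinner ν (coeffShift x r) (coeffShift x r') = cinner ν r r' := by
  have h : MeasurePreserving (shift x : Disorder C → Disorder C) (disorderLaw ν)
    (disorderLaw ν) := measurePreserving_shift ν x
  unfold cinner
  conv_rhs => rw [← h.map_eq]
  exact (integral_map h.measurable.aemeasurable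
    ((coeff_measurable r).mul (coeff_measurable r')).aestronglyMeasurable).symm

lemma cinner_mul_coupling_le (hC : 0 < C) (x : ℤ) (r : coeff C) :
    cinner ν (r * coupling hC x) (r * coupling hC x) ≤ C ^ 2 * cinner ν r r := by
  unfold cinner
  rw [← integral_const_mul]
  refine integral_mono
    (integrable_coeff ν ((r * coupling hC x) * (r * coupling hC x)))
    ((integrable_coeff ν (r * r)).const_mul _) fun m => ?_
  have h := sq_le_sq' (abs_le.1 (abs_coupling_le hC x m)).1 (abs_le.1 (abs_coupling_le hC x m)).2
  simp only [MulMemClass.coe_mul, Pi.mul_apply]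
  nlinarith [mul_self_nonneg ((r : Disorder C → ℝ) m)]

lemma expect_quadTerm_mul_quadTerm (i j k l : ℤ) (r r' : coeff C) :
    expect ν (quadTerm i j (r : Disorder C → ℝ) * quadTerm k l (r' : Disorder C → ℝ)) =
      cinner ν r r' * ∫ ω, wick i j ω * wick k l ω ∂gibbs := by
  unfold expect cinner annealed
  rw [← integral_prod_mul]
  congr 1
  funext p
  simp only [Pi.mul_apply, quadTerm_apply]
  ring

/-- The pairs {0, k} and {x, x + l} with k, l ≥ 0 coincide only for x = 0 and k = l. All other
covariances vanish, and the diagonal one carries the variance 2 of ω₀². -/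
lemma starProd_quadTerm (k l : ℕ) (r r' : coeff C) :
    starProd ν (quadTerm 0 k (r : Disorder C → ℝ)) (quadTerm 0 l (r' : Disorder C → ℝ)) =
      if k = l then (if k = 0 then 2 else 1) * cinner ν r r' else 0 := by
  have hterm : ∀ x : ℤ, expect ν (quadTerm 0 k (r : Disorder C → ℝ) *
      trans x (quadTerm 0 l (r' : Disorder C → ℝ))) =
      cinner ν r (coeffShift x r') * ∫ ω, wick 0 k ω * wick x (x + l) ω ∂gibbs := fun x => by
    rw [trans_quadTerm, expect_quadTerm_mul_quadTerm, add_zero]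
  have hW : ∀ x : ℤ, ¬ (x = 0 ∧ k = l) → ∫ ω, wick 0 k ω * wick x (x + l) ω ∂gibbs = 0 := by
    intro x hx
    by_cases hk : k = 0
    · subst hk
      by_cases hl : l = 0
      · subst hl
        simp only [Nat.cast_zero, add_zero]
        rw [integral_wick_diag_mul_wick_diag, if_neg]
        rintro rfl
        exact hx ⟨rfl, rfl⟩
      · simp_rw [mul_comm (wick 0 _ _)]
        exact integral_wick_off_mul_wick_diag (by omega) 0
    · by_cases hl : l = 0
      · subst hl
        simp only [Nat.cast_zero, add_zero]
        exact integral_wick_off_mul_wick_diag (by omega) x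
      -- A coordinate occurring in only one factor makes the integrand odd: it is the coordinate k
      -- if the second pair contains 0, and the coordinate 0 otherwise.
      · by_cases h1 : x = 0 ∨ x + l = 0
        · rw [wick_comm 0 k]
          exact integral_wick_mul_wick_of_odd (by omega) (by omega) (by omega)
        · exact integral_wick_mul_wick_of_odd (by omega) (by omega) (by omega)
  unfold starProd
  rw [tsum_eq_single 0 fun x hx => by rw [hterm, hW x fun h => hx h.1, mul_zero], hterm,
    coeffShift_zero]
  split_ifs with h1 h2
  · subst h1; subst h2
    simp only [Nat.cast_zero, add_zero]
    rw [integral_wick_diag_mul_wick_diag, if_pos rfl, mul_comm]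
  · subst h1
    rw [zero_add, integral_wick_off_mul_wick_off (by omega), mul_comm]
  · rw [hW 0 fun h => h1 h.2, mul_zero]

lemma inner_kap (k l : ℕ) (r r' : coeff C) : inner ℝ (kap ν 0 k r) (kap ν 0 l r') =
    if k = l then (if k = 0 then 2 else 1) * cinner ν r r' else 0 := by
  rw [← cls_quadTerm, ← cls_quadTerm, inner_cls (isLocal_quadTerm _ _ r) (isLocal_quadTerm _ _ r'),
    starProd_quadTerm]

lemma norm_sq_sum_kap {F : Finset ℕ} {φ : ℕ → ℕ} (hφ : Set.InjOn φ F) (r : ℕ → coeff C) :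
    ‖∑ k ∈ F, kap ν 0 (φ k) (r k)‖ ^ 2 =
      ∑ k ∈ F, (if φ k = 0 then 2 else 1) * cinner ν (r k) (r k) := by
  rw [← real_inner_self_eq_norm_sq, sum_inner]
  refine Finset.sum_congr rfl fun k hk => ?_
  rw [inner_sum, Finset.sum_eq_single k]
  · rw [inner_kap, if_pos rfl]
  · intro l hl hlk
    rw [inner_kap, if_neg fun h => hlk (hφ hl hk h.symm)]
  · exact fun h => absurd hk h

/-- Each part of the generator moves the index k injectively and multiplies coefficients by bounded
amounts. The factor 2 leaves room for a move landing on the index 0, where the squared norm has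
weight 2 instead of 1. -/
lemma norm_sum_kap_le {F : Finset ℕ} (hF : 0 ∉ F) {φ : ℕ → ℕ} (hφ : Set.InjOn φ F)
    {r c : ℕ → coeff C} {M : ℝ} (hM : 0 ≤ M)
    (h : ∀ k ∈ F, cinner ν (r k) (r k) ≤ M ^ 2 * cinner ν (c k) (c k)) :
    ‖∑ k ∈ F, kap ν 0 (φ k) (r k)‖ ≤ 2 * M * ‖∑ k ∈ F, kap ν 0 k (c k)‖ := by
  refine le_of_sq_le_sq ?_ (by positivity)
  have h1 := norm_sq_sum_kap ν (F := F) (φ := fun k => k) (fun _ _ _ _ h => h) c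
  rw [norm_sq_sum_kap ν hφ, mul_pow, h1, Finset.mul_sum]
  refine Finset.sum_le_sum fun k hk => ?_
  have hk0 : k ≠ 0 := by rintro rfl; exact hF hk
  have h2 := h k hk
  have h3 := cinner_self_nonneg ν (r k)
  have h4 := cinner_self_nonneg ν (c k)
  rw [if_neg hk0]
  split_ifs <;> nlinarith [sq_nonneg M]

/-- Coefficients embed isometrically in L²_⋆ through :ω₀ω₁:, so bilinearity and norm inequalities
for `cinner` come from the Hilbert space. -/
lemma cinner_eq_inner (r r' : coeff C) : cinner ν r r' =
    inner ℝ (kap ν 0 (1 : ℕ) r) (kap ν 0 (1 : ℕ) r') := by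
  rw [inner_kap]; simp

/-- Up to exchanging i and j, a translation brings the left index to 0. -/
lemma exists_coordinates (hf : f ∈ quadP C) : ∃ (r : coeff C) (F : Finset ℕ) (c : ℕ → coeff C),
    0 ∉ F ∧ cls ν f = kap ν 0 0 r + ∑ k ∈ F, kap ν 0 k (c k) := by
  classical
  let T : (ℕ →₀ coeff C) →ₗ[ℝ] HilbertStar ν := Finsupp.lsum ℝ fun k : ℕ => kap ν 0 k
  have hT : ∀ (k : ℕ) (r : coeff C), kap ν 0 k r ∈ LinearMap.range T := fun k r =>
    ⟨Finsupp.single k r, by simp [T]⟩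
  have hgen : ∀ (i j : ℤ) (r : coeff C), i ≤ j → kap ν i j r ∈ LinearMap.range T := by
    intro i j r h
    obtain ⟨k, hk⟩ := Int.eq_ofNat_of_zero_le (sub_nonneg.2 h)
    have := kap_shift ν (-i) i j r
    rw [neg_add_cancel, neg_add_eq_sub, hk] at this
    rw [← this]
    exact hT k _
  have hmem : cls ν f ∈ LinearMap.range T := by
    induction hf using Submodule.span_induction with
    | mem f hf =>
      obtain ⟨i, j, r, rfl⟩ := hf
      rw [cls_quadTerm]
      rcases le_total i j with h | h
      · exact hgen i j r h
      · rw [kap_comm]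
        exact hgen j i r h
    | zero =>
      have : cls ν (0 : Obs C) = 0 := map_zero (clsL ν)
      rw [this]; exact Submodule.zero_mem _
    | add f g hf hg h1 h2 =>
      rw [cls_add (isLocal_of_mem_quadP hf) (isLocal_of_mem_quadP hg)]
      exact Submodule.add_mem _ h1 h2
    | smul c f hf h1 =>
      rw [cls_smul c (isLocal_of_mem_quadP hf)]
      exact Submodule.smul_mem _ c h1
  obtain ⟨c, hc⟩ := hmem
  refine ⟨c 0, c.support.erase 0, c, Finset.notMem_erase _ _, ?_⟩
  rw [← hc]
  simp only [T, Finsupp.lsum_apply, Finsupp.sum]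
  by_cases h0 : 0 ∈ c.support
  · rw [← Finset.add_sum_erase _ _ h0, Nat.cast_zero]
  · rw [Finset.erase_eq_of_notMem h0, Finsupp.notMem_support_iff.1 h0, map_zero, zero_add]

end Classes

/-! ### Operator bounds for 𝒜 and 𝒮 on the off-diagonal and on the diagonal part. -/

section Bounds

variable {C : ℝ} (ν : Measure (Set.Icc C⁻¹ C)) [IsProbabilityMeasure ν] {f g : Obs C}

/-- The energy `≪f, -𝒮f≫_⋆`. -/
noncomputable def energy (lam gam : ℝ) (f : Obs C) : ℝ := -starProd ν f (genS lam gam f)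

/-- The off-diagonal observable `∑_{k ∈ F} c_k(m) :ω₀ ω_k:`. -/
noncomputable def offObs (F : Finset ℕ) (c : ℕ → coeff C) : Obs C :=
  ∑ k ∈ F, quadTerm 0 (k : ℤ) (c k : Disorder C → ℝ)

lemma offObs_mem (F : Finset ℕ) (c : ℕ → coeff C) : offObs F c ∈ quadP C :=
  (quadP C).sum_mem fun _ _ => quadTerm_mem_quadP _ _ _

lemma cls_offObs (F : Finset ℕ) (c : ℕ → coeff C) :
    cls ν (offObs F c) = ∑ k ∈ F, kap ν 0 k (c k) :=
  cls_sum fun k => isLocal_quadTerm 0 k (c k)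

lemma genA_offObs (ν : Measure (Set.Icc C⁻¹ C)) [IsProbabilityMeasure ν]
    (F : Finset ℕ) (c : ℕ → coeff C) :
    genA (offObs F c) = ∑ k ∈ F, genA (quadTerm 0 (k : ℤ) (c k : Disorder C → ℝ)) := by
  have h := map_sum (genAL ν) (fun k : ℕ => (⟨quadTerm 0 (k : ℤ) (c k : Disorder C → ℝ),
    isLocal_quadTerm _ _ _, isSmooth_quadTerm _ _ _⟩ : smoothLocal ν)) F
  simp only [genAL, LinearMap.coe_mk, AddHom.coe_mk] at h
  rw [← h]
  congr 1
  simp [offObs]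

lemma genS_offObs (ν : Measure (Set.Icc C⁻¹ C)) [IsProbabilityMeasure ν]
    (lam gam : ℝ) (F : Finset ℕ) (c : ℕ → coeff C) :
    genS lam gam (offObs F c) =
      ∑ k ∈ F, genS lam gam (quadTerm 0 (k : ℤ) (c k : Disorder C → ℝ)) := by
  have h := map_sum (genSL ν lam gam) (fun k : ℕ => (⟨quadTerm 0 (k : ℤ) (c k : Disorder C → ℝ),
    isLocal_quadTerm _ _ _, isSmooth_quadTerm _ _ _⟩ : smoothLocal ν)) F
  simp only [genSL, LinearMap.coe_mk, AddHom.coe_mk] at h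
  rw [← h]
  congr 1
  simp [offObs]

lemma genS_zero_one (f : Obs C) : genS 0 1 f = genMove flipSite f := by
  rw [genS_eq, one_smul, zero_smul, add_zero]

lemma genS_one_zero (f : Obs C) : genS 1 0 f = genMove exch f := by
  rw [genS_eq, one_smul, zero_smul, zero_add]

lemma genMove_flipSite_offObs (ν : Measure (Set.Icc C⁻¹ C)) [IsProbabilityMeasure ν]
    {F : Finset ℕ} (hF : 0 ∉ F) (c : ℕ → coeff C) :
    genMove flipSite (offObs F c) = (-4 : ℝ) • offObs F c := by
  rw [← genS_zero_one, genS_offObs ν, offObs, Finset.smul_sum]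
  refine Finset.sum_congr rfl fun k hk => ?_
  have : (0 : ℤ) ≠ k := by
    intro h
    have : k = 0 := by omega
    exact hF (this ▸ hk)
  rw [genS_zero_one, genMove_flipSite_quadTerm this]

lemma kap_neg_one_left (k : ℕ) (r : coeff C) :
    kap ν (-1) k r = kap ν 0 (k + 1 : ℕ) (coeffShift 1 r) := by
  rw [← kap_shift ν 1 (-1) k r]
  congr 2
  push_cast; ring

lemma kap_one_left {k : ℕ} (hk : k ≠ 0) (r : coeff C) :
    kap ν 1 k r = kap ν 0 (k - 1 : ℕ) (coeffShift (-1) r) := by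
  rw [← kap_shift ν (-1) 1 k r]
  congr 2
  omega

/-- The terms whose left end is no longer at 0 are translated back, at the price of a shift of the
coefficient. -/
lemma cls_genA_quadTerm (hC : 0 < C) {k : ℕ} (hk : k ≠ 0) (r : coeff C) :
    cls ν (genA (quadTerm 0 (k : ℤ) (r : Disorder C → ℝ))) =
      kap ν 0 (k - 1 : ℕ) (coeffShift (-1) (r * coupling hC 0))
      - kap ν 0 (k + 1 : ℕ) (coeffShift 1 (r * coupling hC (-1)))
      + kap ν 0 (k + 1 : ℕ) (r * coupling hC k)
      - kap ν 0 (k - 1 : ℕ) (r * coupling hC (k - 1)) := by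
  have hl : ∀ i j (r : coeff C), IsLocal ν (quadTerm i j (r : Disorder C → ℝ)) := isLocal_quadTerm
  rw [genA_quadTerm hC, cls_sub (((hl _ _ _).sub (hl _ _ _)).add (hl _ _ _)) (hl _ _ _),
    cls_add ((hl _ _ _).sub (hl _ _ _)) (hl _ _ _), cls_sub (hl _ _ _) (hl _ _ _),
    cls_quadTerm, cls_quadTerm, cls_quadTerm, cls_quadTerm, zero_add, zero_sub,
    kap_one_left ν hk, kap_neg_one_left]
  congr 3
  omega

/-- For k = 1 the two inward moves use the same bond {0, 1}, whose exchange leaves ω₀ω₁ fixed; they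
therefore occur only for k ≥ 2. -/
lemma genMove_exch_quadTerm_off {k : ℕ} (hk : k ≠ 0) (r : Disorder C → ℝ) :
    genMove exch (quadTerm 0 (k : ℤ) r) =
      (quadTerm (-1) k r - quadTerm 0 k r) + (quadTerm 0 ((k + 1 : ℕ) : ℤ) r - quadTerm 0 k r) +
      if 2 ≤ k then (quadTerm 1 k r - quadTerm 0 k r) +
        (quadTerm 0 ((k - 1 : ℕ) : ℤ) r - quadTerm 0 k r) else 0 := by
  rw [genMove_exch_quadTerm]
  split_ifs with h
  · rw [Finset.sum_insert (by simp; omega), Finset.sum_insert (by simp; omega),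
      Finset.sum_pair (by omega)]
    have e1 : Equiv.swap ((0 : ℤ) - 1) (0 - 1 + 1) 0 = -1 := by rw [swap_succ_apply]; simp
    have e2 : Equiv.swap ((0 : ℤ) - 1) (0 - 1 + 1) k = k := by
      rw [swap_succ_apply, if_neg (by omega), if_neg (by omega)]
    have e3 : Equiv.swap (0 : ℤ) (0 + 1) 0 = 1 := by rw [swap_succ_apply]; simp
    have e4 : Equiv.swap (0 : ℤ) (0 + 1) k = k := by
      rw [swap_succ_apply, if_neg (by omega), if_neg (by omega)]
    have e5 : Equiv.swap ((k : ℤ) - 1) (k - 1 + 1) 0 = 0 := by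
      rw [swap_succ_apply, if_neg (by omega), if_neg (by omega)]
    have e6 : Equiv.swap ((k : ℤ) - 1) (k - 1 + 1) k = ((k - 1 : ℕ) : ℤ) := by
      rw [swap_succ_apply, if_neg (by omega), if_pos (by omega)]; omega
    have e7 : Equiv.swap (k : ℤ) (k + 1) 0 = 0 := by
      rw [swap_succ_apply, if_neg (by omega), if_neg (by omega)]
    have e8 : Equiv.swap (k : ℤ) (k + 1) k = ((k + 1 : ℕ) : ℤ) := by
      rw [swap_succ_apply, if_pos rfl]; push_cast; rfl
    rw [e1, e2, e3, e4, e5, e6, e7, e8]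
    abel
  · obtain rfl : k = 1 := by omega
    have hset : ({(0 : ℤ) - 1, 0, ((1 : ℕ) : ℤ) - 1, ((1 : ℕ) : ℤ)} : Finset ℤ) = {-1, 0, 1} := by
      ext; simp
    rw [hset, Finset.sum_insert (by simp), Finset.sum_pair (by norm_num)]
    simp only [swap_succ_apply]
    norm_num
    rw [quadTerm_comm 1 0, sub_self]

/-- Putting the condition k ≥ 2 inside the coefficients keeps the formula uniform in k, so that a
sum over k splits into families with injective indices. -/
lemma cls_genMove_exch_quadTerm {k : ℕ} (hk : k ≠ 0) (r : coeff C) :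
    cls ν (genMove exch (quadTerm 0 (k : ℤ) (r : Disorder C → ℝ))) =
      kap ν 0 (k + 1 : ℕ) (coeffShift 1 r + r) - (2 : ℝ) • kap ν 0 k r +
      (kap ν 0 (k - 1 : ℕ) (if 2 ≤ k then coeffShift (-1) r + r else 0) -
        (2 : ℝ) • kap ν 0 k (if 2 ≤ k then r else 0)) := by
  have hl : ∀ i j, IsLocal ν (quadTerm i j (r : Disorder C → ℝ)) := fun i j =>
    isLocal_quadTerm i j r
  rw [genMove_exch_quadTerm_off hk]
  have h1 : ∀ i j k l, IsLocal ν ((quadTerm i j (r : Disorder C → ℝ) -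
      quadTerm 0 k (r : Disorder C → ℝ)) + (quadTerm 0 l (r : Disorder C → ℝ) -
      quadTerm 0 k (r : Disorder C → ℝ))) := fun i j k l =>
    ((hl _ _).sub (hl _ _)).add ((hl _ _).sub (hl _ _))
  have h2 : ∀ i j k l, cls ν ((quadTerm i j (r : Disorder C → ℝ) -
      quadTerm 0 k (r : Disorder C → ℝ)) + (quadTerm 0 l (r : Disorder C → ℝ) -
      quadTerm 0 k (r : Disorder C → ℝ))) = kap ν i j r + kap ν 0 l r - (2 : ℝ) • kap ν 0 k r := by
    intro i j k l
    rw [cls_add ((hl _ _).sub (hl _ _)) ((hl _ _).sub (hl _ _)), cls_sub (hl _ _) (hl _ _),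
      cls_sub (hl _ _) (hl _ _), cls_quadTerm, cls_quadTerm, cls_quadTerm, two_smul]
    abel
  split_ifs with h
  · rw [cls_add (h1 _ _ _ _) (h1 _ _ _ _), h2, h2, kap_one_left ν hk, kap_neg_one_left, map_add,
      map_add]
  · rw [add_zero, h2, kap_neg_one_left, map_add]
    simp

lemma cinner_add_self_le (r r' : coeff C) :
    cinner ν (r + r') (r + r') ≤ 2 * cinner ν r r + 2 * cinner ν r' r' := by
  simp only [cinner_eq_inner, map_add, real_inner_self_eq_norm_sq]
  have h := parallelogram_law_with_norm ℝ (kap ν 0 (1 : ℕ) r) (kap ν 0 (1 : ℕ) r')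
  nlinarith [mul_self_nonneg ‖kap ν 0 (1 : ℕ) r - kap ν 0 (1 : ℕ) r'‖]

lemma injOn_pred {F : Finset ℕ} (hF : 0 ∉ F) : Set.InjOn (fun k : ℕ => k - 1) F := by
  intro a ha b hb h
  have ha0 : a ≠ 0 := by rintro rfl; exact hF ha
  have hb0 : b ≠ 0 := by rintro rfl; exact hF hb
  simp only at h
  omega

lemma injOn_succ (F : Finset ℕ) : Set.InjOn (fun k : ℕ => k + 1) F :=
  fun _ _ _ _ h => by simpa using h

/-- Four families of shifted coefficients, each bounded by 2C, since the couplings are at most C. -/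
lemma norm_cls_genA_offObs_le (hC : 0 < C) {F : Finset ℕ} (hF : 0 ∉ F) (c : ℕ → coeff C) :
    ‖cls ν (genA (offObs F c))‖ ≤ 8 * C * ‖cls ν (offObs F c)‖ := by
  have hA : ∀ k : ℕ, IsLocal ν (genA (quadTerm 0 (k : ℤ) (c k : Disorder C → ℝ))) := fun k =>
    isLocal_of_mem_quadP (genA_mem_quadP ν hC (quadTerm_mem_quadP _ _ _))
  rw [genA_offObs ν, cls_sum hA, cls_offObs, Finset.sum_congr rfl fun k hk =>
    cls_genA_quadTerm ν hC (by rintro rfl; exact hF hk) (c k)]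
  simp only [Finset.sum_sub_distrib, Finset.sum_add_distrib]
  have hb : ∀ k y, cinner ν (c k * coupling hC y) (c k * coupling hC y) ≤
      C ^ 2 * cinner ν (c k) (c k) := fun k y => cinner_mul_coupling_le ν hC y (c k)
  have b1 := norm_sum_kap_le ν hF (injOn_pred hF)
    (r := fun k => coeffShift (-1) (c k * coupling hC 0)) (c := c) hC.le
    (fun k _ => by rw [cinner_shift]; exact hb _ _)
  have b2 := norm_sum_kap_le ν hF (injOn_succ F)
    (r := fun k => coeffShift 1 (c k * coupling hC (-1))) (c := c) hC.le
    (fun k _ => by rw [cinner_shift]; exact hb _ _)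
  have b3 := norm_sum_kap_le ν hF (injOn_succ F)
    (r := fun k => c k * coupling hC k) (c := c) hC.le (fun k _ => hb _ _)
  have b4 := norm_sum_kap_le ν hF (injOn_pred hF)
    (r := fun k => c k * coupling hC (k - 1)) (c := c) hC.le (fun k _ => hb _ _)
  refine (norm_sub_le _ _).trans ?_
  refine (add_le_add ((norm_add_le _ _).trans (add_le_add (norm_sub_le _ _) le_rfl))
    le_rfl).trans ?_
  linarith

/-- The constant is 4 + 2 + 4 + 2·2: the two outer families have coefficients bounded with M = 2,
and the terms that keep the index k are counted twice. -/
lemma norm_cls_genMove_exch_offObs_le {F : Finset ℕ} (hF : 0 ∉ F) (c : ℕ → coeff C) :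
    ‖cls ν (genMove exch (offObs F c))‖ ≤ 14 * ‖cls ν (offObs F c)‖ := by
  have hS : ∀ k : ℕ, IsLocal ν (genMove exch (quadTerm 0 (k : ℤ) (c k : Disorder C → ℝ))) :=
    fun k => (isLocal_quadTerm _ _ _).genMove isMove_exch
  rw [← genS_one_zero, genS_offObs ν]
  simp only [genS_one_zero]
  rw [cls_sum hS, cls_offObs, Finset.sum_congr rfl fun k hk =>
    cls_genMove_exch_quadTerm ν (by rintro rfl; exact hF hk) (c k)]
  simp only [Finset.sum_sub_distrib, Finset.sum_add_distrib, ← Finset.smul_sum]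
  have h2 : ∀ x k, cinner ν (coeffShift x (c k) + c k) (coeffShift x (c k) + c k) ≤
      2 ^ 2 * cinner ν (c k) (c k) := fun x k => by
    have := cinner_add_self_le ν (coeffShift x (c k)) (c k)
    rw [cinner_shift] at this
    linarith
  have h0 : cinner ν (0 : coeff C) 0 = 0 := by simp [cinner]
  have b1 := norm_sum_kap_le ν hF (injOn_succ F)
    (r := fun k => coeffShift 1 (c k) + c k) (c := c) zero_le_two (fun k _ => h2 _ _)
  have b2 := norm_sum_kap_le ν hF (injOn_pred hF)
    (r := fun k => if 2 ≤ k then coeffShift (-1) (c k) + c k else 0) (c := c) zero_le_two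
    (fun k _ => by
      split_ifs
      · exact h2 _ _
      · rw [h0]; nlinarith [cinner_self_nonneg ν (c k)])
  have b3 := norm_sum_kap_le ν hF (φ := fun k => k) (fun _ _ _ _ h => h)
    (r := fun k => if 2 ≤ k then c k else 0) (c := c) zero_le_one
    (fun k _ => by
      split_ifs
      · simp
      · rw [h0]; nlinarith [cinner_self_nonneg ν (c k)])
  refine (norm_add_le _ _).trans ((add_le_add (norm_sub_le _ _) (norm_sub_le _ _)).trans ?_)
  rw [norm_smul, norm_smul, Real.norm_of_nonneg zero_le_two]
  linarith

lemma energy_eq (hf : IsLocal ν f) (lam gam : ℝ) : energy ν lam gam f =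
    -gam * starProd ν f (genMove flipSite f) - lam * starProd ν f (genMove exch f) := by
  rw [energy, starProd_genS hf hf]; ring

lemma isLocal_offObs (F : Finset ℕ) (c : ℕ → coeff C) : IsLocal ν (offObs F c) :=
  isLocal_of_mem_quadP (offObs_mem F c)

lemma norm_cls_sq (hf : IsLocal ν f) : ‖cls ν f‖ ^ 2 = starProd ν f f := by
  rw [← real_inner_self_eq_norm_sq, inner_cls hf hf]

lemma energy_offObs {F : Finset ℕ} (hF : 0 ∉ F) (c : ℕ → coeff C) (lam gam : ℝ) :
    energy ν lam gam (offObs F c) = 4 * gam * ‖cls ν (offObs F c)‖ ^ 2 -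
      lam * starProd ν (offObs F c) (genMove exch (offObs F c)) := by
  rw [energy_eq ν (isLocal_offObs ν F c), genMove_flipSite_offObs ν hF, star_smul_right,
    norm_cls_sq ν (isLocal_offObs ν F c)]
  ring

/-- The flips alone give the gap 4γ; the exchanges only add energy. -/
lemma le_energy_offObs {F : Finset ℕ} (hF : 0 ∉ F) (c : ℕ → coeff C) {lam gam : ℝ}
    (hlam : 0 ≤ lam) : 4 * gam * ‖cls ν (offObs F c)‖ ^ 2 ≤ energy ν lam gam (offObs F c) := by
  rw [energy_offObs ν hF]
  nlinarith [starProd_genMove_nonpos isMove_exch (isLocal_offObs ν F c)]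

lemma energy_offObs_le {F : Finset ℕ} (hF : 0 ∉ F) (c : ℕ → coeff C) {lam gam : ℝ}
    (hlam : 0 ≤ lam) :
    energy ν lam gam (offObs F c) ≤ (4 * gam + 14 * lam) * ‖cls ν (offObs F c)‖ ^ 2 := by
  rw [energy_offObs ν hF]
  have hl := isLocal_offObs ν F c
  have h1 := norm_cls_genMove_exch_offObs_le ν hF c
  have h2 := abs_real_inner_le_norm (cls ν (offObs F c)) (cls ν (genMove exch (offObs F c)))
  rw [inner_cls hl (hl.genMove isMove_exch)] at h2
  have h3 := (abs_le.1 h2).1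
  have h4 : ‖cls ν (offObs F c)‖ * ‖cls ν (genMove exch (offObs F c))‖ ≤
      14 * ‖cls ν (offObs F c)‖ ^ 2 := by nlinarith [norm_nonneg (cls ν (offObs F c))]
  nlinarith

lemma inner_kap_diag_offObs {F : Finset ℕ} (hF : 0 ∉ F) (c : ℕ → coeff C) (r : coeff C) :
    inner ℝ (kap ν 0 0 r) (cls ν (offObs F c)) = 0 := by
  rw [cls_offObs, inner_sum]
  refine Finset.sum_eq_zero fun k hk => ?_
  have h := inner_kap ν 0 k r (c k)
  rw [if_neg (by rintro rfl; exact hF hk)] at h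
  exact h

lemma kap_diag (i : ℤ) (r : coeff C) : kap ν i i r = kap ν 0 0 (coeffShift (-i) r) := by
  rw [← kap_shift ν (-i) i i r, neg_add_cancel]

/-- After translating :ω_{±1}²: back to the origin, the exchange dynamics acts on the coefficient as
a discrete Laplacian in the disorder. -/
lemma cls_genMove_exch_diag (r : coeff C) :
    cls ν (genMove exch (quadTerm 0 0 (r : Disorder C → ℝ))) =
      kap ν 0 0 (coeffShift (-1) r + coeffShift 1 r - (2 : ℝ) • r) := by
  have hl : ∀ i j, IsLocal ν (quadTerm i j (r : Disorder C → ℝ)) := fun i j =>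
    isLocal_quadTerm i j r
  have hset : ({(0 : ℤ) - 1, 0, 0 - 1, 0} : Finset ℤ) = {-1, 0} := by
    ext; simp
  rw [genMove_exch_quadTerm, hset, Finset.sum_pair (by norm_num)]
  simp only [swap_succ_apply]
  norm_num
  rw [cls_add ((hl _ _).sub (hl _ _)) ((hl _ _).sub (hl _ _)), cls_sub (hl _ _) (hl _ _),
    cls_sub (hl _ _) (hl _ _), cls_quadTerm, cls_quadTerm, cls_quadTerm, kap_diag ν (-1),
    kap_diag ν 1, neg_neg, two_smul]
  abel

lemma cls_genS_diag (lam gam : ℝ) (r : coeff C) :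
    cls ν (genS lam gam (quadTerm 0 0 (r : Disorder C → ℝ))) =
      lam • kap ν 0 0 (coeffShift (-1) r + coeffShift 1 r - (2 : ℝ) • r) := by
  rw [genS_eq, genMove_flipSite_quadTerm_diag, smul_zero, zero_add,
    cls_smul lam ((isLocal_quadTerm _ _ _).genMove isMove_exch), cls_genMove_exch_diag]

lemma inner_kap_diag (r r' : coeff C) :
    inner ℝ (kap ν 0 0 r) (kap ν 0 0 r') = 2 * cinner ν r r' := by
  have h := inner_kap ν 0 0 r r'
  simpa using h

lemma cinner_comm (r r' : coeff C) : cinner ν r r' = cinner ν r' r := by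
  rw [cinner_eq_inner, cinner_eq_inner, real_inner_comm]

/-- The Dirichlet form of that Laplacian: flips leave squares fixed, so the energy sees the diagonal
part only through r - τ₁r. -/
lemma energy_diag (lam gam : ℝ) (r : coeff C) :
    energy ν lam gam (quadTerm 0 0 (r : Disorder C → ℝ)) =
      2 * lam * cinner ν (r - coeffShift 1 r) (r - coeffShift 1 r) := by
  have hl : IsLocal ν (quadTerm 0 0 (r : Disorder C → ℝ)) := isLocal_quadTerm 0 0 r
  rw [energy, ← inner_cls hl (hl.genS lam gam), cls_genS_diag, cls_quadTerm,
    real_inner_smul_right, inner_kap_diag]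
  have e1 : cinner ν r (coeffShift (-1) r) = cinner ν r (coeffShift 1 r) := by
    rw [← cinner_shift ν 1 r (coeffShift (-1) r), coeffShift_coeffShift, neg_add_cancel,
      coeffShift_zero, cinner_comm]
  have e2 := cinner_shift ν 1 r r
  simp only [cinner_eq_inner, map_add, map_sub, map_smul, inner_add_right, inner_sub_right,
    inner_sub_left, real_inner_smul_right] at e1 e2 ⊢
  rw [real_inner_comm (kap ν 0 (1 : ℕ) r) (kap ν 0 (1 : ℕ) (coeffShift 1 r))]
  linear_combination (-2 * lam) * e1 - (2 * lam) * e2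

lemma energy_diag_le {lam : ℝ} (hlam : 0 ≤ lam) (gam : ℝ) (r : coeff C) :
    energy ν lam gam (quadTerm 0 0 (r : Disorder C → ℝ)) ≤ 4 * lam * ‖kap ν 0 0 r‖ ^ 2 := by
  rw [energy_diag, ← real_inner_self_eq_norm_sq, inner_kap_diag]
  have h1 := cinner_add_self_le ν r (-coeffShift 1 r)
  have h2 : cinner ν (-coeffShift 1 r) (-coeffShift 1 r) = cinner ν r r := by
    rw [← cinner_shift ν 1 r r]
    simp [cinner_eq_inner]
  rw [h2, ← sub_eq_add_neg] at h1
  nlinarith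

/-- The two bonds at the origin become one bond after translation, with coefficients r and τ₁r of
opposite signs. Thus 𝒜 sees the diagonal part through the very quantity that the exchange energy
controls, and its image is off-diagonal. -/
lemma cls_genA_diag (hC : 0 < C) (r : coeff C) :
    cls ν (genA (quadTerm 0 0 (r : Disorder C → ℝ))) =
      (2 : ℝ) • kap ν 0 (1 : ℕ) ((r - coeffShift 1 r) * coupling hC 0) := by
  have hl : ∀ i j (r : coeff C), IsLocal ν (quadTerm i j (r : Disorder C → ℝ)) := isLocal_quadTerm
  rw [genA_quadTerm hC, cls_sub (((hl _ _ _).sub (hl _ _ _)).add (hl _ _ _)) (hl _ _ _),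
    cls_add ((hl _ _ _).sub (hl _ _ _)) (hl _ _ _), cls_sub (hl _ _ _) (hl _ _ _),
    cls_quadTerm, cls_quadTerm, cls_quadTerm, cls_quadTerm, zero_add, zero_sub,
    kap_comm ν 1 0, kap_comm ν 0 (-1)]
  have h := kap_neg_one_left ν 0 (r * coupling hC (-1))
  simp only [Nat.cast_zero, zero_add, coeffShift_mul, coeffShift_coupling, add_neg_cancel] at h
  rw [h, sub_mul, map_sub, smul_sub, two_smul, two_smul, Nat.cast_one]
  abel

lemma norm_cls_genA_diag_sq_le (hC : 0 < C) (r : coeff C) :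
    ‖cls ν (genA (quadTerm 0 0 (r : Disorder C → ℝ)))‖ ^ 2 ≤
      4 * C ^ 2 * cinner ν (r - coeffShift 1 r) (r - coeffShift 1 r) := by
  rw [cls_genA_diag ν hC, norm_smul, Real.norm_of_nonneg zero_le_two, mul_pow,
    ← real_inner_self_eq_norm_sq, ← cinner_eq_inner]
  have := cinner_mul_coupling_le ν hC 0 (r - coeffShift 1 r)
  linarith

lemma inner_cls_genA_diag (hC : 0 < C) (r r' : coeff C) :
    inner ℝ (cls ν (genA (quadTerm 0 0 (r : Disorder C → ℝ)))) (kap ν 0 0 r') = 0 := by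
  have h := inner_kap ν 1 0 ((r - coeffShift 1 r) * coupling hC 0) r'
  rw [cls_genA_diag ν hC, real_inner_smul_left]
  simp only [Nat.cast_zero] at h
  rw [h]
  simp

end Bounds

/-! ### The sector condition, and the energy bounds for j^A and for the identity. -/

section EnergyBounds

variable {C : ℝ} (ν : Measure (Set.Icc C⁻¹ C)) [IsProbabilityMeasure ν] {f g : Obs C}

/-- The generator acts on functions, not on classes. Symmetry moves it from one argument to the
other, so the form depends only on the two classes, and representatives in normal form can be used.
-/
lemma starProd_genS_of_cls_eq {f' g' : Obs C} (hf : IsLocal ν f) (hg : IsLocal ν g)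
    (hf' : IsLocal ν f') (hg' : IsLocal ν g') (e : cls ν f = cls ν f') (e' : cls ν g = cls ν g')
    (lam gam : ℝ) : starProd ν f (genS lam gam g) = starProd ν f' (genS lam gam g') := by
  rw [← inner_cls hf (hg.genS lam gam), e, inner_cls hf' (hg.genS lam gam),
    starProd_genS_comm hf' hg, ← inner_cls (hf'.genS lam gam) hg, e',
    inner_cls (hf'.genS lam gam) hg', starProd_genS_comm hf' hg']

lemma starProd_genA_left (hC : 0 < C) (hf : f ∈ quadP C) (hg : g ∈ quadP C) :
    starProd ν (genA f) g = -starProd ν f (genA g) := by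
  rw [starProd_genA (isLocal_of_mem_quadP hf) (isLocal_of_mem_quadP hg)
    (isSmooth_of_mem_quadP ν hf) (isSmooth_of_mem_quadP ν hg)
    (isLocal_of_mem_quadP (genA_mem_quadP ν hC hf))
    (isLocal_of_mem_quadP (genA_mem_quadP ν hC hg)), neg_neg]

lemma starProd_genA_of_cls_eq (hC : 0 < C) {f' g' : Obs C} (hf : f ∈ quadP C) (hg : g ∈ quadP C)
    (hf' : f' ∈ quadP C) (hg' : g' ∈ quadP C) (e : cls ν f = cls ν f')
    (e' : cls ν g = cls ν g') : starProd ν (genA f) g = starProd ν (genA f') g' := by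
  have hl : ∀ {f : Obs C}, f ∈ quadP C → IsLocal ν f := isLocal_of_mem_quadP
  have hA : ∀ {f : Obs C}, f ∈ quadP C → IsLocal ν (genA f) := fun h =>
    isLocal_of_mem_quadP (genA_mem_quadP ν hC h)
  rw [← inner_cls (hA hf) (hl hg), e', inner_cls (hA hf) (hl hg'), starProd_genA_left ν hC hf hg',
    ← inner_cls (hl hf) (hA hg'), e, inner_cls (hl hf') (hA hg'),
    starProd_genA_left ν hC hf' hg']

lemma exists_diag_add_offObs (hf : f ∈ quadP C) : ∃ (r : coeff C) (F : Finset ℕ)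
    (c : ℕ → coeff C), 0 ∉ F ∧
      cls ν f = cls ν (quadTerm 0 0 (r : Disorder C → ℝ) + offObs F c) := by
  obtain ⟨r, F, c, hF, h⟩ := exists_coordinates ν hf
  exact ⟨r, F, c, hF, by
    rw [h, cls_add (isLocal_quadTerm 0 0 r) (isLocal_offObs ν F c), cls_offObs, cls_quadTerm]⟩

/-- The operator 𝒮 keeps the class of a diagonal term diagonal, hence orthogonal to the off-diagonal
part; symmetry gives the other cross term. -/
lemma energy_diag_add_offObs {F : Finset ℕ} (hF : 0 ∉ F) (c : ℕ → coeff C) (r : coeff C)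
    (lam gam : ℝ) : energy ν lam gam (quadTerm 0 0 (r : Disorder C → ℝ) + offObs F c) =
      energy ν lam gam (quadTerm 0 0 (r : Disorder C → ℝ)) + energy ν lam gam (offObs F c) := by
  have hd : IsLocal ν (quadTerm 0 0 (r : Disorder C → ℝ)) := isLocal_quadTerm 0 0 r
  have ho := isLocal_offObs ν F c
  have h1 : starProd ν (offObs F c) (genS lam gam (quadTerm 0 0 (r : Disorder C → ℝ))) = 0 := by
    rw [← inner_cls ho (hd.genS lam gam), cls_genS_diag, real_inner_smul_right, real_inner_comm,
      inner_kap_diag_offObs ν hF, mul_zero]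
  have h2 : starProd ν (quadTerm 0 0 (r : Disorder C → ℝ)) (genS lam gam (offObs F c)) = 0 := by
    rw [starProd_genS_comm hd ho, (hd.genS lam gam).star_comm ho, h1]
  simp only [energy]
  rw [genS_add hd ho, star_add_right (hd.add ho) (hd.genS lam gam) (ho.genS lam gam),
    hd.star_add_left ho (hd.genS lam gam), hd.star_add_left ho (ho.genS lam gam), h1, h2]
  ring

lemma norm_cls_diag_add_offObs_sq {F : Finset ℕ} (hF : 0 ∉ F) (c : ℕ → coeff C) (r : coeff C) :
    ‖cls ν (quadTerm 0 0 (r : Disorder C → ℝ) + offObs F c)‖ ^ 2 =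
      ‖kap ν 0 0 r‖ ^ 2 + ‖cls ν (offObs F c)‖ ^ 2 := by
  rw [cls_add (isLocal_quadTerm 0 0 r) (isLocal_offObs ν F c), cls_quadTerm, norm_add_sq_real,
    inner_kap_diag_offObs ν hF]
  ring

lemma energy_le (hf : f ∈ quadP C) {lam gam : ℝ} (hlam : 0 ≤ lam) (hgam : 0 ≤ gam) :
    energy ν lam gam f ≤ (4 * gam + 14 * lam) * ‖cls ν f‖ ^ 2 := by
  obtain ⟨r, F, c, hF, h⟩ := exists_diag_add_offObs ν hf
  have hl : IsLocal ν (quadTerm 0 0 (r : Disorder C → ℝ) + offObs F c) :=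
    (isLocal_quadTerm 0 0 r).add (isLocal_offObs ν F c)
  have e : energy ν lam gam f = energy ν lam gam (quadTerm 0 0 (r : Disorder C → ℝ) + offObs F c) :=
    congrArg Neg.neg (starProd_genS_of_cls_eq ν (isLocal_of_mem_quadP hf)
      (isLocal_of_mem_quadP hf) hl hl h h lam gam)
  rw [e, h, energy_diag_add_offObs ν hF, norm_cls_diag_add_offObs_sq ν hF]
  have h1 := energy_diag_le ν hlam gam r
  have h2 := energy_offObs_le ν hF c hlam (gam := gam)
  nlinarith [mul_nonneg hgam (sq_nonneg ‖kap ν 0 0 r‖),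
    mul_nonneg hlam (sq_nonneg ‖kap ν 0 0 r‖)]

/-- The two seminorms that are controlled by the energy. -/
lemma exists_diag_add_offObs_energy (hC : 0 < C) (hf : f ∈ quadP C) {lam gam : ℝ}
    (hlam : 0 ≤ lam) : ∃ (r : coeff C) (F : Finset ℕ)
    (c : ℕ → coeff C) (X : ℝ), 0 ∉ F ∧
      cls ν f = cls ν (quadTerm 0 0 (r : Disorder C → ℝ) + offObs F c) ∧ 0 ≤ X ∧
      ‖cls ν (genA (quadTerm 0 0 (r : Disorder C → ℝ)))‖ ≤ 2 * C * X ∧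
      2 * lam * X ^ 2 + 4 * gam * ‖cls ν (offObs F c)‖ ^ 2 ≤ energy ν lam gam f := by
  obtain ⟨r, F, c, hF, h⟩ := exists_diag_add_offObs ν hf
  have hX := cinner_self_nonneg ν (r - coeffShift 1 r)
  refine ⟨r, F, c, √(cinner ν (r - coeffShift 1 r) (r - coeffShift 1 r)), hF, h,
    Real.sqrt_nonneg _, ?_, ?_⟩
  · refine le_of_sq_le_sq ?_ (by positivity)
    rw [mul_pow, Real.sq_sqrt hX]
    linarith [norm_cls_genA_diag_sq_le ν hC r]
  · have hl : IsLocal ν (quadTerm 0 0 (r : Disorder C → ℝ) + offObs F c) :=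
      (isLocal_quadTerm 0 0 r).add (isLocal_offObs ν F c)
    have e : energy ν lam gam f =
        energy ν lam gam (quadTerm 0 0 (r : Disorder C → ℝ) + offObs F c) :=
      congrArg Neg.neg (starProd_genS_of_cls_eq ν (isLocal_of_mem_quadP hf)
        (isLocal_of_mem_quadP hf) hl hl h h lam gam)
    rw [e, energy_diag_add_offObs ν hF, Real.sq_sqrt hX, energy_diag]
    linarith [le_energy_offObs ν hF c hlam (gam := gam)]

/-- The sector condition. Write X for the norm of r - τ₁r and Y for that of the off-diagonal part.
Every matrix element of 𝒜 is bounded by products of these, and the energy dominates X² and Y²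
because λ and γ are both positive. -/
lemma abs_starProd_genA_le (hC : 0 < C) {lam gam : ℝ} (hlam : 0 < lam) (hgam : 0 < gam) :
    ∃ c : ℝ, 0 ≤ c ∧ ∀ f g : Obs C, f ∈ quadP C → g ∈ quadP C →
      |starProd ν (genA f) g| ≤ c * √(energy ν lam gam f) * √(energy ν lam gam g) := by
  obtain ⟨m, hm, h1, h2⟩ : ∃ m : ℝ, 0 < m ∧ m ≤ 2 * lam ∧ m ≤ 4 * gam :=
    ⟨min (2 * lam) (4 * gam), by positivity, min_le_left _ _, min_le_right _ _⟩
  refine ⟨16 * C / m, by positivity, fun f g hf hg => ?_⟩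
  obtain ⟨r, F, c, X, hF, e, hX, hA, hE⟩ :=
    exists_diag_add_offObs_energy ν hC hf (gam := gam) hlam.le
  obtain ⟨r', F', c', X', hF', e', hX', hA', hE'⟩ :=
    exists_diag_add_offObs_energy ν hC hg (gam := gam) hlam.le
  have hd : ∀ r : coeff C, quadTerm 0 0 (r : Disorder C → ℝ) ∈ quadP C := quadTerm_mem_quadP 0 0
  have hl : ∀ {f : Obs C}, f ∈ quadP C → IsLocal ν f := isLocal_of_mem_quadP
  have hlA : ∀ {f : Obs C}, f ∈ quadP C → IsLocal ν (genA f) := fun h =>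
    isLocal_of_mem_quadP (genA_mem_quadP ν hC h)
  have hsm : ∀ {f : Obs C}, f ∈ quadP C → IsSmooth f := isSmooth_of_mem_quadP ν
  have ho := offObs_mem F c
  have ho' := offObs_mem F' c'
  -- The diagonal-diagonal element vanishes, and antisymmetry lets 𝒜 act on the diagonal factor in
  -- the mixed ones.
  have key : starProd ν (genA f) g =
      inner ℝ (cls ν (genA (quadTerm 0 0 (r : Disorder C → ℝ)))) (cls ν (offObs F' c')) -
      inner ℝ (cls ν (offObs F c)) (cls ν (genA (quadTerm 0 0 (r' : Disorder C → ℝ)))) +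
      inner ℝ (cls ν (genA (offObs F c))) (cls ν (offObs F' c')) := by
    rw [starProd_genA_of_cls_eq ν hC hf hg ((quadP C).add_mem (hd r) ho)
      ((quadP C).add_mem (hd r') ho') e e', genA_add (hl (hd r)) (hl ho) (hsm (hd r)) (hsm ho),
      ← inner_cls ((hlA (hd r)).add (hlA ho)) ((hl (hd r')).add (hl ho')),
      cls_add (hlA (hd r)) (hlA ho), cls_add (hl (hd r')) (hl ho'), inner_add_left,
      inner_add_right, inner_add_right, cls_quadTerm, inner_cls_genA_diag ν hC]
    have : inner ℝ (cls ν (genA (offObs F c))) (kap ν 0 0 r') =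
        -inner ℝ (cls ν (offObs F c)) (cls ν (genA (quadTerm 0 0 (r' : Disorder C → ℝ)))) := by
      rw [← cls_quadTerm, inner_cls (hlA ho) (hl (hd r')), inner_cls (hl ho) (hlA (hd r')),
        starProd_genA_left ν hC ho (hd r')]
    rw [this]
    ring
  set Y := ‖cls ν (offObs F c)‖ with hY
  set Y' := ‖cls ν (offObs F' c')‖ with hY'
  have hY0 : 0 ≤ Y := norm_nonneg _
  have hY0' : 0 ≤ Y' := norm_nonneg _
  have b1 := (abs_real_inner_le_norm (cls ν (genA (quadTerm 0 0 (r : Disorder C → ℝ))))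
    (cls ν (offObs F' c'))).trans (mul_le_mul_of_nonneg_right hA hY0')
  have b2 := (abs_real_inner_le_norm (cls ν (offObs F c))
    (cls ν (genA (quadTerm 0 0 (r' : Disorder C → ℝ))))).trans (mul_le_mul_of_nonneg_left hA' hY0)
  have b3 := (abs_real_inner_le_norm (cls ν (genA (offObs F c)))
    (cls ν (offObs F' c'))).trans (mul_le_mul_of_nonneg_right
      (norm_cls_genA_offObs_le ν hC hF c) hY0')
  have bound : |starProd ν (genA f) g| ≤ 16 * C * ((X + Y) / 2 * (X' + Y')) := by
    rw [key]
    refine (abs_add_le _ _).trans ((add_le_add (abs_sub _ _) le_rfl).trans ?_)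
    nlinarith [mul_nonneg hC.le (mul_nonneg hX hX'), mul_nonneg hC.le (mul_nonneg hX hY0'),
      mul_nonneg hC.le (mul_nonneg hY0 hX'), mul_nonneg hC.le (mul_nonneg hY0 hY0')]
  -- From (X + Y)² ≤ 2(X² + Y²) and m ≤ min(2λ, 4γ).
  have half : ∀ {E X Y : ℝ}, 0 ≤ X → 0 ≤ Y → 2 * lam * X ^ 2 + 4 * gam * Y ^ 2 ≤ E →
      √(m / 2) * (X + Y) ≤ √E := by
    intro E X Y _ _ h
    refine Real.le_sqrt_of_sq_le ?_
    rw [mul_pow, Real.sq_sqrt (by positivity)]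
    nlinarith [mul_nonneg hm.le (sq_nonneg (X - Y)),
      mul_nonneg (sub_nonneg.2 h1) (sq_nonneg X), mul_nonneg (sub_nonneg.2 h2) (sq_nonneg Y)]
  have hprod := mul_le_mul (half hX hY0 hE) (half hX' hY0' hE') (by positivity)
    (Real.sqrt_nonneg _)
  have hs := Real.mul_self_sqrt (show 0 ≤ m / 2 by positivity)
  calc |starProd ν (genA f) g| ≤ 16 * C * ((X + Y) / 2 * (X' + Y')) := bound
    _ = 16 * C / m * (√(m / 2) * (X + Y) * (√(m / 2) * (X' + Y'))) := by
      rw [show √(m / 2) * (X + Y) * (√(m / 2) * (X' + Y')) =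
        √(m / 2) * √(m / 2) * (X + Y) * (X' + Y') by ring, hs]
      field_simp
    _ ≤ 16 * C / m * (√(energy ν lam gam f) * √(energy ν lam gam g)) := by gcongr
    _ = _ := by ring

lemma currentA_eq (hC : 0 < C) : (currentA : Obs C) =
    (2 : ℝ) • quadTerm 0 1 (coupling hC 0 : Disorder C → ℝ) := by
  funext m ω
  simp [currentA, quadTerm_apply, coupling_apply, wick, div_eq_mul_inv]
  ring

lemma currentA_mem_quadV (hC : 0 < C) : (currentA : Obs C) ∈ quadV C := by
  rw [currentA_eq hC]
  exact (quadV C).smul_mem _ (quadTerm_mem_quadV (by norm_num) _)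

/-- The current is purely off-diagonal, so only the part with the flip gap contributes. -/
lemma abs_starProd_currentA_le (hC : 0 < C) {lam gam : ℝ} (hlam : 0 < lam) (hgam : 0 < gam) :
    ∃ c : ℝ, ∀ f : Obs C, f ∈ quadP C →
      |starProd ν currentA f| ≤ c * √(energy ν lam gam f) := by
  refine ⟨‖cls ν currentA‖ / √(4 * gam), fun f hf => ?_⟩
  obtain ⟨r, F, c, X, hF, e, hX, hA, hE⟩ :=
    exists_diag_add_offObs_energy ν hC hf (gam := gam) hlam.le
  have h0 : inner ℝ (cls ν currentA) (kap ν 0 0 r) = 0 := by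
    have h := inner_kap ν 1 0 (coupling hC 0) r
    rw [currentA_eq hC, cls_smul _ (isLocal_quadTerm _ _ _), cls_quadTerm, real_inner_smul_left]
    simp only [Nat.cast_zero, Nat.cast_one] at h
    rw [h]
    simp
  rw [← inner_cls (isLocal_currentA hC) (isLocal_of_mem_quadP hf), e,
    cls_add (isLocal_quadTerm 0 0 r) (isLocal_offObs ν F c), inner_add_right, cls_quadTerm, h0,
    zero_add]
  refine (abs_real_inner_le_norm _ _).trans ?_
  rw [div_mul_eq_mul_div, mul_div_assoc]
  gcongr
  rw [le_div_iff₀ (by positivity)]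
  refine Real.le_sqrt_of_sq_le ?_
  rw [mul_pow, Real.sq_sqrt (by positivity)]
  nlinarith [mul_nonneg hlam.le (sq_nonneg X)]

end EnergyBounds

/-! ### The first moment ≪·≫_⋆⋆ and the splitting of the Dirichlet form. -/

section FirstMoment

variable {C : ℝ} {ν : Measure (Set.Icc C⁻¹ C)} [IsProbabilityMeasure ν] {f g : Obs C}

lemma expect_eq_zero_of_isLocal (hf : IsLocal ν f) : expect ν f = 0 := by
  have h : expect ν f = ∫ m, ∫ ω, f m ω ∂gibbs ∂(disorderLaw ν) :=
    integral_prod _ (hf.memLp_annealed.integrable one_le_two)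
  rw [h]
  simp [hf.mean_zero]

/-- As f has mean zero, ω_x² may be replaced by its Wick square, a translate of a local function;
the sum then has finitely many nonzero terms. -/
lemma starStar_eq (hf : IsLocal ν f) : starStar ν f = ∑' x : ℤ, (x : ℝ) *
    expect ν (f * trans x (quadTerm 0 0 ((1 : coeff C) : Disorder C → ℝ))) := by
  unfold starStar
  refine tsum_congr fun x => ?_
  congr 1
  have hq : IsLocal ν (quadTerm x x ((1 : coeff C) : Disorder C → ℝ)) := isLocal_quadTerm x x 1
  have h1 := integral_add (hf.integrable_mul hq) (hf.memLp_annealed.integrable one_le_two)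
  have h2 : ∫ p, f p.1 p.2 ∂(annealed ν) = 0 := expect_eq_zero_of_isLocal hf
  rw [h2, add_zero] at h1
  rw [trans_quadTerm, add_zero]
  refine Eq.trans (integral_congr_ae (Eventually.of_forall fun p => ?_)) h1
  simp only [quadTerm_apply, wick, if_true, OneMemClass.coe_one, Pi.one_apply]
  ring

lemma summable_starStar (hf : IsLocal ν f) : Summable fun x : ℤ => (x : ℝ) *
    expect ν (f * trans x (quadTerm 0 0 ((1 : coeff C) : Disorder C → ℝ))) :=
  summable_of_hasFiniteSupport ((hf.finite_support (isLocal_quadTerm 0 0 1)).subset fun x hx h =>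
    hx (by simp only [h, mul_zero]))

lemma starStar_add (hf : IsLocal ν f) (hg : IsLocal ν g) :
    starStar ν (f + g) = starStar ν f + starStar ν g := by
  rw [starStar_eq (hf.add hg), starStar_eq hf, starStar_eq hg,
    ← (summable_starStar hf).tsum_add (summable_starStar hg)]
  refine tsum_congr fun x => ?_
  have hq := (isLocal_quadTerm (ν := ν) 0 0 (1 : coeff C)).trans x
  rw [← mul_add]
  congr 1
  refine Eq.trans (integral_congr_ae (Eventually.of_forall fun p => ?_))
    (integral_add (hf.integrable_mul hq) (hg.integrable_mul hq))
  simp only [Pi.mul_apply, Pi.add_apply, add_mul]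

lemma starStar_smul (c : ℝ) (f : Obs C) : starStar ν (c • f) = c * starStar ν f := by
  unfold starStar
  rw [← tsum_mul_left]
  refine tsum_congr fun x => ?_
  rw [mul_left_comm]
  congr 1
  unfold expect
  rw [← integral_const_mul]
  simp [mul_assoc]

variable (ν) in
/-- The functional `≪·≫_⋆⋆` on `𝒞`. -/
noncomputable def starStarL : localSubmodule ν →ₗ[ℝ] ℝ where
  toFun f := starStar ν f.1
  map_add' f g := starStar_add f.2 g.2
  map_smul' c f := starStar_smul c f.1

lemma starStar_sub (hf : IsLocal ν f) (hg : IsLocal ν g) :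
    starStar ν (f - g) = starStar ν f - starStar ν g :=
  map_sub (starStarL ν) ⟨f, hf⟩ ⟨g, hg⟩

lemma starStar_sum {ι : Type*} {s : Finset ι} {f : ι → Obs C} (hf : ∀ i, IsLocal ν (f i)) :
    starStar ν (∑ i ∈ s, f i) = ∑ i ∈ s, starStar ν (f i) := by
  have h := map_sum (starStarL ν) (fun i => (⟨f i, hf i⟩ : localSubmodule ν)) s
  simp only [starStarL, LinearMap.coe_mk, AddHom.coe_mk] at h
  rw [← h]
  congr 1
  simp

lemma starStar_quadTerm (i j : ℤ) (r : coeff C) :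
    starStar ν (quadTerm i j (r : Disorder C → ℝ)) =
      if i = j then 2 * i * cinner ν r 1 else 0 := by
  have h : ∀ x : ℤ, expect ν (quadTerm i j (r : Disorder C → ℝ) *
      trans x (quadTerm 0 0 ((1 : coeff C) : Disorder C → ℝ))) =
      cinner ν r (coeffShift x 1) * ∫ ω, wick i j ω * wick x x ω ∂gibbs := fun x => by
    rw [trans_quadTerm, expect_quadTerm_mul_quadTerm, add_zero]
  rw [starStar_eq (isLocal_quadTerm i j r)]
  simp only [h]
  split_ifs with hij
  · subst hij
    have h1 : coeffShift i (1 : coeff C) = 1 := rfl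
    simp only [integral_wick_diag_mul_wick_diag]
    rw [tsum_eq_single i fun x hx => by rw [if_neg hx.symm]; ring, if_pos rfl, h1]
    ring
  · simp [integral_wick_off_mul_wick_diag hij]

/-- An exchange moves a square one step right or one step left with the same coefficient, so the
first moment is unchanged in total. -/
lemma starStar_genMove_exch_quadTerm (i j : ℤ) (r : coeff C) :
    starStar ν (genMove exch (quadTerm i j (r : Disorder C → ℝ))) = 0 := by
  have hl : ∀ i j, IsLocal ν (quadTerm i j (r : Disorder C → ℝ)) := fun i j =>
    isLocal_quadTerm i j r
  rw [genMove_exch_quadTerm, starStar_sum fun x => (hl _ _).sub (hl _ _)]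
  simp only [starStar_sub (hl _ _) (hl _ _), starStar_quadTerm,
    (Equiv.injective _).eq_iff]
  by_cases h : i = j
  · subst h
    have hset : ({i - 1, i, i - 1, i} : Finset ℤ) = {i - 1, i} := by
      ext; simp
    rw [hset, Finset.sum_pair (by omega)]
    simp only [swap_succ_apply]
    rw [if_neg (show ¬ i = i - 1 by omega), if_pos (show i = i - 1 + 1 by omega)]
    simp only [if_true]
    push_cast
    ring
  · simp [h]

lemma starStar_genS_quadTerm (lam gam : ℝ) (i j : ℤ) (r : coeff C) :
    starStar ν (genS lam gam (quadTerm i j (r : Disorder C → ℝ))) = 0 := by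
  have hl : IsLocal ν (quadTerm i j (r : Disorder C → ℝ)) := isLocal_quadTerm i j r
  rw [genS_eq, starStar_add ((hl.genMove isMove_flipSite).smul gam)
    ((hl.genMove isMove_exch).smul lam), starStar_smul, starStar_smul,
    starStar_genMove_exch_quadTerm]
  by_cases h : i = j
  · subst h
    rw [genMove_flipSite_quadTerm_diag, ← zero_smul ℝ (0 : Obs C), starStar_smul]
    ring
  · rw [genMove_flipSite_quadTerm h, starStar_smul, starStar_quadTerm, if_neg h]
    ring

lemma starStar_genS (lam gam : ℝ) (hf : f ∈ quadP C) : starStar ν (genS lam gam f) = 0 := by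
  induction hf using Submodule.span_induction with
  | mem f hf =>
    obtain ⟨i, j, r, rfl⟩ := hf
    exact starStar_genS_quadTerm lam gam i j r
  | zero => rw [← zero_smul ℝ (0 : Obs C), genS_smul, starStar_smul, zero_mul]
  | add f g hf hg h1 h2 =>
    have hf : IsLocal ν f := isLocal_of_mem_quadP hf
    have hg : IsLocal ν g := isLocal_of_mem_quadP hg
    rw [genS_add hf hg, starStar_add (hf.genS lam gam) (hg.genS lam gam), h1, h2, add_zero]
  | smul c f hf h1 => rw [genS_smul, starStar_smul, h1, mul_zero]

/-- Diagonal terms arise only for neighbouring sites; they sit at positions differing by one, with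
opposite coefficients, which leaves twice the mean of r times the coupling. -/
lemma starStar_genA_quadTerm (hC : 0 < C) (i j : ℤ) (r : coeff C) :
    starStar ν (genA (quadTerm i j (r : Disorder C → ℝ))) =
      starProd ν (quadTerm i j (r : Disorder C → ℝ)) currentA := by
  wlog hij : i ≤ j generalizing i j
  · rw [quadTerm_comm]
    exact this j i (le_of_not_ge hij)
  have hl : ∀ i j (r : coeff C), IsLocal ν (quadTerm i j (r : Disorder C → ℝ)) := isLocal_quadTerm
  obtain ⟨k, hk⟩ := Int.eq_ofNat_of_zero_le (sub_nonneg.2 hij)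
  have hj : j = i + k := by omega
  subst hj
  have h1 : starProd ν (quadTerm i (i + k) (r : Disorder C → ℝ)) currentA =
      if k = 1 then 2 * cinner ν r (coupling hC i) else 0 := by
    rw [currentA_eq hC, star_smul_right, ← inner_cls (hl _ _ _) (hl _ _ _), cls_quadTerm,
      cls_quadTerm, ← kap_shift ν (-i) i (i + k) r, neg_add_cancel, neg_add_cancel_left]
    have h := inner_kap ν k 1 (coeffShift (-i) r) (coupling hC 0)
    simp only [Nat.cast_one] at h
    rw [h]
    split_ifs with h1 h2
    · omega
    · rw [← cinner_shift ν i, coeffShift_coeffShift, coeffShift_coupling, add_zero,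
        neg_add_cancel, coeffShift_zero, one_mul]
    · simp
  have h2 : ∀ x, cinner ν (r * coupling hC x) 1 = cinner ν r (coupling hC x) := fun x => by
    simp [cinner]
  rw [h1, genA_quadTerm hC, starStar_sub (((hl _ _ _).sub (hl _ _ _)).add (hl _ _ _)) (hl _ _ _),
    starStar_add ((hl _ _ _).sub (hl _ _ _)) (hl _ _ _), starStar_sub (hl _ _ _) (hl _ _ _)]
  simp only [starStar_quadTerm, h2]
  rw [if_neg (show ¬ i - 1 = i + (k : ℤ) by omega),
    if_neg (show ¬ i = i + (k : ℤ) + 1 by omega)]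
  by_cases hk1 : k = 1
  · subst hk1
    simp only [Nat.cast_one, if_true, add_sub_cancel_right]
    push_cast
    ring
  · rw [if_neg (by omega), if_neg (by omega), if_neg hk1]
    ring

/-- Formally, 𝒜 applied to ∑ x ω_x² is minus the total current, by summation by parts; antisymmetry
then moves 𝒜 off f. The rigorous check is made on generators. -/
lemma starStar_genA (hC : 0 < C) (hf : f ∈ quadP C) :
    starStar ν (genA f) = starProd ν f currentA := by
  have hj : IsLocal ν (currentA : Obs C) := isLocal_currentA hC
  induction hf using Submodule.span_induction with
  | mem f hf =>
    obtain ⟨i, j, r, rfl⟩ := hf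
    exact starStar_genA_quadTerm hC i j r
  | zero => rw [← zero_smul ℝ (0 : Obs C), genA_smul, starStar_smul, zero_mul,
      IsLocal.star_smul_left, zero_mul]
  | add f g hf hg h1 h2 =>
    have hf' : IsLocal ν f := isLocal_of_mem_quadP hf
    have hg' : IsLocal ν g := isLocal_of_mem_quadP hg
    rw [genA_add hf' hg' (isSmooth_of_mem_quadP ν hf) (isSmooth_of_mem_quadP ν hg),
      starStar_add (isLocal_of_mem_quadP (genA_mem_quadP ν hC hf))
      (isLocal_of_mem_quadP (genA_mem_quadP ν hC hg)), h1, h2, hf'.star_add_left hg' hj]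
  | smul c f hf h1 => rw [genA_smul, starStar_smul, h1, IsLocal.star_smul_left]

lemma starStar_currentA (hC : 0 < C) : starStar ν (currentA : Obs C) = 0 := by
  rw [currentA_eq hC, starStar_smul, starStar_quadTerm, if_neg (by norm_num), mul_zero]

lemma gradEnergy_eq : (gradEnergy : Obs C) =
    quadTerm 1 1 ((1 : coeff C) : Disorder C → ℝ) -
      quadTerm 0 0 ((1 : coeff C) : Disorder C → ℝ) := by
  funext m ω
  simp only [gradEnergy, Pi.sub_apply, quadTerm_apply, wick, if_true, OneMemClass.coe_one,
    Pi.one_apply]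
  ring

lemma isLocal_gradEnergy : IsLocal ν (gradEnergy : Obs C) := by
  rw [gradEnergy_eq]
  exact (isLocal_quadTerm 1 1 1).sub (isLocal_quadTerm 0 0 1)

/-- The gradient is a difference of two translates of one function, so only the first moment can
detect it. -/
lemma cls_gradEnergy : cls ν (gradEnergy : Obs C) = 0 := by
  rw [gradEnergy_eq, cls_sub (isLocal_quadTerm 1 1 1) (isLocal_quadTerm 0 0 1), cls_quadTerm,
    cls_quadTerm, kap_diag]
  exact sub_self _

lemma cinner_one_one : cinner ν (1 : coeff C) 1 = 1 := by simp [cinner]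

lemma starStar_gradEnergy : starStar ν (gradEnergy : Obs C) = 2 := by
  rw [gradEnergy_eq, starStar_sub (isLocal_quadTerm 1 1 1) (isLocal_quadTerm 0 0 1),
    starStar_quadTerm, starStar_quadTerm, cinner_one_one]
  simp

lemma expect_gradEnergy_sq : expect ν ((gradEnergy : Obs C) * gradEnergy) = 4 := by
  have hl : ∀ i, IsLocal ν (quadTerm i i ((1 : coeff C) : Disorder C → ℝ)) := fun i =>
    isLocal_quadTerm i i 1
  have h : ∀ i j : ℤ, expect ν (quadTerm i i ((1 : coeff C) : Disorder C → ℝ) *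
      quadTerm j j ((1 : coeff C) : Disorder C → ℝ)) = if i = j then 2 else 0 := fun i j => by
    rw [expect_quadTerm_mul_quadTerm, cinner_one_one, one_mul, integral_wick_diag_mul_wick_diag]
  have h1 := integral_sub ((hl 1).integrable_mul (hl 1)) ((hl 1).integrable_mul (hl 0))
  have h2 := integral_sub ((hl 0).integrable_mul (hl 0)) ((hl 0).integrable_mul (hl 1))
  have h3 := integral_add (((hl 1).integrable_mul (hl 1)).sub ((hl 1).integrable_mul (hl 0)))
    (((hl 0).integrable_mul (hl 0)).sub ((hl 0).integrable_mul (hl 1)))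
  have e : expect ν ((gradEnergy : Obs C) * gradEnergy) = expect ν (quadTerm 1 1
      ((1 : coeff C) : Disorder C → ℝ) * quadTerm 1 1 ((1 : coeff C) : Disorder C → ℝ)) -
      expect ν (quadTerm 1 1 ((1 : coeff C) : Disorder C → ℝ) *
        quadTerm 0 0 ((1 : coeff C) : Disorder C → ℝ)) +
      (expect ν (quadTerm 0 0 ((1 : coeff C) : Disorder C → ℝ) *
        quadTerm 0 0 ((1 : coeff C) : Disorder C → ℝ)) -
      expect ν (quadTerm 0 0 ((1 : coeff C) : Disorder C → ℝ) *
        quadTerm 1 1 ((1 : coeff C) : Disorder C → ℝ))) := by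
    refine Eq.trans ?_ (h3.trans (congrArg₂ (· + ·) h1 h2))
    refine integral_congr_ae (Eventually.of_forall fun p => ?_)
    rw [gradEnergy_eq]
    simp only [Pi.mul_apply, Pi.sub_apply]
    ring
  rw [e, h, h, h, h]
  norm_num

lemma moveDiff_exch_gradEnergy : moveDiff exch 0 (gradEnergy : Obs C) =
    (-2 : ℝ) • gradEnergy := by
  funext m ω
  simp [moveDiff, gradEnergy, exch]
  ring

/-- The exchange changes the sign of the gradient, so the expectation is -2≪ω₁² - ω₀², g≫_⋆, and the
gradient has zero class. Hence a ω₀² and Γ_g do not interact in the Dirichlet form. -/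
lemma expect_gradEnergy_mul_gradExch (hg : IsLocal ν g) :
    expect ν (gradEnergy * gradExch g) = 0 := by
  classical
  have hG : IsLocal ν (gradEnergy : Obs C) := isLocal_gradEnergy
  obtain ⟨t, ht⟩ := exists_moveDiff_eq_zero isMove_exch hg
  have ht' := moveDiff_zero_trans_eq_zero isMove_exch ht
  have h1 : ∀ x, expect ν (gradEnergy * moveDiff exch 0 (trans x g)) =
      -2 * expect ν (gradEnergy * trans x g) := fun x => by
    rw [← expect_moveDiff_mul isMove_exch hG (hg.trans x), moveDiff_exch_gradEnergy,
      mul_comm, expect_mul_smul, mul_comm gradEnergy]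
  rw [gradExch_eq, gradMove_eq_sum ht',
    expect_sum_right hG fun x _ => (hg.trans x).moveDiff isMove_exch 0]
  have h2 : starProd ν gradEnergy g =
      ∑ x ∈ t.image Neg.neg, expect ν (gradEnergy * trans x g) := by
    refine tsum_eq_sum fun x hx => ?_
    have h3 := h1 x
    rw [ht' x hx, mul_zero] at h3
    have h4 : expect ν (0 : Obs C) = 0 := by simp [expect]
    linarith
  rw [Finset.sum_congr rfl fun x _ => h1 x, ← Finset.mul_sum, ← h2, ← inner_cls hG hg,
    cls_gradEnergy, inner_zero_left, mul_zero]

/-- The Dirichlet form of `a ω₀² + Γ_g` splits. -/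
lemma dirichlet_eq (hg : IsLocal ν g) (lam gam a : ℝ) :
    dirichlet ν lam gam a g = energy ν lam gam g + 2 * lam * a ^ 2 := by
  have hG : IsLocal ν (gradEnergy : Obs C) := isLocal_gradEnergy
  have hE : IsLocal ν (gradExch g) := hg.gradMove isMove_exch
  have h1 : expect ν (fun m ω => gradFlip g m ω ^ 2) = -2 * starProd ν g (genMove flipSite g) := by
    rw [← expect_gradMove_mul isMove_flipSite hg hg]
    congr 1; funext m ω; simp only [gradFlip_eq, Pi.mul_apply, sq]
  have h2 : expect ν (gradExch g * gradExch g) = -2 * starProd ν g (genMove exch g) := by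
    rw [← expect_gradMove_mul isMove_exch hg hg]; rfl
  have h3 : expect ν (fun m ω => (a * (ω 1 ^ 2 - ω 0 ^ 2) + gradExch g m ω) ^ 2) =
      a ^ 2 * expect ν ((gradEnergy : Obs C) * gradEnergy) +
        2 * a * expect ν (gradEnergy * gradExch g) + expect ν (gradExch g * gradExch g) := by
    unfold expect
    rw [← integral_const_mul, ← integral_const_mul]
    have i1 := (hG.integrable_mul hG).const_mul (a ^ 2)
    have i2 := (hG.integrable_mul hE).const_mul (2 * a)
    refine Eq.trans ?_ ((integral_add (i1.add i2) (hE.integrable_mul hE)).trans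
      (congrArg₂ (· + ·) (integral_add i1 i2) rfl))
    refine integral_congr_ae (Eventually.of_forall fun p => ?_)
    simp only [Pi.add_apply, gradEnergy]
    ring
  rw [dirichlet, h1, h3, expect_gradEnergy_sq, expect_gradEnergy_mul_gradExch hg, h2,
    energy_eq ν hg]
  ring

end FirstMoment

end DisorderedChain

/-- The Hilbert space completion of a real vector space for a semi-inner product. -/
lemma exists_hilbert_completion.{u} {V : Type u} [AddCommGroup V] [Module ℝ V]
    (b : V →ₗ[ℝ] V →ₗ[ℝ] ℝ)
    (hsymm : ∀ f g, b f g = b g f) (hpos : ∀ f, 0 ≤ b f f) :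
    ∃ (K : Type u) (_ : NormedAddCommGroup K) (_ : InnerProductSpace ℝ K) (_ : CompleteSpace K)
      (i : V →ₗ[ℝ] K), DenseRange i ∧ ∀ f g, inner ℝ (i f) (i g) = b f g := by
  let core : PreInnerProductSpace.Core ℝ V :=
    { inner f g := b f g
      conj_inner_symm f g := hsymm g f
      re_inner_nonneg f := hpos f
      add_left f g h := by simp
      smul_left f g c := by simp }
  let : SeminormedAddCommGroup V := InnerProductSpace.Core.toSeminormedAddCommGroup (𝕜 := ℝ)
  let : InnerProductSpace ℝ V := .ofCore core
  refine ⟨UniformSpace.Completion V, inferInstance, inferInstance, inferInstance,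
    (UniformSpace.Completion.toComplₗᵢ (𝕜 := ℝ) (E := V)).toLinearMap,
    UniformSpace.Completion.denseRange_coe, fun f g => ?_⟩
  exact UniformSpace.Completion.inner_coe f g

/-- The resolvent limit without assuming that the range of `J` is dense. -/
lemma exists_resolvent_limit_of_completeSpace {V : Type*} [AddCommGroup V] [Module ℝ V]
    {E : Type*} [NormedAddCommGroup E] [InnerProductSpace ℝ E] [CompleteSpace E]
    {K : Type*} [NormedAddCommGroup K] [InnerProductSpace ℝ K] [CompleteSpace K]
    (J : V →ₗ[ℝ] E) (i : V →ₗ[ℝ] K) (hi : DenseRange i)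
    (A S : V →ₗ[ℝ] V) (j : V) {c : ℝ}
    (hS : ∀ f g, inner ℝ (i f) (i g) = -inner ℝ (J (S f)) (J g))
    (hc : ∀ f, ‖i f‖ ≤ c * ‖J f‖)
    {B : K →L[ℝ] K} (hB : ∀ x y, inner ℝ (B x) y = -inner ℝ x (B y))
    (hBA : ∀ f g, inner ℝ (B (i f)) (i g) = inner ℝ (J (A f)) (J g))
    {k h : K} (hk : ∀ f, inner ℝ k (i f) = inner ℝ (J j) (J f)) (hh : h - B h = k) :
    ∃ u : ℝ → E, (∀ z, 0 < z → (u z, z • u z - J j) ∈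
          closure (Set.range fun f => (J f, J (S f + A f)))) ∧
        Tendsto (fun z => inner ℝ (J j) (u z)) (𝓝[>] 0) (𝓝 (‖h‖ ^ 2)) := by
  -- Classes of 𝒬 need not be dense in L²_⋆; the resolvent is solved inside their closure, which the
  -- dynamics preserves.
  set H := (LinearMap.range J).topologicalClosure with hH
  have hmem : ∀ f, J f ∈ H := fun f =>
    (LinearMap.range J).le_topologicalClosure (LinearMap.mem_range_self J f)
  have : CompleteSpace H := (LinearMap.range J).isClosed_topologicalClosure.completeSpace_coe
  have hd : DenseRange (J.codRestrict H hmem) := by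
    rintro ⟨x, hx⟩
    rw [closure_subtype, ← Set.range_comp]
    exact hx
  obtain ⟨u, hu, hlim⟩ := exists_resolvent_limit (J.codRestrict H hmem) hd i hi A S j (c := c)
    hS hc hB hBA hk hh
  refine ⟨fun z => u z, fun z hz => ?_, hlim⟩
  refine map_mem_closure (f := fun p : H × H => ((p.1 : E), (p.2 : E))) (by fun_prop) (hu z hz) ?_
  rintro _ ⟨f, rfl⟩
  exact ⟨f, rfl⟩

namespace DisorderedChain

/-! ### The three diffusion coefficients rewritten as problems on `K`. -/

section Variational

variable {C : ℝ} {ν : Measure (Set.Icc C⁻¹ C)} [IsProbabilityMeasure ν]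

lemma isLocal_quadV (f : quadV C) : IsLocal ν (f : Obs C) :=
  isLocal_of_mem_quadP (quadV_le_quadP f.2)

lemma quadratic_eq : quadratic C = (quadV C : Set (Obs C)) :=
  Set.ext fun _ => mem_quadV_iff.symm

lemma iSup_quadratic (F : Obs C → EReal) : ⨆ g ∈ quadratic C, F g = ⨆ g : quadV C, F g := by
  rw [quadratic_eq]
  exact iSup_subtype'

lemma iInf_quadratic (F : Obs C → EReal) : ⨅ g ∈ quadratic C, F g = ⨅ g : quadV C, F g := by
  rw [quadratic_eq]
  exact iInf_subtype'

/-- The symmetric part of the generator on `𝒬`. -/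
noncomputable def genSV (ν : Measure (Set.Icc C⁻¹ C)) [IsProbabilityMeasure ν] (lam gam : ℝ) :
    quadV C →ₗ[ℝ] quadV C where
  toFun f := ⟨genS lam gam f, genS_mem_quadV ν lam gam f.2⟩
  map_add' f g := Subtype.ext (genS_add (isLocal_quadV (ν := ν) f) (isLocal_quadV g) lam gam)
  map_smul' c f := Subtype.ext (genS_smul lam gam c (f : Obs C))

/-- The Hamiltonian part of the generator on `𝒬`. -/
noncomputable def genAV (ν : Measure (Set.Icc C⁻¹ C)) [IsProbabilityMeasure ν] (hC : 0 < C) :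
    quadV C →ₗ[ℝ] quadV C where
  toFun f := ⟨genA f, genA_mem_quadV ν hC f.2⟩
  map_add' f g := Subtype.ext (genA_add (isLocal_quadV (ν := ν) f) (isLocal_quadV g)
    (isSmooth_of_mem_quadP ν (quadV_le_quadP f.2)) (isSmooth_of_mem_quadP ν (quadV_le_quadP g.2)))
  map_smul' c f := Subtype.ext (genA_smul c (f : Obs C))

/-- The class map on `𝒬`. -/
noncomputable def clsV (ν : Measure (Set.Icc C⁻¹ C)) [IsProbabilityMeasure ν] :
    quadV C →ₗ[ℝ] HilbertStar ν where
  toFun f := cls ν f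
  map_add' f g := cls_add (isLocal_quadV f) (isLocal_quadV g)
  map_smul' c f := cls_smul c (isLocal_quadV f)

/-- The symmetric form `-≪f, 𝒮 g≫_⋆` on `𝒬`. -/
noncomputable def energyForm (ν : Measure (Set.Icc C⁻¹ C)) [IsProbabilityMeasure ν]
    (lam gam : ℝ) : quadV C →ₗ[ℝ] quadV C →ₗ[ℝ] ℝ :=
  -(((innerₗ (HilbertStar ν)).compl₂ (clsV ν ∘ₗ genSV ν lam gam)) ∘ₗ clsV ν)

lemma inner_clsV (f g : quadV C) :
    inner ℝ (clsV ν f) (clsV ν g) = starProd ν (f : Obs C) (g : Obs C) :=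
  inner_cls (isLocal_quadV f) (isLocal_quadV g)

lemma energyForm_apply (lam gam : ℝ) (f g : quadV C) : energyForm ν lam gam f g =
    -starProd ν (f : Obs C) (genS lam gam g) :=
  congrArg Neg.neg (inner_clsV f (genSV ν lam gam g))

lemma energyForm_comm (lam gam : ℝ) (f g : quadV C) :
    energyForm ν lam gam f g = energyForm ν lam gam g f := by
  rw [energyForm_apply, energyForm_apply, starProd_genS_comm (isLocal_quadV f) (isLocal_quadV g),
    ((isLocal_quadV f).genS lam gam).star_comm (isLocal_quadV g)]

variable {K : Type*} [NormedAddCommGroup K] [InnerProductSpace ℝ K] {lam gam : ℝ}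
  {i : quadV C →ₗ[ℝ] K}

/-- The Dirichlet form splits, so the supremum decouples: over g it is ‖x‖², attained in the limit i
g → x, and over a it is that of 2as - 2λa², attained at a = s/(2λ). -/
lemma tripleNormSq_eq (hlam : 0 < lam) (hi : DenseRange i)
    (hiE : ∀ f g, inner ℝ (i f) (i g) = energyForm ν lam gam f g) {φ : Obs C} {x : K}
    (hφ : ∀ g : quadV C, starProd ν φ g = inner ℝ x (i g)) : tripleNormSq ν lam gam φ =
      ((‖x‖ ^ 2 + starStar ν φ ^ 2 / (2 * lam) : ℝ) : EReal) := by
  set s := starStar ν φ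
  have hd : DenseRange (Prod.map i (id : ℝ → ℝ)) := hi.prodMap Function.surjective_id.denseRange
  have h := iSup_coe_eq_of_denseRange hd
    (F := fun p : K × ℝ => 2 * inner ℝ x p.1 + 2 * p.2 * s - (‖p.1‖ ^ 2 + 2 * lam * p.2 ^ 2))
    (by fun_prop) (y := (x, s / (2 * lam))) fun p => by
      have h1 := norm_sub_sq_real x p.1
      have h2 : 2 * (s / (2 * lam)) * s - 2 * lam * (s / (2 * lam)) ^ 2 =
          2 * p.2 * s - 2 * lam * p.2 ^ 2 + 2 * lam * (p.2 - s / (2 * lam)) ^ 2 := by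
        field_simp; ring
      have h3 : 0 ≤ 2 * lam * (p.2 - s / (2 * lam)) ^ 2 := by positivity
      simp only [real_inner_self_eq_norm_sq]
      nlinarith [sq_nonneg ‖x - p.1‖]
  rw [iSup_prod] at h
  rw [tripleNormSq, iSup_quadratic]
  refine Eq.trans (iSup_congr fun g => iSup_congr fun a => ?_) (h.trans ?_)
  · rw [dirichlet_eq (isLocal_quadV g), hφ]
    simp only [Prod.map_apply, id_eq]
    rw [← real_inner_self_eq_norm_sq (i g), hiE, energyForm_apply, energy]
  · simp only [real_inner_self_eq_norm_sq]
    congr 1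
    field_simp
    ring

variable {B : K →L[ℝ] K} {k : K} (hC : 0 < C)
  (hiE : ∀ f g, inner ℝ (i f) (i g) = energyForm ν lam gam f g)
  (hBA : ∀ f g : quadV C, inner ℝ (B (i f)) (i g) = starProd ν (genA f) g)
  (hk : ∀ f : quadV C, inner ℝ k (i f) = starProd ν currentA f)

include hC hiE hBA hk

/-- The supremum over g is that of 2⟨k - B(i f), y⟩ - ‖y‖², reached at y = k - B(i f). -/
lemma minimaxD_eq (hi : DenseRange i) : minimaxD ν lam gam =
    (lam : EReal) + ((1 / compressibility : ℝ) : EReal) *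
      ⨅ f, ((‖i f‖ ^ 2 + ‖k - B (i f)‖ ^ 2 : ℝ) : EReal) := by
  rw [minimaxD, iInf_quadratic]
  congr 2
  refine iInf_congr fun f => ?_
  rw [iSup_quadratic]
  have h := iSup_coe_eq_of_denseRange hi
    (F := fun y => ‖i f‖ ^ 2 + 2 * inner ℝ (k - B (i f)) y - ‖y‖ ^ 2) (by fun_prop)
    (y := k - B (i f)) fun y => by
      have := norm_sub_sq_real (k - B (i f)) y
      rw [real_inner_self_eq_norm_sq]
      nlinarith [sq_nonneg ‖k - B (i f) - y‖]
  have hneg : ∀ g : quadV C, starProd ν (g : Obs C) (-genS lam gam g) = ‖i g‖ ^ 2 := fun g => by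
    rw [← real_inner_self_eq_norm_sq, hiE, energyForm_apply, ← neg_one_smul ℝ (genS lam gam _),
      star_smul_right, neg_one_mul]
  have hA : IsLocal ν (genA (f : Obs C)) := isLocal_quadV (genAV ν hC f)
  refine Eq.trans (iSup_congr fun g => ?_) (h.trans ?_)
  · rw [hneg, hneg, inner_sub_left, hk, hBA, ← inner_cls ((isLocal_currentA hC).sub
      hA) (isLocal_quadV g), cls_sub (isLocal_currentA hC) hA, inner_sub_left,
      inner_cls (isLocal_currentA hC) (isLocal_quadV g), inner_cls hA (isLocal_quadV g)]
  · rw [real_inner_self_eq_norm_sq]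
    congr 1
    ring

/-- One formula for both norms: (b, a) = (λ, -1) gives j⋆ - ℒ⋆f, and a = 1 with b equal to λ minus
the candidate coefficient gives the non-gradient expression. -/
lemma starProd_combination (b a : ℝ) (f g : quadV C) :
    starProd ν ((b • gradEnergy + a • currentA) + (a • -genA (f : Obs C) - genS lam gam f)) g =
      inner ℝ (a • k + i f - a • B (i f)) (i g) := by
  have hG : IsLocal ν (gradEnergy : Obs C) := isLocal_gradEnergy
  have hj : IsLocal ν (currentA : Obs C) := isLocal_currentA hC
  have hA : IsLocal ν (genA (f : Obs C)) := isLocal_quadV (genAV ν hC f)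
  have hA' : IsLocal ν (-genA (f : Obs C)) := neg_one_smul ℝ (genA (f : Obs C)) ▸ hA.smul (-1)
  have hS : IsLocal ν (genS lam gam (f : Obs C)) := isLocal_quadV (genSV ν lam gam f)
  have hg : IsLocal ν (g : Obs C) := isLocal_quadV g
  have e : cls ν (-genA (f : Obs C)) = -cls ν (genA (f : Obs C)) := by
    rw [← neg_one_smul ℝ (genA (f : Obs C)), cls_smul _ hA, neg_one_smul]
  rw [← inner_cls (((hG.smul b).add (hj.smul a)).add ((hA'.smul a).sub hS)) hg,
    cls_add ((hG.smul b).add (hj.smul a)) ((hA'.smul a).sub hS), cls_add (hG.smul b) (hj.smul a),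
    cls_sub (hA'.smul a) hS, cls_smul _ hG, cls_smul _ hj, cls_smul _ hA', cls_gradEnergy, e]
  simp only [inner_add_left, inner_sub_left, real_inner_smul_left, inner_neg_left, smul_zero,
    zero_add]
  rw [inner_cls hj hg, inner_cls hA hg, inner_cls hS hg, hk, hBA, hiE, energyForm_apply,
    starProd_genS_comm (isLocal_quadV f) hg]
  ring

omit hBA hiE in
lemma starStar_combination (b a : ℝ) (f : quadV C) :
    starStar ν ((b • gradEnergy + a • currentA) + (a • -genA (f : Obs C) - genS lam gam f)) =
      2 * b - a * inner ℝ k (i f) := by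
  have hG : IsLocal ν (gradEnergy : Obs C) := isLocal_gradEnergy
  have hj : IsLocal ν (currentA : Obs C) := isLocal_currentA hC
  have hA : IsLocal ν (genA (f : Obs C)) := isLocal_quadV (genAV ν hC f)
  have hA' : IsLocal ν (-genA (f : Obs C)) := neg_one_smul ℝ (genA (f : Obs C)) ▸ hA.smul (-1)
  have hS : IsLocal ν (genS lam gam (f : Obs C)) := isLocal_quadV (genSV ν lam gam f)
  have e : starStar ν (-genA (f : Obs C)) = -starStar ν (genA (f : Obs C)) := by
    rw [← neg_one_smul ℝ (genA (f : Obs C)), starStar_smul, neg_one_mul]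
  rw [starStar_add ((hG.smul b).add (hj.smul a)) ((hA'.smul a).sub hS),
    starStar_add (hG.smul b) (hj.smul a), starStar_sub (hA'.smul a) hS, starStar_smul,
    starStar_smul, starStar_smul, e, starStar_gradEnergy, starStar_currentA hC,
    starStar_genA hC (quadV_le_quadP f.2), starStar_genS lam gam (quadV_le_quadP f.2), hk,
    (isLocal_quadV f).star_comm hj]
  ring

lemma normD_eq (hlam : 0 < lam) (hi : DenseRange i) : normD ν lam gam =
    ((1 / compressibility : ℝ) : EReal) *
      ⨅ f, ((‖i f + B (i f) - k‖ ^ 2 + (2 * lam + inner ℝ k (i f)) ^ 2 / (2 * lam) : ℝ) :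
        EReal) := by
  rw [normD, iInf_quadratic]
  congr 1
  refine iInf_congr fun f => ?_
  have e : (currentAdj lam - genAdj lam gam f : Obs C) = (lam • gradEnergy + (-1 : ℝ) • currentA) +
      ((-1 : ℝ) • -genA (f : Obs C) - genS lam gam f) := by
    simp only [currentAdj, genAdj, currentS, neg_smul, one_smul, neg_neg]
    abel
  rw [e, tripleNormSq_eq hlam hi hiE (starProd_combination hC hiE hBA hk lam (-1) f),
    starStar_combination hC hk]
  congr 3
  · simp only [neg_smul, one_smul]
    congr 1
    abel
  · ring

lemma isNonGradientCoeff_iff (hlam : 0 < lam) (hi : DenseRange i) (a : ℝ) :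
    IsNonGradientCoeff ν lam gam a ↔ ∀ ε : ℝ, 0 < ε → ∃ f, ‖k + i f - B (i f)‖ ^ 2 +
      (2 * (lam - a) - inner ℝ k (i f)) ^ 2 / (2 * lam) < ε := by
  have key : ∀ f : quadV C,
      tripleNormSq ν lam gam (current lam - a • gradEnergy - gen lam gam f) =
      ((‖k + i f - B (i f)‖ ^ 2 + (2 * (lam - a) - inner ℝ k (i f)) ^ 2 / (2 * lam) : ℝ) :
        EReal) := by
    intro f
    have e : (current lam - a • gradEnergy - gen lam gam f : Obs C) =
        ((lam - a) • gradEnergy + (1 : ℝ) • currentA) +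
        ((1 : ℝ) • -genA (f : Obs C) - genS lam gam f) := by
      simp only [current, gen, currentS, one_smul, sub_smul]
      abel
    rw [e, tripleNormSq_eq hlam hi hiE (starProd_combination hC hiE hBA hk (lam - a) 1 f),
      starStar_combination hC hk, one_smul, one_smul, one_mul]
  unfold IsNonGradientCoeff
  refine forall₂_congr fun ε _ => ⟨?_, ?_⟩
  · rintro ⟨f, hf, h⟩
    rw [quadratic_eq] at hf
    refine ⟨⟨f, hf⟩, ?_⟩
    rw [← EReal.coe_lt_coe_iff, ← key]
    exact h
  · rintro ⟨f, h⟩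
    refine ⟨f, mem_quadV_iff.1 f.2, ?_⟩
    rw [key, EReal.coe_lt_coe_iff]
    exact h

end Variational

end DisorderedChain

/-- Equality of the Green-Kubo coefficient and of the variational diffusion coefficient. -/
theorem mainTheorem3 (C : ℝ) (hC : 0 < C) (ν : Measure (Set.Icc C⁻¹ C)) [IsProbabilityMeasure ν]
    (lam gam : ℝ) (hlam : 0 < lam) (hgam : 0 < gam) :
    ∃ h : ℝ → DisorderedChain.HilbertStar ν,
      (∀ z : ℝ, 0 < z → ∀ u : DisorderedChain.HilbertStar ν,
        DisorderedChain.SolvesResolvent ν lam gam z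
          (DisorderedChain.toHilbert DisorderedChain.currentA
            (DisorderedChain.isLocal_currentA hC)) u ↔ u = h z) ∧
      ∃ D : ℝ,
        Tendsto (fun z : ℝ => lam + 1 / 2 * inner ℝ
            (DisorderedChain.toHilbert DisorderedChain.currentA
              (DisorderedChain.isLocal_currentA hC)) (h z))
          (𝓝[>] 0) (𝓝 D) ∧
        DisorderedChain.minimaxD ν lam gam = (D : EReal) ∧
        DisorderedChain.normD ν lam gam = (D : EReal) ∧
        ∀ a : ℝ, DisorderedChain.IsNonGradientCoeff ν lam gam a ↔ a = D := by
  open DisorderedChain in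
  -- The energy is only positive semidefinite on 𝒬, so the completion also identifies functions at
  -- zero energy distance.
  obtain ⟨K, _, _, _, i, hi, hiE⟩ := exists_hilbert_completion (energyForm ν lam gam)
    (energyForm_comm lam gam) fun f => by
      rw [energyForm_apply]
      exact neg_nonneg.2 (starProd_genS_nonpos (isLocal_quadV f) hlam.le hgam.le)
  have hnorm : ∀ f : quadV C, ‖i f‖ ^ 2 = energy ν lam gam f := fun f => by
    rw [← real_inner_self_eq_norm_sq, hiE, energyForm_apply, energy]
  have hsqrt : ∀ f : quadV C, √(energy ν lam gam f) = ‖i f‖ := fun f => by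
    rw [← hnorm, Real.sqrt_sq (norm_nonneg _)]
  obtain ⟨c, hc, hA⟩ := abs_starProd_genA_le ν hC hlam hgam
  obtain ⟨c', hj⟩ := abs_starProd_currentA_le ν hC hlam hgam
  let j : quadV C := ⟨currentA, currentA_mem_quadV hC⟩
  obtain ⟨B, hB, hBA⟩ := exists_antisymmetric_operator (clsV ν) i hi (genAV ν hC) hc
    (fun f g => by
      rw [inner_clsV, inner_clsV, eq_neg_iff_add_eq_zero, add_comm, ← eq_neg_iff_add_eq_zero]
      exact starProd_genA_left ν hC (quadV_le_quadP f.2) (quadV_le_quadP g.2))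
    (fun f g => by
      rw [inner_clsV, ← hsqrt, ← hsqrt]
      exact hA f g (quadV_le_quadP f.2) (quadV_le_quadP g.2))
  obtain ⟨k, hk⟩ := exists_inner_eq_of_bound i hi (innerₗ (HilbertStar ν) (clsV ν j) ∘ₗ clsV ν)
    (c := c') (fun f => by
      change |inner ℝ (clsV ν j) (clsV ν f)| ≤ _
      rw [inner_clsV, ← hsqrt]
      exact hj f (quadV_le_quadP f.2))
  replace hk : ∀ f, inner ℝ k (i f) = inner ℝ (clsV ν j) (clsV ν f) := hk
  -- This vector carries the whole theorem: ‖h‖² is the common value behind all four coefficients.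
  obtain ⟨h, hh⟩ := exists_sub_antisymm_eq hB k
  obtain ⟨u, hu, hlim⟩ := exists_resolvent_limit_of_completeSpace (clsV ν) i hi (genAV ν hC)
    (genSV ν lam gam) j (c := √(4 * gam + 14 * lam)) (fun f g => by
      rw [hiE, energyForm_comm, energyForm_apply, inner_clsV,
        (isLocal_quadV g).star_comm ((isLocal_quadV f).genS lam gam)]
      rfl)
    (fun f => by
      refine le_of_sq_le_sq ?_ (by positivity)
      rw [hnorm, mul_pow, Real.sq_sqrt (by positivity)]
      exact energy_le ν (quadV_le_quadP f.2) hlam.le hgam.le) hB hBA hk hh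
  have hcls : clsV ν j = toHilbert currentA (isLocal_currentA hC) :=
    cls_of_isLocal (isLocal_currentA hC)
  rw [hcls] at hlim
  have hsol : ∀ z, 0 < z → SolvesResolvent ν lam gam z
      (toHilbert currentA (isLocal_currentA hC)) (u z) := fun z hz => by
    have := hu z hz
    rw [hcls] at this
    refine closure_mono ?_ this
    rintro _ ⟨f, rfl⟩
    have hL : IsLocal ν (gen lam gam (f : Obs C)) :=
      (isLocal_quadV (genAV ν hC f)).add ((isLocal_quadV f).genS lam gam)
    refine ⟨f, isLocal_quadV f, hL, isSmooth_of_mem_quadP ν (quadV_le_quadP f.2), ?_⟩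
    refine Prod.ext (cls_of_isLocal (isLocal_quadV f)) ?_
    rw [← cls_of_isLocal hL, gen, add_comm]
    rfl
  have hBA' : ∀ f g : quadV C, inner ℝ (B (i f)) (i g) = starProd ν (genA f) g := fun f g => by
    rw [hBA, inner_clsV]; rfl
  have hk' : ∀ f : quadV C, inner ℝ k (i f) = starProd ν currentA f := fun f => by
    rw [hk, inner_clsV]
  -- Existence was obtained in the closed span of 𝒬, whereas uniqueness holds in all of L²_⋆, so the
  -- solution found is the resolvent.
  refine ⟨u, fun z hz v => ⟨fun hv => hv.unique hlam.le hgam.le hz (hsol z hz), ?_⟩,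
    lam + 1 / 2 * ‖h‖ ^ 2, (hlim.const_mul _).const_add _, ?_, ?_, fun a => ?_⟩
  · rintro rfl
    exact hsol z hz
  · rw [minimaxD_eq hC hiE hBA' hk' hi, iInf_norm_sq_add_norm_sub_sq hi hB hh, compressibility_eq]
    norm_cast
  -- Here the infimum is 2λ + ‖h‖², and χ(1) = 2.
  · rw [normD_eq hC hiE hBA' hk' hlam hi, iInf_norm_add_sub_sq hi hB hh hlam, compressibility_eq,
      ← EReal.coe_mul]
    congr 1
    ring
  -- The condition reads 2(λ - a) = -‖h‖².
  · rw [isNonGradientCoeff_iff hC hiE hBA' hk' hlam hi,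
      forall_exists_norm_add_sq_lt_iff hi hB hh hlam]
    constructor <;> intro _ <;> linarith
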